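/- Let $\pi:P\to M$ be a smooth principal $\mathrm{SU}(2)$-bundle (with right action) over a smooth 3-manifold $M$, with $P$ and $M$ oriented (independently, each by a nowhere vanishing smooth form of top degree), and let $V=\ker d\pi\subset TP$. Identify $V_p$ with $\mathfrak{su}(2)$ by $X\mapsto\frac{d}{dt}\big|_{0}\,p\cdot e^{tX}$ and put the invariant inner product $\langle X,Y\rangle=-2\,\mathrm{Tr}(XY)$ on $\mathfrak{su}(2)$. For a 3-form $\Omega$ on $P$ and a volume form $v$ in the orientation class of $P$ let $K_\Omega$ be the endomorphism of $T^*P$ with $i_\xi(K_\Omega\alpha)=\alpha\wedge i_\xi\Omega\wedge\Omega/v$ for all $\xi\in TP$, let $\lambda(\Omega)=\frac16\mathrm{Tr}(K_\Omega^2)$ and $J_\Omega=K_\Omega/\sqrt{-\lambda(\Omega)}$ where $\lambda(\Omega)<0$; $J_\Omega$ acts on $TP$ by transposition. Let $W$ be a negative definite connection on $P$, i.e. a smooth $\mathfrak{su}(2)$-valued connection 1-form on $P$ whose Chern-Simons form $$\Omega=CS(W)=\mathrm{Tr}\Big(W\wedge dW+\tfrac23\,W\wedge W\wedge W\Big)$$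 is at every point stable of negative type, i.e. lies in the $\mathrm{GL}(6,\mathbb R)$-orbit of $2\,\mathrm{Re}(dz_1\wedge dz_2\wedge dz_3)$. Let $J_W=J_\Omega$. Then $J_W^2=-1$, i.e. $J_W$ is an almost-complex structure, and: 1. $W$ is the connection determined by $J_W$: $W$ is the unique connection form on $P$ whose horizontal spaces are the images $J_W(V_p)$ of the vertical ones. 2. There is a unique smooth $\mathfrak{su}(2)$-valued basic (i.e. horizontal and $\mathrm{SU}(2)$-equivariant) 1-form $E_W$ on $P$ with $$F(W)=dW+W\wedge W=E_W\wedge E_W$$ such that $-\mathrm{Tr}(E_W\wedge E_W\wedge E_W)$ is the pullback of a positive volume form on the oriented manifold $M$ (without the condition on the orientation, $-E_W$ is a solution as well). 3. There is a unique metric $g$ on $M$ determined by $J_W$, i.e. with $g(d\pi\,\xi,d\pi\,\eta)=\langle J_W\xi,J_W\eta\rangle$ for all $p\in P$ and $\xi,\eta\in J_W(V_p)$; it is a smooth Riemannian metric, and $E_W$ is a frame for it: $\pi^*g=-2\,\mathrm{Tr}(E_W\otimes E_W)$. -/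

import Mathlib

open scoped Manifold ContDiff Matrix Matrix.Norms.L2Operator

noncomputable section

/-! ### The group `SU(2)` and its Lie algebra -/

/-- Complex `2 × 2` matrices. -/
abbrev Mat2 : Type := Matrix (Fin 2) (Fin 2) ℂ

/-- The group `SU(2)`. -/
abbrev SU2 : Type := Matrix.specialUnitaryGroup (Fin 2) ℂ

namespace SU2

theorem star_mul_self (g : SU2) : star (g : Mat2) * (g : Mat2) = 1 :=
  (Matrix.mem_unitaryGroup_iff').1 (Matrix.mem_specialUnitaryGroup_iff.1 g.2).1

theorem det_eq_one (g : SU2) : (g : Mat2).det = 1 :=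
  (Matrix.mem_specialUnitaryGroup_iff.1 g.2).2

theorem star_eq_adjugate (g : SU2) : star (g : Mat2) = (g : Mat2).adjugate := by
  have h1 : (g : Mat2) * (g : Mat2).adjugate = 1 := by
    rw [Matrix.mul_adjugate, det_eq_one, one_smul]
  calc star (g : Mat2) = star (g : Mat2) * ((g : Mat2) * (g : Mat2).adjugate) := by
        rw [h1, mul_one]
    _ = (g : Mat2).adjugate := by rw [← mul_assoc, star_mul_self, one_mul]

theorem entry_one_one (g : SU2) : (g : Mat2) 1 1 = star ((g : Mat2) 0 0) := by
  have h := congrFun (congrFun (star_eq_adjugate g) 0) 0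
  simpa [Matrix.adjugate_fin_two, Matrix.star_apply] using h.symm

theorem entry_zero_one (g : SU2) : (g : Mat2) 0 1 = - star ((g : Mat2) 1 0) := by
  have h := congrFun (congrFun (star_eq_adjugate g) 0) 1
  simp only [Matrix.adjugate_fin_two, Matrix.star_apply] at h
  rw [h]; simp

/-- The first column of an element of `SU(2)`, as a vector in `ℝ⁴`. -/
def toVec (g : SU2) : EuclideanSpace ℝ (Fin 4) :=
  !₂[((g : Mat2) 0 0).re, ((g : Mat2) 0 0).im, ((g : Mat2) 1 0).re, ((g : Mat2) 1 0).im]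

theorem toVec_mem (g : SU2) : toVec g ∈ Metric.sphere (0 : EuclideanSpace ℝ (Fin 4)) 1 := by
  have h := det_eq_one g
  rw [Matrix.det_fin_two, entry_one_one, entry_zero_one] at h
  have h' := congrArg Complex.re h
  simp [Complex.mul_re] at h'
  rw [mem_sphere_zero_iff_norm, EuclideanSpace.norm_eq, Real.sqrt_eq_one]
  simp [toVec, Fin.sum_univ_four]
  nlinarith

/-- The matrix of determinant `|x|²` with given first column. -/
def ofVecMat (x : EuclideanSpace ℝ (Fin 4)) : Mat2 :=
  !![⟨x 0, x 1⟩, -⟨x 2, -x 3⟩; ⟨x 2, x 3⟩, ⟨x 0, -x 1⟩]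

theorem ofVecMat_mem (x : EuclideanSpace ℝ (Fin 4))
    (hx : x ∈ Metric.sphere (0 : EuclideanSpace ℝ (Fin 4)) 1) :
    ofVecMat x ∈ Matrix.specialUnitaryGroup (Fin 2) ℂ := by
  rw [mem_sphere_zero_iff_norm, EuclideanSpace.norm_eq, Real.sqrt_eq_one] at hx
  simp [Fin.sum_univ_four] at hx
  rw [Matrix.mem_specialUnitaryGroup_iff, Matrix.mem_unitaryGroup_iff]
  constructor
  · ext i j
    fin_cases i <;> fin_cases j <;>
      simp [ofVecMat, Matrix.mul_apply, Fin.sum_univ_two, Matrix.star_apply, Complex.ext_iff] <;>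
      exact ⟨by nlinarith, by ring⟩
  · rw [Matrix.det_fin_two, Complex.ext_iff]
    simp [ofVecMat]
    constructor
    · nlinarith
    · ring

/-- `SU(2)` is the unit sphere `S³`. -/
def homeoSphere : SU2 ≃ₜ Metric.sphere (0 : EuclideanSpace ℝ (Fin 4)) 1 where
  toFun g := ⟨toVec g, toVec_mem g⟩
  invFun x := ⟨ofVecMat x, ofVecMat_mem x x.2⟩
  left_inv g := by
    apply Subtype.ext
    ext i j
    fin_cases i <;> fin_cases j <;>
      simp [ofVecMat, toVec, entry_one_one, entry_zero_one, Complex.ext_iff]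
  right_inv x := by
    apply Subtype.ext
    ext i
    fin_cases i <;> simp [ofVecMat, toVec]
  continuous_toFun := by
    refine Continuous.subtype_mk ?_ _
    have h : ∀ i j, Continuous fun g : SU2 => (g : Mat2) i j := fun i j =>
      (continuous_apply_apply i j).comp continuous_subtype_val
    refine (PiLp.continuous_toLp 2 _).comp (continuous_pi fun i => ?_)
    fin_cases i
    · exact Complex.continuous_re.comp (h 0 0)
    · exact Complex.continuous_im.comp (h 0 0)
    · exact Complex.continuous_re.comp (h 1 0)
    · exact Complex.continuous_im.comp (h 1 0)
  continuous_invFun := by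
    refine Continuous.subtype_mk ?_ _
    have : Continuous ofVecMat := by
      have h : ∀ i, Continuous fun x : EuclideanSpace ℝ (Fin 4) => ((x i : ℝ) : ℂ) :=
        fun i => by fun_prop
      have h' : ofVecMat = fun x => !![(x 0 : ℂ) + x 1 * Complex.I, -(x 2 - x 3 * Complex.I);
          (x 2 : ℂ) + x 3 * Complex.I, x 0 - x 1 * Complex.I] := by
        ext x i j
        fin_cases i <;> fin_cases j <;> simp [ofVecMat, Complex.ext_iff]
      rw [h']
      refine continuous_matrix fun i j => ?_
      fin_cases i <;> fin_cases j <;> simp <;> fun_prop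
    exact this.comp continuous_subtype_val

/-- The manifold structure of `SU(2)`, carried over from `S³`. -/
instance : ChartedSpace (EuclideanSpace ℝ (Fin 3)) SU2 where
  atlas := (fun c => homeoSphere.toOpenPartialHomeomorph.trans c) ''
    atlas (EuclideanSpace ℝ (Fin 3)) (Metric.sphere (0 : EuclideanSpace ℝ (Fin 4)) 1)
  chartAt g := homeoSphere.toOpenPartialHomeomorph.trans
    (chartAt (EuclideanSpace ℝ (Fin 3)) (homeoSphere g))
  mem_chart_source g := by
    rw [OpenPartialHomeomorph.trans_source]
    exact ⟨trivial, mem_chart_source (EuclideanSpace ℝ (Fin 3)) (homeoSphere g)⟩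
  chart_mem_atlas g := ⟨_, chart_mem_atlas _ _, rfl⟩

theorem chartAt_eq (g : SU2) : chartAt (EuclideanSpace ℝ (Fin 3)) g =
    homeoSphere.toOpenPartialHomeomorph.trans
      (chartAt (EuclideanSpace ℝ (Fin 3)) (homeoSphere g)) := rfl

instance : Fact (Module.finrank ℝ (EuclideanSpace ℝ (Fin 4)) = 3 + 1) := ⟨by simp⟩

theorem contMDiff_homeoSphere : ContMDiff (𝓡 3) (𝓡 3) ∞ homeoSphere := by
  intro g
  have h := (contMDiff_id (I := 𝓡 3) (n := ∞)
    (M := Metric.sphere (0 : EuclideanSpace ℝ (Fin 4)) 1)) (homeoSphere g)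
  rw [contMDiffAt_iff] at h ⊢
  refine ⟨homeoSphere.continuous.continuousAt, ?_⟩
  convert h.2 using 1
  · funext y
    simp [extChartAt, chartAt_eq]
  · rfl

theorem contMDiff_homeoSphere_symm : ContMDiff (𝓡 3) (𝓡 3) ∞ homeoSphere.symm := by
  intro x
  have h := (contMDiff_id (I := 𝓡 3) (n := ∞)
    (M := Metric.sphere (0 : EuclideanSpace ℝ (Fin 4)) 1)) x
  rw [contMDiffAt_iff] at h ⊢
  refine ⟨homeoSphere.symm.continuous.continuousAt, ?_⟩
  convert h.2 using 1
  funext y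
  simp [extChartAt, chartAt_eq]

instance : IsManifold (𝓡 3) ∞ SU2 where
  compatible := by
    rintro _ _ ⟨c, hc, rfl⟩ ⟨c', hc', rfl⟩
    have h := (contDiffGroupoid ∞ (𝓡 3)).compatible hc hc'
    refine (contDiffGroupoid ∞ (𝓡 3)).mem_of_eqOnSource h ⟨?_, fun y _ => ?_⟩
    · ext y; simp
    · simp

theorem contDiff_ofVecMat : ContDiff ℝ ∞ ofVecMat := by
  have h : ofVecMat = fun x => x 0 • (!![1, 0; 0, 1] : Mat2) +
      x 1 • (!![Complex.I, 0; 0, -Complex.I] : Mat2) + x 2 • (!![0, -1; 1, 0] : Mat2) +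
      x 3 • (!![0, Complex.I; Complex.I, 0] : Mat2) := by
    ext x i j
    fin_cases i <;> fin_cases j <;> simp [ofVecMat, Complex.ext_iff]
  rw [h]
  fun_prop

/-- The inclusion of `SU(2)` in the space of matrices is smooth. -/
theorem contMDiff_coe : ContMDiff (𝓡 3) 𝓘(ℝ, Mat2) ∞ (fun g : SU2 => (g : Mat2)) := by
  have h : (fun g : SU2 => (g : Mat2)) = fun g => ofVecMat (homeoSphere g) := by
    funext g
    exact congrArg Subtype.val (homeoSphere.left_inv g).symm
  rw [h]
  exact contDiff_ofVecMat.contMDiff.comp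
    ((contMDiff_coe_sphere (m := ∞)).comp contMDiff_homeoSphere)

/-- A map to `SU(2)` is smooth if it is smooth as a map to the space of matrices. -/
theorem contMDiff_of_coe {E H X : Type*} [NormedAddCommGroup E] [NormedSpace ℝ E]
    [TopologicalSpace H] {I : ModelWithCorners ℝ E H} [TopologicalSpace X] [ChartedSpace H X]
    [IsManifold I ∞ X] {f : X → SU2} (hf : ContMDiff I 𝓘(ℝ, Mat2) ∞ fun x => (f x : Mat2)) :
    ContMDiff I (𝓡 3) ∞ f := by
  have hv : ContMDiff I 𝓘(ℝ, EuclideanSpace ℝ (Fin 4)) ∞ fun x => toVec (f x) := by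
    have he : ∀ i j, ContDiff ℝ ∞ fun A : Mat2 => A i j := fun i j =>
      (LinearMap.toContinuousLinearMap (Matrix.entryLinearMap ℝ ℂ i j)).contDiff
    have hc : ContDiff ℝ ∞ fun A : Mat2 =>
        (!₂[(A 0 0).re, (A 0 0).im, (A 1 0).re, (A 1 0).im] : EuclideanSpace ℝ (Fin 4)) := by
      rw [contDiff_euclidean]
      intro i
      fin_cases i
      · exact Complex.reCLM.contDiff.comp (he 0 0)
      · exact Complex.imCLM.contDiff.comp (he 0 0)
      · exact Complex.reCLM.contDiff.comp (he 1 0)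
      · exact Complex.imCLM.contDiff.comp (he 1 0)
    exact hc.contMDiff.comp hf
  have h2 := contMDiff_homeoSphere_symm.comp
    (ContMDiff.codRestrict_sphere (n := 3) hv fun x => toVec_mem (f x))
  convert h2 using 1
  funext x
  exact (homeoSphere.left_inv (f x)).symm

instance : LieGroup (𝓡 3) ∞ SU2 where
  contMDiff_mul := contMDiff_of_coe <| by
    have h : ContDiff ℝ ∞ fun z : Mat2 × Mat2 => z.1 * z.2 := contDiff_fst.mul contDiff_snd
    have h' : ContMDiff (𝓘(ℝ, Mat2).prod 𝓘(ℝ, Mat2)) 𝓘(ℝ, Mat2) ∞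
        fun z : Mat2 × Mat2 => z.1 * z.2 := by
      rw [contMDiff_iff]
      exact ⟨continuous_mul, fun x y => h.contDiffOn⟩
    exact h'.comp (contMDiff_coe.prodMap contMDiff_coe)
  contMDiff_inv := contMDiff_of_coe <| by
    have h : ContDiff ℝ ∞ fun z : Mat2 => star z :=
      (LinearMap.toContinuousLinearMap (starLinearEquiv ℝ (A := Mat2)).toLinearMap).contDiff
    exact h.contMDiff.comp contMDiff_coe

end SU2

/-- The Lie algebra `su(2)` of traceless anti-Hermitian matrices. -/
def su2 : Submodule ℝ Mat2 where
  carrier := {X | star X = -X ∧ X.trace = 0}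
  add_mem' := by
    rintro X Y ⟨h1, h2⟩ ⟨h3, h4⟩
    exact ⟨by rw [star_add, h1, h3]; abel, by rw [Matrix.trace_add, h2, h4, add_zero]⟩
  zero_mem' := ⟨by simp, by simp⟩
  smul_mem' := by
    rintro c X ⟨h1, h2⟩
    exact ⟨by rw [star_smul, h1]; simp, by rw [Matrix.trace_smul, h2, smul_zero]⟩

namespace su2

theorem exp_mem {X : Mat2} (hX : X ∈ su2) :
    NormedSpace.exp X ∈ Matrix.specialUnitaryGroup (Fin 2) ℂ := by
  obtain ⟨h1, h2⟩ := hX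
  have hinv : NormedSpace.exp X * NormedSpace.exp (-X) = 1 := by
    rw [← Matrix.exp_add_of_commute _ _ (Commute.neg_right (Commute.refl X)), add_neg_cancel,
      NormedSpace.exp_zero]
  have hinv' : NormedSpace.exp (-X) * NormedSpace.exp X = 1 := by
    rw [← Matrix.exp_add_of_commute _ _ (Commute.neg_left (Commute.refl X)), neg_add_cancel,
      NormedSpace.exp_zero]
  rw [Matrix.mem_specialUnitaryGroup_iff, Matrix.mem_unitaryGroup_iff]
  refine ⟨?_, ?_⟩
  · have : star (NormedSpace.exp X) = NormedSpace.exp (-X) := by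
      rw [← h1]; exact (Matrix.exp_conjTranspose X).symm
    rw [this, hinv]
  · have key : ∀ A : Mat2, A.adjugate = !![0, 1; -1, 0] * Aᵀ * !![0, -1; 1, 0] := by
      intro A
      ext i j
      fin_cases i <;> fin_cases j <;>
        simp [Matrix.adjugate_fin_two, Matrix.mul_apply, Matrix.vecMul, dotProduct,
          Fin.sum_univ_two]
    let U : Mat2ˣ := ⟨!![0, 1; -1, 0], !![0, -1; 1, 0],
      by ext i j; fin_cases i <;> fin_cases j <;> simp [Matrix.mul_apply, Fin.sum_univ_two],
      by ext i j; fin_cases i <;> fin_cases j <;> simp [Matrix.mul_apply, Fin.sum_univ_two]⟩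
    have hadj : X.adjugate = -X := by
      rw [Matrix.trace_fin_two] at h2
      have h3 : X 1 1 = - X 0 0 := by linear_combination h2
      ext i j
      fin_cases i <;> fin_cases j <;> simp [Matrix.adjugate_fin_two, h3]
    have h4 : (NormedSpace.exp X).adjugate = NormedSpace.exp (-X) := by
      have h5 := Matrix.exp_units_conj U Xᵀ
      have h6 : (U : Mat2) * Xᵀ * (U⁻¹ : Mat2ˣ) = -X := by rw [← hadj, key]; rfl
      rw [h6] at h5
      rw [h5, key, ← Matrix.exp_transpose]; rfl
    have h7 := Matrix.mul_adjugate (NormedSpace.exp X)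
    rw [h4, hinv] at h7
    have h8 := congrFun (congrFun h7 0) 0
    simpa using h8.symm

/-- The exponential map `su(2) → SU(2)`. -/
def exp (X : su2) : SU2 := ⟨NormedSpace.exp (X : Mat2), exp_mem X.2⟩

end su2

/-! ### Pointwise algebra of forms

A `k`-form on a real vector space `T` with values in an algebra `A` is an alternating map
`T [⋀^Fin k]→ₗ[ℝ] A`. The wedge product is normalised so that
`(α ∧ β)(u, v) = α u * β v - α v * β u` for 1-forms. -/

section Pointwise

variable {T : Type*} [AddCommGroup T] [Module ℝ T] {A : Type*} [Ring A] [Algebra ℝ A] {n : ℕ}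

/-- A linear map, as an alternating map in one variable. -/
def oneForm (α : T →ₗ[ℝ] A) : T [⋀^Fin 1]→ₗ[ℝ] A :=
  AlternatingMap.ofSubsingleton ℝ T A (0 : Fin 1) α

/-- The wedge product of a 1-form and an `n`-form:
`(α ∧ γ)(v₀, …, vₙ) = ∑ₖ (-1)ᵏ α(vₖ) γ(v₀, …, v̂ₖ, …, vₙ)`. -/
def wedgeOne (α : T →ₗ[ℝ] A) (γ : T [⋀^Fin n]→ₗ[ℝ] A) : T [⋀^Fin (n + 1)]→ₗ[ℝ] A :=
  AlternatingMap.alternatizeUncurryFin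
    { toFun := fun u => (LinearMap.mulLeft ℝ (α u)).compAlternatingMap γ
      map_add' := fun u v => by ext; simp [add_mul]
      map_smul' := fun c u => by ext; simp }

theorem wedgeOne_apply (α : T →ₗ[ℝ] A) (γ : T [⋀^Fin n]→ₗ[ℝ] A) (v : Fin (n + 1) → T) :
    wedgeOne α γ v = ∑ k : Fin (n + 1), (-1) ^ (k : ℕ) • (α (v k) * γ (k.removeNth v)) := by
  simp [wedgeOne, AlternatingMap.alternatizeUncurryFin_apply]

theorem wedgeOne_add_left (α β : T →ₗ[ℝ] A) (γ : T [⋀^Fin n]→ₗ[ℝ] A) :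
    wedgeOne (α + β) γ = wedgeOne α γ + wedgeOne β γ := by
  ext v; simp [wedgeOne_apply, add_mul, Finset.sum_add_distrib]

theorem wedgeOne_smul_left (c : ℝ) (α : T →ₗ[ℝ] A) (γ : T [⋀^Fin n]→ₗ[ℝ] A) :
    wedgeOne (c • α) γ = c • wedgeOne α γ := by
  ext v; simp [wedgeOne_apply, Finset.smul_sum]

theorem wedgeOne_add_right (α : T →ₗ[ℝ] A) (γ δ : T [⋀^Fin n]→ₗ[ℝ] A) :
    wedgeOne α (γ + δ) = wedgeOne α γ + wedgeOne α δ := by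
  ext v; simp [wedgeOne_apply, mul_add, Finset.sum_add_distrib]

theorem wedgeOne_smul_right (c : ℝ) (α : T →ₗ[ℝ] A) (γ : T [⋀^Fin n]→ₗ[ℝ] A) :
    wedgeOne α (c • γ) = c • wedgeOne α γ := by
  ext v; simp [wedgeOne_apply, Finset.smul_sum]

/-- `β(u, ·)` for a 2-form `β`. -/
def contractTwo (β : T [⋀^Fin 2]→ₗ[ℝ] A) (u : T) : T →ₗ[ℝ] A :=
  have e : ∀ x : T, ![u, x] = Function.update ![u, 0] 1 x := fun x => by
    ext i; fin_cases i <;> simp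
  { toFun := fun v => β ![u, v]
    map_add' := fun v w => by
      rw [e (v + w), e v, e w]; exact β.map_update_add ![u, 0] 1 v w
    map_smul' := fun c v => by
      rw [e (c • v), e v]; exact β.map_update_smul ![u, 0] 1 c v }

theorem contractTwo_apply (β : T [⋀^Fin 2]→ₗ[ℝ] A) (u v : T) :
    contractTwo β u v = β ![u, v] := rfl

theorem contractTwo_add (β : T [⋀^Fin 2]→ₗ[ℝ] A) (u u' : T) :
    contractTwo β (u + u') = contractTwo β u + contractTwo β u' := by
  ext v
  have e : ∀ x : T, ![x, v] = Function.update ![0, v] 0 x := fun x => by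
    ext i; fin_cases i <;> simp
  rw [LinearMap.add_apply, contractTwo_apply, contractTwo_apply, contractTwo_apply, e (u + u'), e u, e u']
  exact β.map_update_add ![0, v] 0 u u'

theorem contractTwo_smul (β : T [⋀^Fin 2]→ₗ[ℝ] A) (c : ℝ) (u : T) :
    contractTwo β (c • u) = c • contractTwo β u := by
  ext v
  have e : ∀ x : T, ![x, v] = Function.update ![0, v] 0 x := fun x => by
    ext i; fin_cases i <;> simp
  rw [LinearMap.smul_apply, contractTwo_apply, contractTwo_apply, e (c • u), e u]
  exact β.map_update_smul ![0, v] 0 c u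

/-- The wedge product of a 2-form and an `n`-form. Each 2-element subset of the arguments
is met twice in the double alternation, whence the factor `1 / 2`:
`(β ∧ γ)(v) = ½ ∑_{k ≠ l} ± β(vₖ, vₗ) γ(the others) = ∑_{k < l} ± β(vₖ, vₗ) γ(the others)`. -/
def wedgeTwo (β : T [⋀^Fin 2]→ₗ[ℝ] A) (γ : T [⋀^Fin n]→ₗ[ℝ] A) :
    T [⋀^Fin (n + 2)]→ₗ[ℝ] A :=
  (1 / 2 : ℝ) • AlternatingMap.alternatizeUncurryFin
    { toFun := fun u => wedgeOne (contractTwo β u) γ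
      map_add' := fun u v => by
        rw [contractTwo_add, wedgeOne_add_left]
      map_smul' := fun c u => by
        rw [RingHom.id_apply, contractTwo_smul, wedgeOne_smul_left] }

theorem wedgeTwo_apply (β : T [⋀^Fin 2]→ₗ[ℝ] A) (γ : T [⋀^Fin n]→ₗ[ℝ] A)
    (v : Fin (n + 2) → T) :
    wedgeTwo β γ v = (1 / 2 : ℝ) • ∑ k : Fin (n + 2), (-1) ^ (k : ℕ) •
      wedgeOne (contractTwo β (v k)) γ (k.removeNth v) := by
  simp [wedgeTwo, AlternatingMap.alternatizeUncurryFin_apply]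

theorem wedgeTwo_add_left (β β' : T [⋀^Fin 2]→ₗ[ℝ] A) (γ : T [⋀^Fin n]→ₗ[ℝ] A) :
    wedgeTwo (β + β') γ = wedgeTwo β γ + wedgeTwo β' γ := by
  have h : ∀ u, contractTwo (β + β') u = contractTwo β u + contractTwo β' u := fun u => by
    ext; simp [contractTwo_apply]
  ext v; simp [wedgeTwo_apply, h, wedgeOne_add_left, Finset.sum_add_distrib]

theorem wedgeTwo_smul_left (c : ℝ) (β : T [⋀^Fin 2]→ₗ[ℝ] A) (γ : T [⋀^Fin n]→ₗ[ℝ] A) :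
    wedgeTwo (c • β) γ = c • wedgeTwo β γ := by
  have h : ∀ u, contractTwo (c • β) u = c • contractTwo β u := fun u => by
    ext; simp [contractTwo_apply]
  ext v
  simp only [wedgeTwo_apply, h, wedgeOne_smul_left, AlternatingMap.smul_apply]
  simp only [smul_comm _ c, Finset.smul_sum]

/-- The ratio `η / v` of two top-degree forms on a 6-dimensional space, `v ≠ 0`: evaluate both
on one 6-tuple of vectors on which `v` does not vanish. (On a 6-dimensional space the top-degree
forms are a line, so the choice of the 6-tuple does not matter.) -/
def topRatio (v : T [⋀^Fin 6]→ₗ[ℝ] ℝ) : (T [⋀^Fin 6]→ₗ[ℝ] ℝ) →ₗ[ℝ] ℝ where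
  toFun η := η (Classical.epsilon fun b => v b ≠ 0) / v (Classical.epsilon fun b => v b ≠ 0)
  map_add' η η' := by simp [add_div]
  map_smul' c η := by simp [mul_div_assoc]

/-- The endomorphism `K_Ω` of the dual space attached to a 3-form `Ω` on a 6-dimensional space
and a volume form `v`: `i_ξ (K_Ω α) = α ∧ i_ξ Ω ∧ Ω / v` for all vectors `ξ`. -/
def hitchinK (v : T [⋀^Fin 6]→ₗ[ℝ] ℝ) (Ω : T [⋀^Fin 3]→ₗ[ℝ] ℝ) :
    Module.Dual ℝ T →ₗ[ℝ] Module.Dual ℝ T :=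
  LinearMap.mk₂ ℝ (fun α ξ => topRatio v (wedgeOne α (wedgeTwo (Ω.curryLeft ξ) Ω)))
    (fun α β ξ => by simp [wedgeOne_add_left])
    (fun c α ξ => by simp [wedgeOne_smul_left])
    (fun α ξ η => by simp [wedgeTwo_add_left, wedgeOne_add_right])
    (fun c α ξ => by simp [wedgeTwo_smul_left, wedgeOne_smul_right])

/-- The invariant `λ(Ω) = Tr(K_Ω²) / 6`. -/
def hitchinLambda (v : T [⋀^Fin 6]→ₗ[ℝ] ℝ) (Ω : T [⋀^Fin 3]→ₗ[ℝ] ℝ) : ℝ :=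
  (1 / 6) * LinearMap.trace ℝ (Module.Dual ℝ T) (hitchinK v Ω ∘ₗ hitchinK v Ω)

/-- The endomorphism `J_Ω = K_Ω / √(-λ(Ω))` of the dual space. -/
def hitchinJDual (v : T [⋀^Fin 6]→ₗ[ℝ] ℝ) (Ω : T [⋀^Fin 3]→ₗ[ℝ] ℝ) :
    Module.Dual ℝ T →ₗ[ℝ] Module.Dual ℝ T :=
  (Real.sqrt (-hitchinLambda v Ω))⁻¹ • hitchinK v Ω

/-- The endomorphism `J_Ω` on vectors, the transpose of `J_Ω` on covectors:
`α (J_Ω ξ) = (J_Ω α) ξ`. -/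
def hitchinJ [Module.IsReflexive ℝ T] (v : T [⋀^Fin 6]→ₗ[ℝ] ℝ) (Ω : T [⋀^Fin 3]→ₗ[ℝ] ℝ) :
    T →ₗ[ℝ] T :=
  (Module.evalEquiv ℝ T).symm.toLinearMap ∘ₗ (hitchinJDual v Ω).dualMap ∘ₗ
    (Module.evalEquiv ℝ T).toLinearMap

theorem dual_hitchinJ_apply [Module.IsReflexive ℝ T] (v : T [⋀^Fin 6]→ₗ[ℝ] ℝ)
    (Ω : T [⋀^Fin 3]→ₗ[ℝ] ℝ) (α : Module.Dual ℝ T) (ξ : T) :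
    α (hitchinJ v Ω ξ) = hitchinJDual v Ω α ξ := by
  simp [hitchinJ]

/-- A 3-form on a 6-dimensional space is stable of negative type if it lies in the `GL(6, ℝ)`-orbit
of `2 Re (dz₁ ∧ dz₂ ∧ dz₃)`, i.e. if it is `α₁ ∧ α₂ ∧ α₃ + ᾱ₁ ∧ ᾱ₂ ∧ ᾱ₃` for complex-valued 1-forms
`αᵢ` that are the components of a real-linear isomorphism `T ≃ ℂ³`. -/
def IsNegativeType (Ω : T [⋀^Fin 3]→ₗ[ℝ] ℝ) : Prop :=
  ∃ α : T ≃ₗ[ℝ] (Fin 3 → ℂ), ∀ u : Fin 3 → T,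
    Ω u = 2 * (Matrix.det (Matrix.of fun i j => α (u j) i)).re

end Pointwise

/-- The real part of the trace, on matrices. -/
def reTrace : Mat2 →ₗ[ℝ] ℝ := Complex.reLm ∘ₗ Matrix.traceLinearMap (Fin 2) ℝ ℂ

/-! ### Differential forms on manifolds -/

section Forms

variable {d : ℕ} {X : Type*} [TopologicalSpace X] [ChartedSpace (EuclideanSpace ℝ (Fin d)) X]
  {A : Type*} [NormedAddCommGroup A] [NormedSpace ℝ A] {k : ℕ}

instance (x : X) : FiniteDimensional ℝ (TangentSpace (𝓡 d) x) :=
  inferInstanceAs (FiniteDimensional ℝ (EuclideanSpace ℝ (Fin d)))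

variable (d X A k) in
/-- An `A`-valued `k`-form on a `d`-manifold (no regularity assumed). -/
abbrev DiffForm : Type _ := ∀ x : X, TangentSpace (𝓡 d) x [⋀^Fin k]→L[ℝ] A

variable (d X A) in
/-- An `A`-valued 1-form on a `d`-manifold (no regularity assumed). -/
abbrev OneForm : Type _ := ∀ x : X, TangentSpace (𝓡 d) x →L[ℝ] A

/-- A 1-form as a `k`-form with `k = 1`. -/
def toDiffForm (α : OneForm d X A) : DiffForm d X A 1 := fun x =>
  ContinuousAlternatingMap.ofSubsingleton ℝ (TangentSpace (𝓡 d) x) A (0 : Fin 1) (α x)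

/-- The expression of a form in the preferred chart at `x₀`: the pullback by the inverse of
the chart. -/
def formInChart (η : DiffForm d X A k) (x₀ : X) :
    EuclideanSpace ℝ (Fin d) → EuclideanSpace ℝ (Fin d) [⋀^Fin k]→L[ℝ] A := fun y =>
  (η ((extChartAt (𝓡 d) x₀).symm y)).compContinuousLinearMap
    (mfderiv 𝓘(ℝ, EuclideanSpace ℝ (Fin d)) (𝓡 d) (extChartAt (𝓡 d) x₀).symm y)

/-- A form is smooth if it is smooth in the charts. -/
def IsSmoothForm (η : DiffForm d X A k) : Prop :=
  ∀ x₀ : X, ContDiffOn ℝ ∞ (formInChart η x₀) (extChartAt (𝓡 d) x₀).target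

/-- The exterior derivative, computed at `x` in the preferred chart at `x` (the chart through
which `TangentSpace (𝓡 d) x` is identified with `ℝᵈ`). -/
def extDerivForm (η : DiffForm d X A k) : DiffForm d X A (k + 1) := fun x =>
  (extDeriv (formInChart η x) (extChartAt (𝓡 d) x x) :
    EuclideanSpace ℝ (Fin d) [⋀^Fin (k + 1)]→L[ℝ] A)

variable (d X) in
/-- A volume form on a `d`-manifold: a smooth nowhere vanishing form of top degree. It fixes an
orientation. -/
structure VolumeForm where
  form : DiffForm d X ℝ d
  smooth : IsSmoothForm form
  ne_zero : ∀ x, form x ≠ 0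

end Forms

/-! ### Principal `SU(2)`-bundles over 3-manifolds -/

/-- A smooth principal `SU(2)`-bundle `P → M` over a 3-manifold: a smooth projection and a smooth
right action of `SU(2)` on `P` with smooth equivariant local trivialisations `P|_U ≅ U × SU(2)`,
where `SU(2)` acts on the second factor by right multiplication. -/
structure PrincipalSU2Bundle (P M : Type*)
    [TopologicalSpace P] [ChartedSpace (EuclideanSpace ℝ (Fin 6)) P] [IsManifold (𝓡 6) ∞ P]
    [TopologicalSpace M] [ChartedSpace (EuclideanSpace ℝ (Fin 3)) M] [IsManifold (𝓡 3) ∞ M] where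
  proj : P → M
  act : P → SU2 → P
  act_one : ∀ p, act p 1 = p
  act_mul : ∀ p g h, act p (g * h) = act (act p g) h
  proj_act : ∀ p g, proj (act p g) = proj p
  smooth_proj : ContMDiff (𝓡 6) (𝓡 3) ∞ proj
  smooth_act : ContMDiff ((𝓡 6).prod (𝓡 3)) (𝓡 6) ∞ fun x : P × SU2 => act x.1 x.2
  locally_trivial : ∀ x : M, ∃ e : Bundle.Trivialization SU2 proj, x ∈ e.baseSet ∧
    ContMDiffOn (𝓡 6) ((𝓡 3).prod (𝓡 3)) ∞ e e.source ∧
    ContMDiffOn ((𝓡 3).prod (𝓡 3)) (𝓡 6) ∞ e.toOpenPartialHomeomorph.symm e.target ∧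
    ∀ p ∈ e.source, ∀ g, (e (act p g)).2 = (e p).2 * g

/-! ### Connections and the forms built from them -/

section Gauge

variable {P : Type*} [TopologicalSpace P] [ChartedSpace (EuclideanSpace ℝ (Fin 6)) P]

/-- The 2-form `α ∧ α`. -/
def wedgeSelf (α : OneForm 6 P Mat2) (p : P) : TangentSpace (𝓡 6) p [⋀^Fin 2]→ₗ[ℝ] Mat2 :=
  wedgeOne (α p).toLinearMap (oneForm (α p).toLinearMap)

/-- The 3-form `α ∧ α ∧ α`. -/
def wedgeCube (α : OneForm 6 P Mat2) (p : P) : TangentSpace (𝓡 6) p [⋀^Fin 3]→ₗ[ℝ] Mat2 :=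
  wedgeOne (α p).toLinearMap (wedgeSelf α p)

/-- The curvature `F(W) = dW + W ∧ W`. -/
def curvature (W : OneForm 6 P Mat2) (p : P) : TangentSpace (𝓡 6) p [⋀^Fin 2]→ₗ[ℝ] Mat2 :=
  (extDerivForm (toDiffForm W) p).toAlternatingMap + wedgeSelf W p

/-- The Chern-Simons 3-form `Tr (W ∧ dW + (2/3) W ∧ W ∧ W)`. (The trace is real when `W` takes
values in `su(2)`.) -/
def chernSimons (W : OneForm 6 P Mat2) (p : P) : TangentSpace (𝓡 6) p [⋀^Fin 3]→ₗ[ℝ] ℝ :=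
  reTrace.compAlternatingMap
    (wedgeOne (W p).toLinearMap (extDerivForm (toDiffForm W) p).toAlternatingMap +
      (2 / 3 : ℝ) • wedgeCube W p)

end Gauge

namespace PrincipalSU2Bundle

variable {P M : Type*}
  [TopologicalSpace P] [ChartedSpace (EuclideanSpace ℝ (Fin 6)) P] [IsManifold (𝓡 6) ∞ P]
  [TopologicalSpace M] [ChartedSpace (EuclideanSpace ℝ (Fin 3)) M] [IsManifold (𝓡 3) ∞ M]
  (B : PrincipalSU2Bundle P M)

/-- The differential of the projection. -/
def dproj (p : P) : TangentSpace (𝓡 6) p →L[ℝ] TangentSpace (𝓡 3) (B.proj p) :=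
  mfderiv (𝓡 6) (𝓡 3) B.proj p

/-- The differential of the right translation by `g`. -/
def dact (g : SU2) (p : P) : TangentSpace (𝓡 6) p →L[ℝ] TangentSpace (𝓡 6) (B.act p g) :=
  mfderiv (𝓡 6) (𝓡 6) (fun q => B.act q g) p

/-- The vertical subspace. -/
def vertical (p : P) : Submodule ℝ (TangentSpace (𝓡 6) p) := LinearMap.ker (B.dproj p).toLinearMap

/-- The fundamental vector field of `X ∈ su(2)` at `p`: the velocity at `t = 0` of
`t ↦ p · exp (t X)`, seen in the preferred chart at `p`. -/
def fundamental (X : su2) (p : P) : TangentSpace (𝓡 6) p :=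
  (deriv (fun t : ℝ => extChartAt (𝓡 6) p (B.act p (su2.exp (t • X)))) 0 :
    EuclideanSpace ℝ (Fin 6))

/-- Connection forms on the bundle. -/
structure IsConnection (W : OneForm 6 P Mat2) : Prop where
  smooth : IsSmoothForm (toDiffForm W)
  mem_su2 : ∀ p v, W p v ∈ su2
  fundamental : ∀ (X : su2) p, W p (B.fundamental X p) = X
  equivariant : ∀ (g : SU2) p v, W (B.act p g) (B.dact g p v) = ((g⁻¹ : SU2) : Mat2) * W p v * g

/-- Lie algebra valued basic 1-forms: smooth, horizontal and equivariant. -/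
structure IsBasic (E : OneForm 6 P Mat2) : Prop where
  smooth : IsSmoothForm (toDiffForm E)
  mem_su2 : ∀ p v, E p v ∈ su2
  horizontal : ∀ p, ∀ v ∈ B.vertical p, E p v = 0
  equivariant : ∀ (g : SU2) p v, E (B.act p g) (B.dact g p v) = ((g⁻¹ : SU2) : Mat2) * E p v * g

/-- A connection is negative definite if its Chern-Simons form is stable of negative type
at every point of the total space. -/
def IsNegativeDefinite (W : OneForm 6 P Mat2) : Prop :=
  B.IsConnection W ∧ ∀ p, IsNegativeType (chernSimons W p)

/-- The orientation of the base for which `-Tr (E ∧ E ∧ E)` is positive is that of `vM`. -/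
def IsPositive (vM : VolumeForm 3 M) (E : OneForm 6 P Mat2) : Prop :=
  ∀ p (u : Fin 3 → TangentSpace (𝓡 6) p), 0 < vM.form (B.proj p) (fun i => B.dproj p (u i)) →
    0 < -reTrace (wedgeCube E p u)

/-- `E` is a basic 1-form with `F(W) = E ∧ E` that induces the given orientation of the base. -/
structure IsCurvatureRoot (vM : VolumeForm 3 M) (W E : OneForm 6 P Mat2) : Prop where
  basic : B.IsBasic E
  curvature_eq : ∀ p, curvature W p = wedgeSelf E p
  positive : B.IsPositive vM E

/-- A field of endomorphisms of the tangent spaces of the total space. -/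
abbrev EndField (P : Type*) [TopologicalSpace P] [ChartedSpace (EuclideanSpace ℝ (Fin 6)) P] :=
  ∀ p : P, TangentSpace (𝓡 6) p →ₗ[ℝ] TangentSpace (𝓡 6) p

/-- The almost-complex structure `J_W` on the total space defined by the 3-form `CS(W)` and the
orientation of the total space given by a volume form. -/
def almostComplex (vP : VolumeForm 6 P) (W : OneForm 6 P Mat2) : EndField P := fun p =>
  hitchinJ (vP.form p).toAlternatingMap (chernSimons W p)

/-- `W` is the connection determined by `J`: the horizontal vectors are the images of the vertical
vectors under `J`. -/
def IsConnectionOf (J : EndField P) (W : OneForm 6 P Mat2) : Prop :=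
  B.IsConnection W ∧ ∀ p, LinearMap.ker (W p).toLinearMap = (B.vertical p).map (J p)

/-- `g` is the bilinear form on the base determined by `J`: if `ξ, η` are in `J(V)` and `Jξ, Jη` are
the vertical vectors given by `X, Y ∈ su(2)`, then the product of the projections of `ξ, η` is
the invariant product `-2 Tr (X Y)`. -/
def IsMetricOf (J : EndField P)
    (g : ∀ x : M, TangentSpace (𝓡 3) x →L[ℝ] TangentSpace (𝓡 3) x →L[ℝ] ℝ) : Prop :=
  ∀ p, ∀ ξ ∈ (B.vertical p).map (J p), ∀ η ∈ (B.vertical p).map (J p), ∀ X Y : su2,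
    J p ξ = B.fundamental X p → J p η = B.fundamental Y p →
      g (B.proj p) (B.dproj p ξ) (B.dproj p η) = -2 * reTrace ((X : Mat2) * (Y : Mat2))

/-- `E` is a frame for `g`: a basic 1-form with `g = -2 Tr (E ⊗ E)`. -/
def IsFrame (g : ∀ x : M, TangentSpace (𝓡 3) x →L[ℝ] TangentSpace (𝓡 3) x →L[ℝ] ℝ)
    (E : OneForm 6 P Mat2) : Prop :=
  B.IsBasic E ∧ ∀ p (u v : TangentSpace (𝓡 6) p),
    g (B.proj p) (B.dproj p u) (B.dproj p v) = -2 * reTrace (E p u * E p v)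

end PrincipalSU2Bundle

end

/-!
The Lie algebra `su(2)` with `-2 Tr (X Y)` and the commutator is `ℝ³` with the scalar and the
cross product (`su2.vec`), so that at a point `p` of the total space the connection is a linear
map `w : T_p P → ℝ³`, an isomorphism on the vertical space, and the curvature is an `ℝ³`-valued
2-form `F`. It is horizontal (`IsConnection.curvature_fundamental`), and the Chern-Simons form is
`Ω = -½ ∑ w · F + ½ w₁ ∧ w₂ ∧ w₃` (`chernSimons_apply`).

On the 3-dimensional horizontal quotient, `F` is a linear map from bivectors to `ℝ³`, with a
determinant whose sign does not depend on the orientation. For a form `Ω` of negative type the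
kernel of `Ω(ξ, ·, ·)` is a complex line, if `ξ ≠ 0`. If the determinant of `F` vanished, then the
horizontal space would lie in such a kernel, with `ξ` vertical and orthogonal to the values of
`F`; if it were negative, then `F = - e × e` for some `e`, and `{w = - e}` would lie in such a
kernel, with `w ξ = e ξ`. So the determinant is positive (`IsNegativeType.triple_product_pos`),
and `F` is a matrix of cofactors: `F = e × e` for a horizontal `e`, which is unique up to sign and
is therefore fixed by the orientation of the base (`exists_root`, `IsRootAt.unique`).

Then `Ω = ½ Re ((w₁ + i e₁) ∧ (w₂ + i e₂) ∧ (w₃ + i e₃))` (`exists_complex_coordinates`), and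
Hitchin's construction returns the complex structure of the coordinates `w + i e`, up to the sign
`ε` given by the orientation of the total space (`hitchinJ_eq`). Hence `J² = -1`, `w ∘ J = -ε e`
and `e ∘ J = ε w` (`IsNegativeDefinite.exists_root`). These relations show that `w` vanishes
exactly on `J(V)`, where `V` is the vertical space, and the first one that the metric determined
by `J` is given by the scalar product of the values of `e`.

Smoothness and equivariance of the 1-form `E` with coordinates `e` come from uniqueness: `e` is
given by an explicit smooth formula in terms of `F` and of a positive frame (`IsRootAt.apply_eq`),
and a right translation conjugates `F` and preserves the orientation. The metric descends to the
base because the group acts transitively on the fibres (`IsBasic.reTrace_mul_eq`), and it is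
smooth because it is computed by pulling `E` back along local sections (`IsBasic.exists_metric`).
-/

noncomputable section

/-! ### Pullbacks of forms -/

section Calculus

variable {E F A G : Type*} [NormedAddCommGroup E] [NormedSpace ℝ E]
  [NormedAddCommGroup F] [NormedSpace ℝ F] [NormedAddCommGroup A] [NormedSpace ℝ A]
  [NormedAddCommGroup G] [NormedSpace ℝ G] {k : ℕ}

/-- A map to a finite-dimensional space of alternating maps is smooth if its values on constant
vectors are. -/
theorem contDiffAt_alternating_of_apply [FiniteDimensional ℝ E] [FiniteDimensional ℝ A]
    {n : ℕ∞ω} {f : G → E [⋀^Fin k]→L[ℝ] A} {z : G}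
    (h : ∀ v : Fin k → E, ContDiffAt ℝ n (fun y => f y v) z) : ContDiffAt ℝ n f z := by
  let b := Module.finBasis ℝ E
  -- evaluation on the tuples of basis vectors embeds the space of forms in a space of functions
  let L : (E [⋀^Fin k]→L[ℝ] A) →ₗ[ℝ] ((Fin k → Fin (Module.finrank ℝ E)) → A) :=
    { toFun := fun η i => η (fun j => b (i j))
      map_add' := fun _ _ => rfl
      map_smul' := fun _ _ => rfl }
  have hL : LinearMap.ker L = ⊥ := by
    rw [LinearMap.ker_eq_bot]
    intro η η' hη
    apply ContinuousAlternatingMap.toAlternatingMap_injective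
    refine Module.Basis.ext_alternating b fun v _ => ?_
    exact congrFun hη v
  obtain ⟨g, hg⟩ := LinearMap.exists_leftInverse_of_injective L hL
  have hgc : ContDiff ℝ n g := (LinearMap.toContinuousLinearMap g).contDiff
  have hLf : ContDiffAt ℝ n (fun y => L (f y)) z := by
    rw [contDiffAt_pi]
    intro i
    exact h _
  have h2 := hgc.contDiffAt.comp z hLf
  have : (g ∘ fun y => L (f y)) = f := by
    funext y
    exact LinearMap.congr_fun hg (f y)
  rwa [this] at h2

/-- Evaluating a smooth family of forms on smooth vector fields gives a smooth function. -/
theorem ContDiffAt.alternating_apply [CompleteSpace A] {n : ℕ∞ω}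
    {f : G → E [⋀^Fin k]→L[ℝ] A} {v : Fin k → G → E} {z : G}
    (hf : ContDiffAt ℝ n f z) (hv : ∀ i, ContDiffAt ℝ n (v i) z) :
    ContDiffAt ℝ n (fun y => f y (fun i => v i y)) z := by
  let L := ContinuousAlternatingMap.toContinuousMultilinearMapCLM (𝕜 := ℝ) (E := E) (F := A)
    (ι := Fin k) ℝ
  have h1 : ContDiffAt ℝ n (fun p : (E [⋀^Fin k]→L[ℝ] A) × (Fin k → E) => L p.1 p.2)
      (f z, fun i => v i z) :=
    L.analyticAt_uncurry_of_multilinear.contDiffAt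
  exact h1.comp z (hf.prodMk (contDiffAt_pi.2 hv))

/-- The exterior derivative commutes with continuous linear maps of the coefficients. -/
theorem extDeriv_clm_comp {A' : Type*} [NormedAddCommGroup A'] [NormedSpace ℝ A'] (L : A →L[ℝ] A')
    {η : E → E [⋀^Fin k]→L[ℝ] A} {x : E} (h : DifferentiableAt ℝ η x) :
    extDeriv (fun y => L.compContinuousAlternatingMap (η y)) x =
      L.compContinuousAlternatingMap (extDeriv η x) := by
  have hL : DifferentiableAt ℝ (fun y => L.compContinuousAlternatingMap (η y)) x :=
    ((ContinuousLinearMap.compContinuousAlternatingMapCLM (𝕜 := ℝ) (E := E) (F := A) (G := A')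
      (ι := Fin k) L).differentiableAt (x := η x)).comp x h
  ext v
  rw [extDeriv_apply hL, ContinuousLinearMap.compContinuousAlternatingMap_coe, Function.comp_apply,
    extDeriv_apply h, map_sum]
  refine Finset.sum_congr rfl fun i _ => ?_
  rw [map_zsmul]
  congr 1
  have := (L.hasFDerivAt (x := η x (i.removeNth v))).comp x
    (h.continuousAlternatingMap_apply_const (i.removeNth v)).hasFDerivAt
  exact congrArg (fun l : E →L[ℝ] A' => l (v i)) this.fderiv

end Calculus

section Pullback

variable {d : ℕ} {X : Type*} [TopologicalSpace X] [ChartedSpace (EuclideanSpace ℝ (Fin d)) X]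
  {A : Type*} [NormedAddCommGroup A] [NormedSpace ℝ A] {k : ℕ}
  {G : Type*} [NormedAddCommGroup G] [NormedSpace ℝ G]

/-- The pullback of a form on a manifold by a map from a normed space. -/
def pullbackForm (η : DiffForm d X A k) (f : G → X) : G → G [⋀^Fin k]→L[ℝ] A := fun z =>
  (η (f z)).compContinuousLinearMap (mfderiv 𝓘(ℝ, G) (𝓡 d) f z)

theorem pullbackForm_apply (η : DiffForm d X A k) (f : G → X) (z : G) (v : Fin k → G) :
    pullbackForm η f z v = η (f z) (fun i => mfderiv 𝓘(ℝ, G) (𝓡 d) f z (v i)) := rfl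

/-- Equal points have the same forms on the same (model) vectors. -/
theorem form_apply_congr (η : DiffForm d X A k) {x x' : X} (h : x = x')
    (w : Fin k → EuclideanSpace ℝ (Fin d)) :
    (η x : EuclideanSpace ℝ (Fin d) [⋀^Fin k]→L[ℝ] A) w =
      (η x' : EuclideanSpace ℝ (Fin d) [⋀^Fin k]→L[ℝ] A) w := by
  subst h; rfl

theorem contMDiffAt_extChartAt_symm [IsManifold (𝓡 d) ∞ X] (x₀ : X) {y : EuclideanSpace ℝ (Fin d)}
    (hy : y ∈ (extChartAt (𝓡 d) x₀).target) :
    ContMDiffAt 𝓘(ℝ, EuclideanSpace ℝ (Fin d)) (𝓡 d) ∞ (extChartAt (𝓡 d) x₀).symm y :=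
  (contMDiffOn_extChartAt_symm x₀).contMDiffAt ((isOpen_extChartAt_target x₀).mem_nhds hy)

theorem contDiffAt_chart_comp [IsManifold (𝓡 d) ∞ X] {f : G → X} {z : G} {x₀ : X}
    (hf : ContMDiffAt 𝓘(ℝ, G) (𝓡 d) ∞ f z) (hz : f z ∈ (extChartAt (𝓡 d) x₀).source) :
    ContDiffAt ℝ ∞ (extChartAt (𝓡 d) x₀ ∘ f) z := by
  rw [← contMDiffAt_iff_contDiffAt]
  rw [extChartAt_source] at hz
  exact (contMDiffAt_extChartAt' hz).comp z hf

/-- The derivative of a map, computed through a chart. -/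
theorem mfderiv_eq_through_chart [IsManifold (𝓡 d) ∞ X] {f : G → X} {z : G} {x₀ : X}
    (hf : ContMDiffAt 𝓘(ℝ, G) (𝓡 d) ∞ f z) (hz : f z ∈ (extChartAt (𝓡 d) x₀).source) (v : G) :
    mfderiv 𝓘(ℝ, G) (𝓡 d) f z v =
      mfderiv 𝓘(ℝ, EuclideanSpace ℝ (Fin d)) (𝓡 d) (extChartAt (𝓡 d) x₀).symm
        (extChartAt (𝓡 d) x₀ (f z)) (fderiv ℝ (extChartAt (𝓡 d) x₀ ∘ f) z v) := by
  have hc := (contDiffAt_chart_comp hf hz).contMDiffAt.mdifferentiableAt (by simp)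
  have ht := (extChartAt (𝓡 d) x₀).map_source hz
  have hs := (contMDiffAt_extChartAt_symm x₀ ht).mdifferentiableAt (by simp)
  have heq : f =ᶠ[nhds z] (extChartAt (𝓡 d) x₀).symm ∘ (extChartAt (𝓡 d) x₀ ∘ f) := by
    have : ∀ᶠ y in nhds z, f y ∈ (extChartAt (𝓡 d) x₀).source :=
      hf.continuousAt.eventually ((isOpen_extChartAt_source x₀).mem_nhds hz)
    filter_upwards [this] with y hy
    exact ((extChartAt (𝓡 d) x₀).left_inv hy).symm
  have h1 := heq.mfderiv_eq (I := 𝓘(ℝ, G)) (I' := 𝓡 d)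
  have h2 := mfderiv_comp (I := 𝓘(ℝ, G)) (I' := 𝓘(ℝ, EuclideanSpace ℝ (Fin d))) (I'' := 𝓡 d)
    z (g := (extChartAt (𝓡 d) x₀).symm) (f := extChartAt (𝓡 d) x₀ ∘ f) hs hc
  rw [mfderiv_eq_fderiv] at h2
  have h3 := h1.trans h2
  exact congrArg (fun L : G →L[ℝ] EuclideanSpace ℝ (Fin d) => L v) h3

theorem mfderiv_eq_fderiv_chart [IsManifold (𝓡 d) ∞ X] {f : G → X} {z : G}
    (hf : ContMDiffAt 𝓘(ℝ, G) (𝓡 d) ∞ f z) :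
    mfderiv 𝓘(ℝ, G) (𝓡 d) f z = fderiv ℝ (extChartAt (𝓡 d) (f z) ∘ f) z := by
  refine (hf.mdifferentiableAt (by simp)).mfderiv.trans ?_
  simp [writtenInExtChartAt]
  rfl

/-- In a chart, a pullback of forms is a pullback between normed spaces. -/
theorem pullbackForm_eventuallyEq [IsManifold (𝓡 d) ∞ X] (η : DiffForm d X A k) {f : G → X}
    {z : G} (x₀ : X)
    (hf : ∀ᶠ y in nhds z, ContMDiffAt 𝓘(ℝ, G) (𝓡 d) ∞ f y)
    (hz : f z ∈ (extChartAt (𝓡 d) x₀).source) :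
    pullbackForm η f =ᶠ[nhds z] fun y =>
      (formInChart η x₀ ((extChartAt (𝓡 d) x₀ ∘ f) y)).compContinuousLinearMap
        (fderiv ℝ (extChartAt (𝓡 d) x₀ ∘ f) y) := by
  have hs : ∀ᶠ y in nhds z, f y ∈ (extChartAt (𝓡 d) x₀).source :=
    hf.self_of_nhds.continuousAt.eventually ((isOpen_extChartAt_source x₀).mem_nhds hz)
  filter_upwards [hf, hs] with y hy hys
  ext v
  have h := (extChartAt (𝓡 d) x₀).left_inv hys
  simp only [pullbackForm_apply, mfderiv_eq_through_chart hy hys]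
  exact form_apply_congr η h.symm _

theorem IsSmoothForm.contDiffAt {η : DiffForm d X A k} (hη : IsSmoothForm η) {x₀ : X}
    {y : EuclideanSpace ℝ (Fin d)} (hy : y ∈ (extChartAt (𝓡 d) x₀).target) :
    ContDiffAt ℝ ∞ (formInChart η x₀) y :=
  (hη x₀).contDiffAt ((isOpen_extChartAt_target x₀).mem_nhds hy)

theorem contDiffAt_pullbackForm [FiniteDimensional ℝ G] [FiniteDimensional ℝ A]
    [IsManifold (𝓡 d) ∞ X] {η : DiffForm d X A k} (hη : IsSmoothForm η) {f : G → X} {z : G}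
    (hf : ∀ᶠ y in nhds z, ContMDiffAt 𝓘(ℝ, G) (𝓡 d) ∞ f y) :
    ContDiffAt ℝ ∞ (pullbackForm η f) z := by
  have hz := mem_extChartAt_source (I := 𝓡 d) (f z)
  refine ContDiffAt.congr_of_eventuallyEq ?_ (pullbackForm_eventuallyEq η (f z) hf hz)
  have hc := contDiffAt_chart_comp hf.self_of_nhds hz
  refine contDiffAt_alternating_of_apply fun v => ?_
  refine ContDiffAt.alternating_apply
    (v := fun i y => fderiv ℝ (extChartAt (𝓡 d) (f z) ∘ f) y (v i))
    ((hη.contDiffAt ((extChartAt (𝓡 d) (f z)).map_source hz)).comp z hc) fun i => ?_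
  exact (hc.fderiv_right (m := ∞) (by simp)).clm_apply contDiffAt_const

/-- The exterior derivative commutes with pullbacks. -/
theorem extDeriv_pullbackForm [IsManifold (𝓡 d) ∞ X] {η : DiffForm d X A k}
    (hη : IsSmoothForm η) {f : G → X} {z : G}
    (hf : ∀ᶠ y in nhds z, ContMDiffAt 𝓘(ℝ, G) (𝓡 d) ∞ f y) :
    extDeriv (pullbackForm η f) z = pullbackForm (extDerivForm η) f z := by
  have hz := mem_extChartAt_source (I := 𝓡 d) (f z)
  have hc := contDiffAt_chart_comp hf.self_of_nhds hz
  rw [(pullbackForm_eventuallyEq η (f z) hf hz).extDeriv_eq]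
  have h := extDeriv_pullback (r := ∞) (f := extChartAt (𝓡 d) (f z) ∘ f) (x := z)
    ((hη.contDiffAt ((extChartAt (𝓡 d) (f z)).map_source hz)).differentiableAt (by simp)) hc
    (by simpa using WithTop.coe_le_coe.2 (le_top : (2 : ℕ∞) ≤ ⊤))
  refine h.trans ?_
  ext v
  rw [pullbackForm_apply, mfderiv_eq_fderiv_chart hf.self_of_nhds]
  rfl

theorem mfderiv_extChartAt_symm_self [IsManifold (𝓡 d) ∞ X] (x : X) :
    mfderiv 𝓘(ℝ, EuclideanSpace ℝ (Fin d)) (𝓡 d) (extChartAt (𝓡 d) x).symm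
      (extChartAt (𝓡 d) x x) = ContinuousLinearMap.id ℝ (EuclideanSpace ℝ (Fin d)) := by
  have : IsManifold (𝓡 d) 1 X := IsManifold.of_le (n := ∞) (by simp)
  have h := mfderivWithin_range_extChartAt_symm (I := 𝓡 d) (x := x)
  rw [ModelWithCorners.range_eq_univ, mfderivWithin_univ] at h
  exact h

/-- In every chart, the exterior derivative is the exterior derivative of normed spaces. -/
theorem formInChart_extDerivForm [IsManifold (𝓡 d) ∞ X] {η : DiffForm d X A k}
    (hη : IsSmoothForm η) {x₀ : X} {y : EuclideanSpace ℝ (Fin d)}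
    (hy : y ∈ (extChartAt (𝓡 d) x₀).target) :
    formInChart (extDerivForm η) x₀ y = extDeriv (formInChart η x₀) y := by
  refine (extDeriv_pullbackForm hη ?_).symm
  filter_upwards [(isOpen_extChartAt_target x₀).mem_nhds hy] with z hz
  exact contMDiffAt_extChartAt_symm x₀ hz

theorem IsSmoothForm.extDerivForm [IsManifold (𝓡 d) ∞ X] {η : DiffForm d X A k}
    (hη : IsSmoothForm η) : IsSmoothForm (extDerivForm η) := by
  intro x₀ y hy
  have he : extDeriv (formInChart η x₀) =
      ContinuousAlternatingMap.alternatizeUncurryFinCLM ℝ (EuclideanSpace ℝ (Fin d)) A ∘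
        fderiv ℝ (formInChart η x₀) := rfl
  have hd : ContDiffAt ℝ ∞ (extDeriv (formInChart η x₀)) y := he ▸
    ContDiffAt.continuousLinearMap_comp
      (ContinuousAlternatingMap.alternatizeUncurryFinCLM ℝ (EuclideanSpace ℝ (Fin d)) A)
      ((hη.contDiffAt hy).fderiv_right (m := ∞) (by simp))
  exact (hd.contDiffWithinAt (s := (extChartAt (𝓡 d) x₀).target)).congr
    (fun z hz => formInChart_extDerivForm hη hz) (formInChart_extDerivForm hη hy)

end Pullback

/-! ### The action, the fundamental vector fields and local sections -/

namespace PrincipalSU2Bundle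

variable {P M : Type*}
  [TopologicalSpace P] [ChartedSpace (EuclideanSpace ℝ (Fin 6)) P] [IsManifold (𝓡 6) ∞ P]
  [TopologicalSpace M] [ChartedSpace (EuclideanSpace ℝ (Fin 3)) M] [IsManifold (𝓡 3) ∞ M]
  (B : PrincipalSU2Bundle P M)

omit [IsManifold (𝓡 6) ∞ P] in
theorem finrank_tangent (p : P) : Module.finrank ℝ (TangentSpace (𝓡 6) p) = 6 :=
  finrank_euclideanSpace_fin

omit [IsManifold (𝓡 3) ∞ M] in
theorem finrank_tangent_base (x : M) : Module.finrank ℝ (TangentSpace (𝓡 3) x) = 3 :=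
  finrank_euclideanSpace_fin

theorem contMDiff_exp_smul (X : su2) {G : Type*} [NormedAddCommGroup G] [NormedSpace ℝ G]
    (l : G →L[ℝ] ℝ) : ContMDiff 𝓘(ℝ, G) (𝓡 3) ∞ fun z : G => su2.exp (l z • X) := by
  refine SU2.contMDiff_of_coe (ContDiff.contMDiff ?_)
  have h : ContDiff ℝ ∞ (NormedSpace.exp : Mat2 → Mat2) := by
    refine contDiff_iff_contDiffAt.2 fun x => ?_
    exact (NormedSpace.exp_analytic x).contDiffAt
  have h2 : ContDiff ℝ ∞ fun z : G => l z • (X : Mat2) := l.contDiff.smul contDiff_const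
  exact h.comp h2

theorem exp_add_smul (X : su2) (s t : ℝ) :
    su2.exp ((s + t) • X) = su2.exp (s • X) * su2.exp (t • X) := by
  apply Subtype.ext
  change NormedSpace.exp ((s + t) • (X : Mat2)) =
    NormedSpace.exp (s • (X : Mat2)) * NormedSpace.exp (t • (X : Mat2))
  rw [add_smul]
  exact Matrix.exp_add_of_commute _ _
    (((Commute.refl (X : Mat2)).smul_left s).smul_right t)

theorem exp_zero_smul (X : su2) : su2.exp ((0 : ℝ) • X) = 1 := by
  apply Subtype.ext
  change NormedSpace.exp ((0 : ℝ) • (X : Mat2)) = 1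
  rw [zero_smul, NormedSpace.exp_zero]

theorem contMDiff_act_right (g : SU2) : ContMDiff (𝓡 6) (𝓡 6) ∞ fun q => B.act q g :=
  B.smooth_act.comp (contMDiff_id.prodMk contMDiff_const)

/-- The velocity of a curve that moves along an orbit by a one-parameter group. -/
theorem mfderiv_orbit_curve (X : su2) {c : ℝ → P} {t : ℝ}
    (hc : ContMDiffAt 𝓘(ℝ, ℝ) (𝓡 6) ∞ c t)
    (h : ∀ r : ℝ, c (t + r) = B.act (c t) (su2.exp (r • X))) :
    mfderiv 𝓘(ℝ, ℝ) (𝓡 6) c t (1 : ℝ) = B.fundamental X (c t) := by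
  have h1 := mfderiv_eq_fderiv_chart hc
  have h2 : fderiv ℝ (extChartAt (𝓡 6) (c t) ∘ c) t (1 : ℝ) = B.fundamental X (c t) := by
    rw [fderiv_apply_one_eq_deriv]
    unfold fundamental
    simp only [← h]
    have := deriv_comp_const_add (f := extChartAt (𝓡 6) (c t) ∘ c) (a := t) (x := 0)
    rw [add_zero] at this
    exact this.symm
  rw [← h2]
  exact congrArg (fun L : ℝ →L[ℝ] EuclideanSpace ℝ (Fin 6) => L 1) h1

theorem contMDiff_orbit_curve (X : su2) (p : P) :
    ContMDiff 𝓘(ℝ, ℝ) (𝓡 6) ∞ fun t : ℝ => B.act p (su2.exp (t • X)) :=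
  B.smooth_act.comp (contMDiff_const.prodMk
    (contMDiff_exp_smul X (ContinuousLinearMap.id ℝ ℝ)))

theorem mdifferentiableAt_proj (p : P) : MDifferentiableAt (𝓡 6) (𝓡 3) B.proj p :=
  B.smooth_proj.mdifferentiableAt (by simp)

theorem mdifferentiableAt_act (g : SU2) (p : P) :
    MDifferentiableAt (𝓡 6) (𝓡 6) (fun q => B.act q g) p :=
  (B.contMDiff_act_right g).mdifferentiableAt (by simp)

theorem fundamental_mem_vertical (X : su2) (p : P) : B.fundamental X p ∈ B.vertical p := by
  set c : ℝ → P := fun t => B.act p (su2.exp (t • X)) with hc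
  have hs := B.contMDiff_orbit_curve X p
  have h0 : c 0 = p := by simp only [hc, exp_zero_smul, B.act_one]
  have h1 : mfderiv 𝓘(ℝ, ℝ) (𝓡 6) c 0 (1 : ℝ) = B.fundamental X (c 0) := by
    refine B.mfderiv_orbit_curve X (hs 0) fun r => ?_
    simp only [hc, zero_add, exp_zero_smul, B.act_one]
  have h2 : mfderiv 𝓘(ℝ, ℝ) (𝓡 3) (B.proj ∘ c) 0 (1 : ℝ) =
      B.dproj (c 0) (B.fundamental X (c 0)) := by
    rw [← h1]
    exact mfderiv_comp_apply (I := 𝓘(ℝ, ℝ)) (I' := 𝓡 6) (I'' := 𝓡 3) (0 : ℝ)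
      (B.mdifferentiableAt_proj (c 0)) (hs.mdifferentiableAt (by simp)) (1 : ℝ)
  have h3 : B.proj ∘ c = fun _ => B.proj p := by
    funext t; exact B.proj_act _ _
  have h4 : B.fundamental X (c 0) ∈ B.vertical (c 0) := by
    refine LinearMap.mem_ker.2 (h2.symm.trans ?_)
    have h5 : ∀ f : ℝ → M, f = (fun _ => B.proj p) →
        (mfderiv 𝓘(ℝ, ℝ) (𝓡 3) f 0 : ℝ →L[ℝ] EuclideanSpace ℝ (Fin 3)) 1 = 0 := by
      rintro _ rfl
      rw [mfderiv_const]; rfl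
    exact h5 _ h3
  rwa [h0] at h4

/-- There is a smooth local section through every point of the total space. -/
theorem exists_local_section (x₀ : M) (p : P) (hp : B.proj p = x₀) :
    ∃ s : M → P, s x₀ = p ∧ (∀ᶠ x in nhds x₀, ContMDiffAt (𝓡 3) (𝓡 6) ∞ s x) ∧
      ∀ᶠ x in nhds x₀, B.proj (s x) = x := by
  obtain ⟨e, hx, he, hes, -⟩ := B.locally_trivial x₀
  have hps : p ∈ e.source := e.mem_source.2 (hp ▸ hx)
  refine ⟨fun x => e.toOpenPartialHomeomorph.symm (x, (e p).2), ?_, ?_, ?_⟩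
  · have h1 : (x₀, (e p).2) = e p := by
      rw [← hp, ← e.coe_fst hps]
    simp only [h1]
    exact e.toOpenPartialHomeomorph.left_inv hps
  · filter_upwards [e.open_baseSet.mem_nhds hx] with x hx
    have ht : (x, (e p).2) ∈ e.target := e.mem_target.2 hx
    exact ((hes.contMDiffAt (e.open_target.mem_nhds ht))).comp x
      (contMDiffAt_id.prodMk contMDiffAt_const)
  · filter_upwards [e.open_baseSet.mem_nhds hx] with x hx
    exact e.proj_symm_apply (e.mem_target.2 hx)

theorem proj_surjective : Function.Surjective B.proj := by
  intro x
  obtain ⟨e, hx, -, -, -⟩ := B.locally_trivial x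
  exact ⟨e.toOpenPartialHomeomorph.symm (x, 1), e.proj_symm_apply (e.mem_target.2 hx)⟩

/-- The differential of a local section is a right inverse of the differential of the
projection. -/
theorem dproj_mfderiv_section {s : M → P} {x : M} (hs : ContMDiffAt (𝓡 3) (𝓡 6) ∞ s x)
    (h : ∀ᶠ y in nhds x, B.proj (s y) = y) (u : EuclideanSpace ℝ (Fin 3)) :
    (B.dproj (s x) (mfderiv (𝓡 3) (𝓡 6) s x u) : EuclideanSpace ℝ (Fin 3)) = u := by
  have h1 := mfderiv_comp_apply (I := 𝓡 3) (I' := 𝓡 6) (I'' := 𝓡 3) x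
    (B.mdifferentiableAt_proj (s x)) (hs.mdifferentiableAt (by simp)) u
  have h2 : B.proj ∘ s =ᶠ[nhds x] id := h
  have h3 := h2.mfderiv_eq (I := 𝓡 3) (I' := 𝓡 3)
  refine h1.symm.trans ?_
  refine (congrArg (fun L : EuclideanSpace ℝ (Fin 3) →L[ℝ] EuclideanSpace ℝ (Fin 3) => L u)
    h3).trans ?_
  rw [mfderiv_id]; rfl

theorem dproj_surjective (p : P) : Function.Surjective (B.dproj p) := by
  intro u
  obtain ⟨s, h1, h2, h3⟩ := B.exists_local_section (B.proj p) p rfl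
  have key : ∀ q, q = s (B.proj p) → ∃ v : EuclideanSpace ℝ (Fin 6),
      (B.dproj q : EuclideanSpace ℝ (Fin 6) →L[ℝ] EuclideanSpace ℝ (Fin 3)) v = u := by
    rintro _ rfl
    exact ⟨_, B.dproj_mfderiv_section h2.self_of_nhds h3 u⟩
  exact key p h1.symm

theorem finrank_vertical (p : P) : Module.finrank ℝ (B.vertical p) = 3 := by
  have h := LinearMap.finrank_range_add_finrank_ker (B.dproj p).toLinearMap
  have hr : LinearMap.range (B.dproj p).toLinearMap = ⊤ :=
    LinearMap.range_eq_top.2 (B.dproj_surjective p)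
  rw [hr, finrank_top, finrank_tangent, finrank_tangent_base] at h
  unfold vertical
  omega

theorem dproj_dact (g : SU2) (p : P) (v : TangentSpace (𝓡 6) p) :
    (B.dproj (B.act p g) (B.dact g p v) : EuclideanSpace ℝ (Fin 3)) = B.dproj p v := by
  have h1 := mfderiv_comp_apply (I := 𝓡 6) (I' := 𝓡 6) (I'' := 𝓡 3) p
    (B.mdifferentiableAt_proj (B.act p g)) (B.mdifferentiableAt_act g p) v
  have h2 : (B.proj ∘ fun q => B.act q g) = B.proj := by
    funext q; exact B.proj_act _ _
  refine h1.symm.trans ?_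
  have h3 : ∀ f : P → M, f = B.proj →
      (mfderiv (𝓡 6) (𝓡 3) f p : EuclideanSpace ℝ (Fin 6) →L[ℝ] EuclideanSpace ℝ (Fin 3)) v =
        B.dproj p v := by
    rintro _ rfl; rfl
  exact h3 _ h2

end PrincipalSU2Bundle

/-! ### The Lie algebra `su(2)` and the cross product -/

section Wedge

variable {T : Type*} [AddCommGroup T] [Module ℝ T] {A : Type*} [Ring A] [Algebra ℝ A] {n : ℕ}

theorem wedgeOne_oneForm_apply (α β : T →ₗ[ℝ] A) (v : Fin 2 → T) :
    wedgeOne α (oneForm β) v = α (v 0) * β (v 1) - α (v 1) * β (v 0) := by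
  simp [wedgeOne_apply, oneForm, Fin.sum_univ_two, Fin.removeNth, sub_eq_add_neg]

end Wedge

theorem AlternatingMap.apply_swap_two {T A : Type*} [AddCommGroup T] [Module ℝ T] [AddCommGroup A]
    [Module ℝ A] (β : T [⋀^Fin 2]→ₗ[ℝ] A) (u v : T) : β ![u, v] = -β ![v, u] := by
  have := β.map_swap ![v, u] (i := 0) (j := 1) (by decide)
  rw [← this]; congr 1; ext i; fin_cases i <;> simp

theorem wedgeSelf_apply {P : Type*} [TopologicalSpace P]
    [ChartedSpace (EuclideanSpace ℝ (Fin 6)) P] (α : OneForm 6 P Mat2) (p : P)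
    (v : Fin 2 → TangentSpace (𝓡 6) p) :
    wedgeSelf α p v = α p (v 0) * α p (v 1) - α p (v 1) * α p (v 0) :=
  wedgeOne_oneForm_apply _ _ v

namespace SU2

theorem inv_mul_coe (g : SU2) : ((g⁻¹ : SU2) : Mat2) * (g : Mat2) = 1 := by
  rw [← Submonoid.coe_mul, inv_mul_cancel]; rfl

theorem mul_inv_coe (g : SU2) : (g : Mat2) * ((g⁻¹ : SU2) : Mat2) = 1 := by
  rw [← Submonoid.coe_mul, mul_inv_cancel]; rfl

theorem conj_mul (g : SU2) (X Y : Mat2) :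
    ((g : Mat2) * X * ((g⁻¹ : SU2) : Mat2)) * ((g : Mat2) * Y * ((g⁻¹ : SU2) : Mat2)) =
      (g : Mat2) * (X * Y) * ((g⁻¹ : SU2) : Mat2) := by
  calc _ = (g : Mat2) * X * (((g⁻¹ : SU2) : Mat2) * (g : Mat2)) * Y * ((g⁻¹ : SU2) : Mat2) := by
        noncomm_ring
    _ = _ := by rw [inv_mul_coe]; noncomm_ring

theorem conj_commutator (g : SU2) (X Y : Mat2) :
    ((g : Mat2) * X * ((g⁻¹ : SU2) : Mat2)) * ((g : Mat2) * Y * ((g⁻¹ : SU2) : Mat2)) -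
      ((g : Mat2) * Y * ((g⁻¹ : SU2) : Mat2)) * ((g : Mat2) * X * ((g⁻¹ : SU2) : Mat2)) =
      (g : Mat2) * (X * Y - Y * X) * ((g⁻¹ : SU2) : Mat2) := by
  rw [conj_mul, conj_mul, mul_sub, sub_mul]

theorem reTrace_conj (g : SU2) (X : Mat2) :
    reTrace ((g : Mat2) * X * ((g⁻¹ : SU2) : Mat2)) = reTrace X := by
  have h : ∀ Y : Mat2, reTrace Y = Y.trace.re := fun _ => rfl
  rw [h, h, Matrix.trace_mul_cycle, inv_mul_coe, one_mul]

theorem reTrace_conj_mul_conj (g : SU2) (X Y : Mat2) :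
    reTrace ((((g⁻¹ : SU2) : Mat2) * X * g) * (((g⁻¹ : SU2) : Mat2) * Y * g)) =
      reTrace (X * Y) := by
  have h := conj_mul g⁻¹ X Y
  have h' := reTrace_conj g⁻¹ (X * Y)
  rw [inv_inv] at h h'
  rw [h, h']

end SU2

namespace su2

theorem commutator_mem {X Y : Mat2} (hX : X ∈ su2) (hY : Y ∈ su2) : X * Y - Y * X ∈ su2 := by
  refine ⟨?_, ?_⟩
  · rw [star_sub, star_mul, star_mul, hX.1, hY.1]; noncomm_ring
  · rw [Matrix.trace_sub, Matrix.trace_mul_comm, sub_self]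

/-- The coordinates of an element of `su(2)` in the basis `-iσ₁/2, -iσ₂/2, -iσ₃/2`, which is
orthonormal for `-2 Tr (X Y)` and in which the commutator is the cross product. -/
def vec : Mat2 →ₗ[ℝ] (Fin 3 → ℝ) where
  toFun X := ![-2 * (X 1 0).im, 2 * (X 1 0).re, -2 * (X 0 0).im]
  map_add' X Y := by ext i; fin_cases i <;> simp <;> ring
  map_smul' c X := by ext i; fin_cases i <;> simp <;> ring

/-- The element of `su(2)` with given coordinates. -/
def ofVec : (Fin 3 → ℝ) →ₗ[ℝ] Mat2 where
  toFun x := !![⟨0, -x 2 / 2⟩, ⟨-x 1 / 2, -x 0 / 2⟩; ⟨x 1 / 2, -x 0 / 2⟩, ⟨0, x 2 / 2⟩]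
  map_add' x y := by
    ext i j; fin_cases i <;> fin_cases j <;> simp [Complex.ext_iff] <;> (try constructor) <;> ring
  map_smul' c x := by
    ext i j; fin_cases i <;> fin_cases j <;> simp [Complex.ext_iff] <;> (try constructor) <;> ring

theorem ofVec_mem (x : Fin 3 → ℝ) : ofVec x ∈ su2 := by
  refine ⟨?_, ?_⟩
  · ext i j
    fin_cases i <;> fin_cases j <;> simp [ofVec, Complex.ext_iff, Matrix.star_apply] <;> ring
  · simp [ofVec, Matrix.trace_fin_two, Complex.ext_iff]; ring

@[simp] theorem vec_ofVec (x : Fin 3 → ℝ) : vec (ofVec x) = x := by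
  ext i; fin_cases i <;> simp [vec, ofVec] <;> ring

theorem ofVec_vec {X : Mat2} (hX : X ∈ su2) : ofVec (vec X) = X := by
  obtain ⟨h1, h2⟩ := hX
  have e := fun i j => congrFun (congrFun h1 i) j
  have h00 := e 0 0
  have h01 := e 0 1
  have h11 := e 1 1
  rw [Matrix.trace_fin_two] at h2
  simp [Matrix.star_apply, Complex.ext_iff] at h00 h01 h11 h2
  ext i j
  fin_cases i <;> fin_cases j <;> simp [ofVec, vec, Complex.ext_iff]
  · linarith
  · exact ⟨by linarith, by linarith⟩
  · exact ⟨by linarith, by linarith⟩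

/-- `su(2)` is isomorphic to `ℝ³`. -/
def equivVec : su2 ≃ₗ[ℝ] (Fin 3 → ℝ) where
  toFun X := vec X
  invFun x := ⟨ofVec x, ofVec_mem x⟩
  map_add' _ _ := map_add vec _ _
  map_smul' _ _ := map_smul vec _ _
  left_inv X := Subtype.ext (ofVec_vec X.2)
  right_inv x := vec_ofVec x

theorem finrank_eq : Module.finrank ℝ su2 = 3 := by
  rw [equivVec.finrank_eq, Module.finrank_fin_fun]

theorem vec_injOn {X Y : Mat2} (hX : X ∈ su2) (hY : Y ∈ su2) (h : vec X = vec Y) : X = Y := by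
  rw [← ofVec_vec hX, h, ofVec_vec hY]

theorem ofVec_commutator (x y : Fin 3 → ℝ) :
    ofVec x * ofVec y - ofVec y * ofVec x = ofVec (crossProduct x y) := by
  ext i j
  fin_cases i <;> fin_cases j <;>
    simp [ofVec, crossProduct, Complex.ext_iff] <;>
    (try constructor) <;> ring

theorem vec_commutator {X Y : Mat2} (hX : X ∈ su2) (hY : Y ∈ su2) :
    vec (X * Y - Y * X) = crossProduct (vec X) (vec Y) := by
  rw [← ofVec_vec hX, ← ofVec_vec hY, ofVec_commutator]; simp

theorem reTrace_mul {X Y : Mat2} (hX : X ∈ su2) (hY : Y ∈ su2) :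
    reTrace (X * Y) = -(1 / 2) * (vec X ⬝ᵥ vec Y) := by
  rw [← ofVec_vec hX, ← ofVec_vec hY, vec_ofVec, vec_ofVec]
  simp [ofVec, reTrace, Matrix.trace_fin_two, dotProduct,
    Fin.sum_univ_three]
  ring

theorem conj_mem {X : Mat2} (hX : X ∈ su2) (g : SU2) :
    (g : Mat2) * X * ((g⁻¹ : SU2) : Mat2) ∈ su2 := by
  have hg : ((g⁻¹ : SU2) : Mat2) = star (g : Mat2) := rfl
  refine ⟨?_, ?_⟩
  · rw [hg, star_mul, star_mul, star_star, hX.1]; noncomm_ring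
  · rw [Matrix.trace_mul_cycle, SU2.inv_mul_coe, one_mul, hX.2]

end su2

/-! ### The curvature is horizontal, equivariant and `su(2)`-valued -/

namespace PrincipalSU2Bundle

variable {P M : Type*}
  [TopologicalSpace P] [ChartedSpace (EuclideanSpace ℝ (Fin 6)) P] [IsManifold (𝓡 6) ∞ P]
  [TopologicalSpace M] [ChartedSpace (EuclideanSpace ℝ (Fin 3)) M] [IsManifold (𝓡 3) ∞ M]
  {B : PrincipalSU2Bundle P M} {W : OneForm 6 P Mat2}

/-- A connection is injective on vertical vectors: it maps the 3-dimensional vertical space onto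
`su(2)`. -/
theorem IsConnection.eq_zero_of_vertical (hW : B.IsConnection W) {p : P}
    {v : TangentSpace (𝓡 6) p} (hv : v ∈ B.vertical p) (h : W p v = 0) : v = 0 := by
  let f : B.vertical p →ₗ[ℝ] su2 :=
    ((W p).toLinearMap.comp (B.vertical p).subtype).codRestrict su2 fun v => hW.mem_su2 p v
  have hf : Function.Surjective f := fun X =>
    ⟨⟨B.fundamental X p, B.fundamental_mem_vertical X p⟩, Subtype.ext (hW.fundamental X p)⟩
  have hi : Function.Injective f :=
    (LinearMap.injective_iff_surjective_of_finrank_eq_finrank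
      (by rw [B.finrank_vertical, su2.finrank_eq])).2 hf
  have h0 : f ⟨v, hv⟩ = f 0 := Subtype.ext (h.trans (by simp))
  exact congrArg Subtype.val (hi h0)

/-- Every vertical vector is the fundamental vector of its value under the connection. -/
theorem IsConnection.fundamental_eq (hW : B.IsConnection W) {p : P} {v : TangentSpace (𝓡 6) p}
    (hv : v ∈ B.vertical p) : B.fundamental ⟨W p v, hW.mem_su2 p v⟩ p = v := by
  have h := hW.fundamental ⟨W p v, hW.mem_su2 p v⟩ p
  rw [← sub_eq_zero]
  refine hW.eq_zero_of_vertical (sub_mem (B.fundamental_mem_vertical _ p) hv) ?_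
  rw [map_sub, h, sub_self]

theorem exp_neg_smul (X : su2) (t : ℝ) : su2.exp ((-t) • X) = (su2.exp (t • X))⁻¹ := by
  rw [eq_inv_iff_mul_eq_one, ← exp_add_smul, neg_add_cancel, exp_zero_smul]

/-- The orbit direction is in the kernel of the curvature: pulled back to the plane by
`(s, t) ↦ c(s) · exp(tX)`, the connection has constant value `X` on `∂ₜ`, and its value on `∂ₛ`
along the second axis is `Ad(exp(-tX)) W(c'(0))`. -/
theorem IsConnection.curvature_fundamental (hW : B.IsConnection W) (p : P)
    (v : TangentSpace (𝓡 6) p) (X : su2) : curvature W p ![v, B.fundamental X p] = 0 := by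
  let φ := extChartAt (𝓡 6) p
  let v' : EuclideanSpace ℝ (Fin 6) := v
  let line : ℝ → EuclideanSpace ℝ (Fin 6) := fun s => φ p + s • v'
  have hline : ContDiff ℝ ∞ line := contDiff_const.add (contDiff_id.smul contDiff_const)
  let c : ℝ → P := fun s => φ.symm (line s)
  have hl0 : line 0 = φ p := by simp [line]
  have htarget : ∀ᶠ s in nhds (0 : ℝ), line s ∈ φ.target := by
    refine hline.continuous.continuousAt.eventually ((isOpen_extChartAt_target p).mem_nhds ?_)
    rw [hl0]; exact mem_extChartAt_target p
  have hc : ∀ᶠ s in nhds (0 : ℝ), ContMDiffAt 𝓘(ℝ, ℝ) (𝓡 6) ∞ c s := by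
    filter_upwards [htarget] with s hs
    exact (contMDiffAt_extChartAt_symm p hs).comp s hline.contMDiff.contMDiffAt
  have hc0 : c 0 = p := by simp only [c, hl0]; exact extChartAt_to_inv p
  let σ : ℝ × ℝ → P := fun z => B.act (c z.1) (su2.exp (z.2 • X))
  have hexp : ContMDiff 𝓘(ℝ, ℝ × ℝ) (𝓡 3) ∞ fun z : ℝ × ℝ => su2.exp (z.2 • X) :=
    contMDiff_exp_smul X (ContinuousLinearMap.snd ℝ ℝ ℝ)
  have hσ_of : ∀ z : ℝ × ℝ, ContMDiffAt 𝓘(ℝ, ℝ) (𝓡 6) ∞ c z.1 →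
      ContMDiffAt 𝓘(ℝ, ℝ × ℝ) (𝓡 6) ∞ σ z := fun z hz =>
    (B.smooth_act _).comp z ((ContMDiffAt.comp z (f := Prod.fst) hz
      contDiff_fst.contMDiff.contMDiffAt).prodMk hexp.contMDiffAt)
  have hσ : ∀ᶠ z in nhds (0 : ℝ × ℝ), ContMDiffAt 𝓘(ℝ, ℝ × ℝ) (𝓡 6) ∞ σ z := by
    have : ∀ᶠ z in nhds (0 : ℝ × ℝ), ContMDiffAt 𝓘(ℝ, ℝ) (𝓡 6) ∞ c z.1 :=
      (continuous_fst.tendsto' (0 : ℝ × ℝ) 0 rfl).eventually hc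
    filter_upwards [this] with z hz using hσ_of z hz
  -- the two partial derivatives
  have ht : ∀ z, ContMDiffAt 𝓘(ℝ, ℝ × ℝ) (𝓡 6) ∞ σ z →
      mfderiv 𝓘(ℝ, ℝ × ℝ) (𝓡 6) σ z ((0, 1) : ℝ × ℝ) = B.fundamental X (σ z) := by
    intro z hz
    let m : ℝ → ℝ × ℝ := fun r => (z.1, r)
    have hm : HasFDerivAt m (ContinuousLinearMap.inr ℝ ℝ ℝ) z.2 := hasFDerivAt_prodMk_right z.1 z.2
    have hms : ContMDiff 𝓘(ℝ, ℝ) 𝓘(ℝ, ℝ × ℝ) ∞ m := (contDiff_const.prodMk contDiff_id).contMDiff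
    have h1 := mfderiv_comp_apply (I := 𝓘(ℝ, ℝ)) (I' := 𝓘(ℝ, ℝ × ℝ)) (I'' := 𝓡 6) z.2
      (g := σ) (f := m) (hz.mdifferentiableAt (by simp)) (hms.mdifferentiableAt (by simp)) (1 : ℝ)
    have h2 : mfderiv 𝓘(ℝ, ℝ) 𝓘(ℝ, ℝ × ℝ) m z.2 (1 : ℝ) = ((0, 1) : ℝ × ℝ) := by
      rw [mfderiv_eq_fderiv, hm.fderiv]; rfl
    rw [h2] at h1
    refine h1.symm.trans (B.mfderiv_orbit_curve X (c := σ ∘ m) ?_ fun r => ?_)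
    · exact ContMDiffAt.comp z.2 (g := σ) hz hms.contMDiffAt
    · simp only [σ, m, Function.comp_apply, exp_add_smul, B.act_mul]
  have hs : ∀ t : ℝ, mfderiv 𝓘(ℝ, ℝ × ℝ) (𝓡 6) σ (0, t) ((1, 0) : ℝ × ℝ) =
      B.dact (su2.exp (t • X)) (c 0) (mfderiv 𝓘(ℝ, ℝ) (𝓡 6) c 0 (1 : ℝ)) := by
    intro t
    let m : ℝ → ℝ × ℝ := fun r => (r, t)
    have hm : HasFDerivAt m (ContinuousLinearMap.inl ℝ ℝ ℝ) 0 := hasFDerivAt_prodMk_left 0 t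
    have hms : ContMDiff 𝓘(ℝ, ℝ) 𝓘(ℝ, ℝ × ℝ) ∞ m := (contDiff_id.prodMk contDiff_const).contMDiff
    have h1 := mfderiv_comp_apply (I := 𝓘(ℝ, ℝ)) (I' := 𝓘(ℝ, ℝ × ℝ)) (I'' := 𝓡 6) 0
      (g := σ) (f := m) ((hσ_of (0, t) hc.self_of_nhds).mdifferentiableAt (by simp))
      (hms.mdifferentiableAt (by simp)) (1 : ℝ)
    have h2 : mfderiv 𝓘(ℝ, ℝ) 𝓘(ℝ, ℝ × ℝ) m 0 (1 : ℝ) = ((1, 0) : ℝ × ℝ) := by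
      rw [mfderiv_eq_fderiv, hm.fderiv]; rfl
    rw [h2] at h1
    exact h1.symm.trans (mfderiv_comp_apply (I := 𝓘(ℝ, ℝ)) (I' := 𝓡 6) (I'' := 𝓡 6) (0 : ℝ)
      (g := fun q => B.act q (su2.exp (t • X))) (f := c)
      (B.mdifferentiableAt_act _ _) (hc.self_of_nhds.mdifferentiableAt (by simp)) (1 : ℝ))
  -- the pulled back connection
  set η := pullbackForm (toDiffForm W) σ with hη
  have hηs : ContDiffAt ℝ ∞ η 0 := contDiffAt_pullbackForm hW.smooth hσ
  set Y : Mat2 := W (c 0) (mfderiv 𝓘(ℝ, ℝ) (𝓡 6) c 0 (1 : ℝ)) with hY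
  have hη2 : (fun z => η z ![((0, 1) : ℝ × ℝ)]) =ᶠ[nhds 0] fun _ => (X : Mat2) := by
    filter_upwards [hσ] with z hz
    change W (σ z) (mfderiv 𝓘(ℝ, ℝ × ℝ) (𝓡 6) σ z ((0, 1) : ℝ × ℝ)) = X
    rw [ht z hz, hW.fundamental]
  have hη1 : ∀ t : ℝ, η (0, t) ![((1, 0) : ℝ × ℝ)] =
      NormedSpace.exp (t • -(X : Mat2)) * Y * NormedSpace.exp (t • (X : Mat2)) := by
    intro t
    change W (σ (0, t)) (mfderiv 𝓘(ℝ, ℝ × ℝ) (𝓡 6) σ (0, t) ((1, 0) : ℝ × ℝ)) = _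
    rw [hs t]
    refine (hW.equivariant _ _ _).trans ?_
    rw [← exp_neg_smul]
    have : t • -(X : Mat2) = (((-t) • X : su2) : Mat2) := by simp
    rw [this]; rfl
  have hd : extDeriv η 0 ![((1, 0) : ℝ × ℝ), ((0, 1) : ℝ × ℝ)] = -(Y * X - X * Y) := by
    have he1 : fderiv ℝ (fun z => η z ![((1, 0) : ℝ × ℝ)]) 0 ((0, 1) : ℝ × ℝ) =
        Y * X - X * Y := by
      have hdiff : DifferentiableAt ℝ (fun z => η z ![((1, 0) : ℝ × ℝ)]) 0 :=
        (hηs.differentiableAt (by simp)).continuousAlternatingMap_apply_const _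
      have hm : HasDerivAt (fun r : ℝ => ((0, r) : ℝ × ℝ)) ((0, 1) : ℝ × ℝ) 0 :=
        (hasDerivAt_const 0 0).prodMk (hasDerivAt_id 0)
      have h1 := hdiff.hasFDerivAt.comp_hasDerivAt_of_eq (0 : ℝ) hm rfl
      have h2 : HasDerivAt (fun t : ℝ => NormedSpace.exp (t • -(X : Mat2)) * Y *
          NormedSpace.exp (t • (X : Mat2))) (Y * X - X * Y) 0 := by
        have ha := hasDerivAt_exp_smul_const (𝕂 := ℝ) (-(X : Mat2)) 0
        have hb := hasDerivAt_exp_smul_const (𝕂 := ℝ) (X : Mat2) 0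
        refine ((ha.mul_const Y).mul hb).congr_deriv ?_
        simp only [zero_smul, NormedSpace.exp_zero]
        noncomm_ring
      have h3 : ((fun z => η z ![((1, 0) : ℝ × ℝ)]) ∘ fun r : ℝ => ((0, r) : ℝ × ℝ)) =
          fun t : ℝ => NormedSpace.exp (t • -(X : Mat2)) * Y *
            NormedSpace.exp (t • (X : Mat2)) := funext hη1
      rw [h3] at h1
      exact h1.unique h2
    have he2 : fderiv ℝ (fun z => η z ![((0, 1) : ℝ × ℝ)]) 0 ((1, 0) : ℝ × ℝ) = 0 := by
      rw [hη2.fderiv_eq]; simp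
    have r0 : Fin.removeNth 0 ![((1, 0) : ℝ × ℝ), ((0, 1) : ℝ × ℝ)] = ![((0, 1) : ℝ × ℝ)] := by
      ext i <;> fin_cases i <;> rfl
    have r1 : Fin.removeNth 1 ![((1, 0) : ℝ × ℝ), ((0, 1) : ℝ × ℝ)] = ![((1, 0) : ℝ × ℝ)] := by
      ext i <;> fin_cases i <;> rfl
    rw [extDeriv_apply (hηs.differentiableAt (by simp)), Fin.sum_univ_two, r0, r1]
    simp [he1, he2]
  have hcurv : curvature W (σ 0) ![mfderiv 𝓘(ℝ, ℝ × ℝ) (𝓡 6) σ 0 ((1, 0) : ℝ × ℝ),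
      B.fundamental X (σ 0)] = 0 := by
    have h1 : W (σ 0) (mfderiv 𝓘(ℝ, ℝ × ℝ) (𝓡 6) σ 0 ((1, 0) : ℝ × ℝ)) = Y := by
      refine (hη1 0).trans ?_
      simp [NormedSpace.exp_zero]
    have h2 : extDerivForm (toDiffForm W) (σ 0)
        ![mfderiv 𝓘(ℝ, ℝ × ℝ) (𝓡 6) σ 0 ((1, 0) : ℝ × ℝ), B.fundamental X (σ 0)] =
          -(Y * X - X * Y) := by
      rw [← hd, extDeriv_pullbackForm hW.smooth hσ, pullbackForm_apply]
      congr 1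
      ext1 i
      fin_cases i
      · rfl
      · exact (ht 0 hσ.self_of_nhds).symm
    have h3 := wedgeSelf_apply W (σ 0)
      ![mfderiv 𝓘(ℝ, ℝ × ℝ) (𝓡 6) σ 0 ((1, 0) : ℝ × ℝ), B.fundamental X (σ 0)]
    simp only [Matrix.cons_val_zero, Matrix.cons_val_one] at h3
    rw [h1, hW.fundamental] at h3
    refine (congrArg₂ (· + ·) h2 h3).trans ?_
    simp
  have transfer : ∀ q : P, q = σ 0 → ∀ w : EuclideanSpace ℝ (Fin 6),
      w = mfderiv 𝓘(ℝ, ℝ × ℝ) (𝓡 6) σ 0 ((1, 0) : ℝ × ℝ) →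
      curvature W q ![(w : TangentSpace (𝓡 6) q), B.fundamental X q] = 0 := by
    rintro _ rfl _ rfl; exact hcurv
  have hσ0 : σ 0 = p := by
    simp only [σ, Prod.fst_zero, Prod.snd_zero, exp_zero_smul, B.act_one, hc0]
  refine transfer p hσ0.symm v ?_
  have hm := mfderiv_eq_fderiv_chart hσ.self_of_nhds
  refine Eq.trans ?_ (congrArg (fun L : ℝ × ℝ →L[ℝ] EuclideanSpace ℝ (Fin 6) => L (1, 0)) hm).symm
  rw [hσ0]
  have hdiff : DifferentiableAt ℝ (φ ∘ σ) 0 :=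
    (contDiffAt_chart_comp (x₀ := p) hσ.self_of_nhds
      (by rw [hσ0]; exact mem_extChartAt_source p)).differentiableAt (by simp)
  have hcurve : HasDerivAt (fun r : ℝ => ((r, 0) : ℝ × ℝ)) ((1, 0) : ℝ × ℝ) 0 :=
    (hasDerivAt_id 0).prodMk (hasDerivAt_const 0 0)
  have h1 := hdiff.hasFDerivAt.comp_hasDerivAt_of_eq (0 : ℝ) hcurve rfl
  have h2 : (φ ∘ σ) ∘ (fun r : ℝ => ((r, 0) : ℝ × ℝ)) =ᶠ[nhds 0] line := by
    filter_upwards [htarget] with r hr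
    simp only [Function.comp_apply, σ, exp_zero_smul, B.act_one, c]
    exact φ.right_inv hr
  have h3 : HasDerivAt line v' 0 := by
    have := ((hasDerivAt_id (0 : ℝ)).smul_const v').const_add (φ p)
    rw [one_smul] at this
    exact this
  exact h3.unique (h1.congr_of_eventuallyEq h2.symm)

/-- `su(2)` is closed under commutators, and derivatives of `su(2)`-valued functions stay in it. -/
theorem IsConnection.curvature_mem_su2 (hW : B.IsConnection W) (p : P)
    (v : Fin 2 → TangentSpace (𝓡 6) p) : curvature W p v ∈ su2 := by
  -- the projection `L` along `su(2)` kills the connection, hence its exterior derivative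
  let L : Mat2 →L[ℝ] Mat2 := LinearMap.toContinuousLinearMap
    (LinearMap.id - su2.ofVec ∘ₗ su2.vec)
  have hL : ∀ X, X ∈ su2 → L X = 0 := fun X hX => sub_eq_zero.2 (su2.ofVec_vec hX).symm
  have hL' : ∀ X, L X = 0 → X ∈ su2 := fun X hX => by
    have h : X = su2.ofVec (su2.vec X) := sub_eq_zero.1 hX
    rw [h]; exact su2.ofVec_mem _
  have h0 : (fun y => L.compContinuousAlternatingMap (formInChart (toDiffForm W) p y)) =
      fun _ => 0 := by
    funext y
    ext1 w
    exact hL _ (hW.mem_su2 _ _)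
  have h1 := extDeriv_clm_comp L ((hW.smooth.contDiffAt
    (mem_extChartAt_target (I := 𝓡 6) p)).differentiableAt (by simp))
  rw [h0] at h1
  have h2 : extDeriv (fun _ : EuclideanSpace ℝ (Fin 6) =>
      (0 : EuclideanSpace ℝ (Fin 6) [⋀^Fin 1]→L[ℝ] Mat2)) (extChartAt (𝓡 6) p p) = 0 := by
    ext1 w
    rw [extDeriv_apply (differentiableAt_const _)]
    simp
  rw [h2] at h1
  have h3 : extDerivForm (toDiffForm W) p v ∈ su2 := hL' _ (DFunLike.congr_fun h1 v).symm
  refine add_mem h3 ((wedgeSelf_apply W p v).symm ▸ ?_)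
  exact su2.commutator_mem (hW.mem_su2 _ _) (hW.mem_su2 _ _)

/-- The exterior derivative commutes with the pullback by right translations and with conjugation of
the values. -/
theorem IsConnection.curvature_equivariant (hW : B.IsConnection W) (g : SU2) (p : P)
    (v : Fin 2 → TangentSpace (𝓡 6) p) :
    curvature W (B.act p g) (fun i => B.dact g p (v i)) =
      ((g⁻¹ : SU2) : Mat2) * curvature W p v * g := by
  let φ := extChartAt (𝓡 6) p
  have hp : φ.symm (φ p) = p := extChartAt_to_inv p
  let f : EuclideanSpace ℝ (Fin 6) → P := fun y => B.act (φ.symm y) g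
  have hφ : ∀ᶠ y in nhds (φ p), ContMDiffAt 𝓘(ℝ, EuclideanSpace ℝ (Fin 6)) (𝓡 6) ∞ φ.symm y := by
    filter_upwards [(isOpen_extChartAt_target p).mem_nhds (mem_extChartAt_target p)] with y hy
    exact contMDiffAt_extChartAt_symm p hy
  have hf : ∀ᶠ y in nhds (φ p), ContMDiffAt 𝓘(ℝ, EuclideanSpace ℝ (Fin 6)) (𝓡 6) ∞ f y := by
    filter_upwards [hφ] with y hy
    exact (B.contMDiff_act_right g _).comp y hy
  let L : Mat2 →L[ℝ] Mat2 := LinearMap.toContinuousLinearMap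
    (LinearMap.mulRight ℝ (g : Mat2) ∘ₗ LinearMap.mulLeft ℝ ((g⁻¹ : SU2) : Mat2))
  have hL : ∀ X, L X = ((g⁻¹ : SU2) : Mat2) * X * g := fun X => rfl
  have hD : ∀ y, ContMDiffAt 𝓘(ℝ, EuclideanSpace ℝ (Fin 6)) (𝓡 6) ∞ φ.symm y →
      ∀ w : EuclideanSpace ℝ (Fin 6),
      mfderiv 𝓘(ℝ, EuclideanSpace ℝ (Fin 6)) (𝓡 6) f y w = B.dact g (φ.symm y)
        (mfderiv 𝓘(ℝ, EuclideanSpace ℝ (Fin 6)) (𝓡 6) φ.symm y w) := fun y hy w =>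
    mfderiv_comp_apply (I := 𝓘(ℝ, EuclideanSpace ℝ (Fin 6))) (I' := 𝓡 6) (I'' := 𝓡 6) y
      (g := fun q => B.act q g) (f := φ.symm)
      (B.mdifferentiableAt_act g _) (hy.mdifferentiableAt (by simp)) w
  have hpull : pullbackForm (toDiffForm W) f =ᶠ[nhds (φ p)] fun y =>
      L.compContinuousAlternatingMap (formInChart (toDiffForm W) p y) := by
    filter_upwards [hφ] with y hy
    ext1 w
    change W (f y) (mfderiv 𝓘(ℝ, EuclideanSpace ℝ (Fin 6)) (𝓡 6) f y (w 0)) = _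
    rw [hD y hy]
    exact hW.equivariant _ _ _
  have h1 := extDeriv_pullbackForm hW.smooth hf
  rw [hpull.extDeriv_eq, extDeriv_clm_comp L ((hW.smooth.contDiffAt
    (mem_extChartAt_target p)).differentiableAt (by simp))] at h1
  have h2 : extDerivForm (toDiffForm W) (B.act p g) (fun i => B.dact g p (v i)) =
      L (extDerivForm (toDiffForm W) p v) := by
    have h3 : ∀ w : Fin 2 → EuclideanSpace ℝ (Fin 6),
        pullbackForm (extDerivForm (toDiffForm W)) f (φ p) w =
          extDerivForm (toDiffForm W) (B.act (φ.symm (φ p)) g)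
            (fun i => B.dact g (φ.symm (φ p)) (w i)) := by
      intro w
      rw [pullbackForm_apply]
      simp only [hD (φ p) hφ.self_of_nhds]
      exact congrArg (fun D : EuclideanSpace ℝ (Fin 6) →L[ℝ] EuclideanSpace ℝ (Fin 6) =>
        extDerivForm (toDiffForm W) (B.act (φ.symm (φ p)) g)
          (fun i => B.dact g (φ.symm (φ p)) (D (w i)))) (mfderiv_extChartAt_symm_self p)
    refine Eq.trans ?_ (((DFunLike.congr_fun h1 _).trans (h3 v)).symm)
    have transfer : ∀ q : P, q = p → ∀ w : Fin 2 → EuclideanSpace ℝ (Fin 6),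
        extDerivForm (toDiffForm W) (B.act p g) (fun i => B.dact g p (w i)) =
          extDerivForm (toDiffForm W) (B.act q g) (fun i => B.dact g q (w i)) := by
      rintro _ rfl w; rfl
    exact transfer _ hp v
  change _ + wedgeSelf W (B.act p g) _ = _ * (_ + wedgeSelf W p v) * _
  rw [wedgeSelf_apply, wedgeSelf_apply, hW.equivariant, hW.equivariant]
  have h4 : ∀ a b : Mat2, ((g⁻¹ : SU2) : Mat2) * a * g * (((g⁻¹ : SU2) : Mat2) * b * g) =
      ((g⁻¹ : SU2) : Mat2) * (a * b) * g := fun a b => by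
    simpa only [inv_inv] using SU2.conj_mul g⁻¹ a b
  rw [h4, h4, mul_add, add_mul, mul_sub, sub_mul]
  exact congrArg₂ (· + ·) h2 rfl

end PrincipalSU2Bundle

/-! ### The algebra of the square root -/

section CrossProduct

/-- The square root of a cofactor matrix: from the products `bᵢ = aⱼ × aₖ` of a positive frame one
recovers the coordinates of every vector `x` from its products with the frame. -/
theorem eq_of_cross_products (a : Fin 3 → Fin 3 → ℝ) (x : Fin 3 → ℝ)
    (ha : 0 < a 0 ⬝ᵥ a 1 ⨯₃ a 2) {b : Fin 3 → Fin 3 → ℝ} (h0 : b 0 = a 1 ⨯₃ a 2)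
    (h1 : b 1 = a 2 ⨯₃ a 0) (h2 : b 2 = a 0 ⨯₃ a 1) :
    0 < b 0 ⬝ᵥ b 1 ⨯₃ b 2 ∧
    x = ((b 0 ⬝ᵥ b 1 ⨯₃ b 2) * √(b 0 ⬝ᵥ b 1 ⨯₃ b 2))⁻¹ •
      (((x ⨯₃ a 1) ⬝ᵥ (b 0 ⨯₃ b 1)) • (b 1 ⨯₃ b 2) +
        ((x ⨯₃ a 2) ⬝ᵥ (b 1 ⨯₃ b 2)) • (b 2 ⨯₃ b 0) +
        ((x ⨯₃ a 0) ⬝ᵥ (b 2 ⨯₃ b 0)) • (b 0 ⨯₃ b 1)) := by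
  set τ := a 0 ⬝ᵥ a 1 ⨯₃ a 2 with hτ
  have hD : b 0 ⬝ᵥ b 1 ⨯₃ b 2 = τ * τ := by
    rw [h0, h1, h2, hτ]
    simp [cross_apply, dotProduct, Fin.sum_univ_three]
    ring
  have c0 : b 1 ⨯₃ b 2 = τ • a 0 := by
    rw [h1, h2, hτ]
    ext i; fin_cases i <;> simp [cross_apply, dotProduct, Fin.sum_univ_three] <;> ring
  have c1 : b 2 ⨯₃ b 0 = τ • a 1 := by
    rw [h2, h0, hτ]
    ext i; fin_cases i <;> simp [cross_apply, dotProduct, Fin.sum_univ_three] <;> ring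
  have c2 : b 0 ⨯₃ b 1 = τ • a 2 := by
    rw [h0, h1, hτ]
    ext i; fin_cases i <;> simp [cross_apply, dotProduct, Fin.sum_univ_three] <;> ring
  refine ⟨hD ▸ mul_pos ha ha, ?_⟩
  rw [hD, Real.sqrt_mul_self ha.le, c0, c1, c2]
  have key : τ • x = ((x ⨯₃ a 1) ⬝ᵥ a 2) • a 0 + ((x ⨯₃ a 2) ⬝ᵥ a 0) • a 1 +
      ((x ⨯₃ a 0) ⬝ᵥ a 1) • a 2 := by
    rw [hτ]
    ext i; fin_cases i <;> simp [cross_apply, dotProduct, Fin.sum_univ_three] <;> ring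
  have : (((x ⨯₃ a 1) ⬝ᵥ (τ • a 2)) • τ • a 0 + ((x ⨯₃ a 2) ⬝ᵥ (τ • a 0)) • τ • a 1 +
      ((x ⨯₃ a 0) ⬝ᵥ (τ • a 1)) • τ • a 2) = (τ * τ * τ) • x := by
    rw [mul_smul, key]
    simp only [dotProduct_smul, smul_add, smul_smul, smul_eq_mul]
    congr 1
    · congr 1 <;> congr 1 <;> ring
    · congr 1; ring
  rw [this, smul_smul, inv_mul_cancel₀ (by positivity), one_smul]

/-- A triple of vectors with positive determinant is a triple of cross products. -/
theorem exists_cross_products {b : Fin 3 → Fin 3 → ℝ} (hb : 0 < b 0 ⬝ᵥ b 1 ⨯₃ b 2) :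
    ∃ a : Fin 3 → Fin 3 → ℝ, 0 < a 0 ⬝ᵥ a 1 ⨯₃ a 2 ∧ a 1 ⨯₃ a 2 = b 0 ∧ a 2 ⨯₃ a 0 = b 1 ∧
      a 0 ⨯₃ a 1 = b 2 := by
  set D := b 0 ⬝ᵥ b 1 ⨯₃ b 2 with hD
  set s := (√D)⁻¹ with hs
  have hsp : 0 < s := by positivity
  have hs2 : s * s * D = 1 := by
    have h1 : √D * √D = D := Real.mul_self_sqrt hb.le
    have h2 : s * √D = 1 := inv_mul_cancel₀ (by positivity)
    calc s * s * D = s * s * (√D * √D) := by rw [h1]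
      _ = (s * √D) * (s * √D) := by ring
      _ = 1 := by rw [h2, one_mul]
  refine ⟨![s • (b 1 ⨯₃ b 2), s • (b 2 ⨯₃ b 0), s • (b 0 ⨯₃ b 1)], ?_, ?_, ?_, ?_⟩
  · have : (s • (b 1 ⨯₃ b 2)) ⬝ᵥ (s • (b 2 ⨯₃ b 0)) ⨯₃ (s • (b 0 ⨯₃ b 1)) =
        s * s * s * (D * D) := by
      rw [hD]; simp [cross_apply, dotProduct, Fin.sum_univ_three]; ring
    change 0 < (s • (b 1 ⨯₃ b 2)) ⬝ᵥ (s • (b 2 ⨯₃ b 0)) ⨯₃ (s • (b 0 ⨯₃ b 1))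
    rw [this]; positivity
  · calc (s • (b 2 ⨯₃ b 0)) ⨯₃ (s • (b 0 ⨯₃ b 1)) = (s * s * D) • b 0 := by
          rw [hD]
          ext i; fin_cases i <;> simp [cross_apply, dotProduct, Fin.sum_univ_three] <;> ring
      _ = b 0 := by rw [hs2, one_smul]
  · calc (s • (b 0 ⨯₃ b 1)) ⨯₃ (s • (b 1 ⨯₃ b 2)) = (s * s * D) • b 1 := by
          rw [hD]
          ext i; fin_cases i <;> simp [cross_apply, dotProduct, Fin.sum_univ_three] <;> ring
      _ = b 1 := by rw [hs2, one_smul]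
  · calc (s • (b 1 ⨯₃ b 2)) ⨯₃ (s • (b 2 ⨯₃ b 0)) = (s * s * D) • b 2 := by
          rw [hD]
          ext i; fin_cases i <;> simp [cross_apply, dotProduct, Fin.sum_univ_three] <;> ring
      _ = b 2 := by rw [hs2, one_smul]

end CrossProduct

/-! ### Forms of negative type and horizontal 2-forms -/

section NegativeType

variable {T : Type*} [AddCommGroup T] [Module ℝ T]

/-- For a 3-form of negative type and a vector `ξ ≠ 0` the kernel of `Ω(ξ, ·, ·)` is the complex
line spanned by `ξ`, so that it contains no 3-dimensional subspace. -/
theorem IsNegativeType.false_of_kernel {Ω : T [⋀^Fin 3]→ₗ[ℝ] ℝ} (hΩ : IsNegativeType Ω) {ξ : T}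
    (hξ : ξ ≠ 0) {L : (Fin 3 → ℝ) →ₗ[ℝ] T} (hL : Function.Injective L)
    (h : ∀ x ζ, Ω ![ξ, L x, ζ] = 0) : False := by
  classical
  obtain ⟨α, hα⟩ := hΩ
  set a := α ξ with ha
  have ha0 : a ≠ 0 := by simpa [ha] using hξ
  have hmem : ∀ x, L x ∈ Submodule.span ℝ (({ξ, α.symm (Complex.I • a)} : Finset T) : Set T) := by
    intro x
    set b := α (L x) with hb
    have hdet : ∀ c : Fin 3 → ℂ, ((a 1 * b 2 - a 2 * b 1) * c 0 + (a 2 * b 0 - a 0 * b 2) * c 1 +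
        (a 0 * b 1 - a 1 * b 0) * c 2).re = 0 := by
      intro c
      have h1 := h x (α.symm c)
      rw [hα, Matrix.det_fin_three] at h1
      simp only [Matrix.of_apply, Matrix.cons_val_zero, Matrix.cons_val_one, Matrix.cons_val,
        LinearEquiv.apply_symm_apply, ← ha, ← hb] at h1
      have h2 := (mul_eq_zero.1 h1).resolve_left two_ne_zero
      rw [← h2]; congr 1; ring
    have hz : ∀ z : ℂ, (z * 1).re = 0 → (z * Complex.I).re = 0 → z = 0 := by
      intro z h1 h2
      apply Complex.ext <;> simp_all
    have m0 : a 1 * b 2 - a 2 * b 1 = 0 :=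
      hz _ (by simpa using hdet ![1, 0, 0]) (by simpa using hdet ![Complex.I, 0, 0])
    have m1 : a 2 * b 0 - a 0 * b 2 = 0 :=
      hz _ (by simpa using hdet ![0, 1, 0]) (by simpa using hdet ![0, Complex.I, 0])
    have m2 : a 0 * b 1 - a 1 * b 0 = 0 :=
      hz _ (by simpa using hdet ![0, 0, 1]) (by simpa using hdet ![0, 0, Complex.I])
    obtain ⟨l, hl⟩ : ∃ l : ℂ, b = l • a := by
      obtain ⟨i, hi⟩ := Function.ne_iff.1 ha0
      refine ⟨b i / a i, ?_⟩
      rw [Pi.zero_apply] at hi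
      ext j
      rw [Pi.smul_apply, smul_eq_mul, div_mul_eq_mul_div, eq_div_iff hi]
      fin_cases i <;> fin_cases j <;> simp <;>
        first
        | linear_combination m0
        | linear_combination -m0
        | linear_combination m1
        | linear_combination -m1
        | linear_combination m2
        | linear_combination -m2
    have hx : L x = l.re • ξ + l.im • α.symm (Complex.I • a) := by
      apply α.injective
      rw [← hb, hl, map_add, map_smul, map_smul, LinearEquiv.apply_symm_apply, ← ha]
      ext j
      simp only [Pi.add_apply, Pi.smul_apply, smul_eq_mul, Complex.real_smul]
      conv_lhs => rw [← Complex.re_add_im l]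
      ring
    rw [hx]
    exact add_mem (Submodule.smul_mem _ _ (Submodule.subset_span (by simp)))
      (Submodule.smul_mem _ _ (Submodule.subset_span (by simp)))
  set S := Submodule.span ℝ (({ξ, α.symm (Complex.I • a)} : Finset T) : Set T) with hS
  have h1 := LinearMap.finrank_le_finrank_of_injective (f := L.codRestrict S hmem)
    (fun x y hxy => hL (congrArg Subtype.val hxy))
  have h2 := finrank_span_finset_le_card (R := ℝ) ({ξ, α.symm (Complex.I • a)} : Finset T)
  have h3 : ({ξ, α.symm (Complex.I • a)} : Finset T).card ≤ 2 := Finset.card_le_two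
  rw [Module.finrank_fin_fun] at h1
  change Module.finrank ℝ S ≤ _ at h2
  omega

variable {w q : T →ₗ[ℝ] (Fin 3 → ℝ)} {F : T [⋀^Fin 2]→ₗ[ℝ] (Fin 3 → ℝ)}
  {Ω : T [⋀^Fin 3]→ₗ[ℝ] ℝ}

/-- A horizontal 2-form, expanded in a frame `k` of the horizontal directions. -/
theorem horizontal_two_form_apply {k : Fin 3 → T} (hqk : ∀ i, q (k i) = Pi.single i 1)
    (hF : ∀ ξ v, q ξ = 0 → F ![v, ξ] = 0) (u v : T) :
    F ![u, v] = (q u ⨯₃ q v) 0 • F ![k 1, k 2] + (q u ⨯₃ q v) 1 • F ![k 2, k 0] +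
      (q u ⨯₃ q v) 2 • F ![k 0, k 1] := by
  have hadd : ∀ u v v', F ![u, v + v'] = F ![u, v] + F ![u, v'] := fun u v v' =>
    (contractTwo F u).map_add v v'
  have hsmul : ∀ (c : ℝ) u v, F ![u, c • v] = c • F ![u, v] := fun c u v =>
    (contractTwo F u).map_smul c v
  have hswap := AlternatingMap.apply_swap_two F
  have hself : ∀ u, F ![u, u] = 0 := fun u =>
    F.map_eq_zero_of_eq ![u, u] (i := 0) (j := 1) rfl (by decide)
  have hred : ∀ u v, F ![u, v] = F ![u, q v 0 • k 0 + q v 1 • k 1 + q v 2 • k 2] := by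
    intro u v
    have h0 : q (v - (q v 0 • k 0 + q v 1 • k 1 + q v 2 • k 2)) = 0 := by
      simp only [map_sub, map_add, map_smul, hqk]
      ext i; fin_cases i <;> simp
    have h1 := hF _ u h0
    have h2 := hadd u (v - (q v 0 • k 0 + q v 1 • k 1 + q v 2 • k 2))
      (q v 0 • k 0 + q v 1 • k 1 + q v 2 • k 2)
    rw [sub_add_cancel, h1, zero_add] at h2
    exact h2
  have hk : ∀ i, F ![u, k i] = -(q u 0 • F ![k i, k 0] + q u 1 • F ![k i, k 1] +
      q u 2 • F ![k i, k 2]) := by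
    intro i
    rw [hswap, hred (k i) u]
    simp only [hadd, hsmul]
  rw [hred u v]
  simp only [hadd, hsmul, hk, hself]
  rw [hswap (k 1) (k 0), hswap (k 2) (k 1), hswap (k 0) (k 2)]
  simp only [cross_apply, Matrix.cons_val_zero, Matrix.cons_val_one, Matrix.cons_val]
  module

end NegativeType

/-! ### Hitchin's endomorphism of the model form -/

section HitchinJ

variable {T : Type*} [AddCommGroup T] [Module ℝ T]

theorem wedgeOne_apply_six (a : T →ₗ[ℝ] ℝ) (γ : T [⋀^Fin 5]→ₗ[ℝ] ℝ) (b : Fin 6 → T) :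
    wedgeOne a γ b = a (b 0) * γ ![b 1, b 2, b 3, b 4, b 5] - a (b 1) * γ ![b 0, b 2, b 3, b 4, b 5]
      + a (b 2) * γ ![b 0, b 1, b 3, b 4, b 5] - a (b 3) * γ ![b 0, b 1, b 2, b 4, b 5]
      + a (b 4) * γ ![b 0, b 1, b 2, b 3, b 5] - a (b 5) * γ ![b 0, b 1, b 2, b 3, b 4] := by
  rw [wedgeOne_apply, Fin.sum_univ_six]
  have r0 : Fin.removeNth 0 b = ![b 1, b 2, b 3, b 4, b 5] := by ext i; fin_cases i <;> rfl
  have r1 : Fin.removeNth 1 b = ![b 0, b 2, b 3, b 4, b 5] := by ext i; fin_cases i <;> rfl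
  have r2 : Fin.removeNth 2 b = ![b 0, b 1, b 3, b 4, b 5] := by ext i; fin_cases i <;> rfl
  have r3 : Fin.removeNth 3 b = ![b 0, b 1, b 2, b 4, b 5] := by ext i; fin_cases i <;> rfl
  have r4 : Fin.removeNth 4 b = ![b 0, b 1, b 2, b 3, b 5] := by ext i; fin_cases i <;> rfl
  have r5 : Fin.removeNth 5 b = ![b 0, b 1, b 2, b 3, b 4] := by ext i; fin_cases i <;> rfl
  rw [r0, r1, r2, r3, r4, r5]
  norm_num
  ring

theorem wedgeOne_apply_four (a : T →ₗ[ℝ] ℝ) (γ : T [⋀^Fin 3]→ₗ[ℝ] ℝ) (x y z t : T) :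
    wedgeOne a γ ![x, y, z, t] = a x * γ ![y, z, t] - a y * γ ![x, z, t] + a z * γ ![x, y, t]
      - a t * γ ![x, y, z] := by
  rw [wedgeOne_apply, Fin.sum_univ_four]
  have r0 : Fin.removeNth 0 ![x, y, z, t] = ![y, z, t] := by ext i; fin_cases i <;> rfl
  have r1 : Fin.removeNth 1 ![x, y, z, t] = ![x, z, t] := by ext i; fin_cases i <;> rfl
  have r2 : Fin.removeNth 2 ![x, y, z, t] = ![x, y, t] := by ext i; fin_cases i <;> rfl
  have r3 : Fin.removeNth 3 ![x, y, z, t] = ![x, y, z] := by ext i; fin_cases i <;> rfl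
  have e2 : ![x, y, z, t] 2 = z := rfl
  have e3 : ![x, y, z, t] 3 = t := rfl
  rw [r0, r1, r2, r3, e2, e3]
  norm_num
  ring

theorem wedgeTwo_apply_five (β : T [⋀^Fin 2]→ₗ[ℝ] ℝ) (γ : T [⋀^Fin 3]→ₗ[ℝ] ℝ) (x y z t s : T) :
    wedgeTwo β γ ![x, y, z, t, s] = β ![x, y] * γ ![z, t, s] - β ![x, z] * γ ![y, t, s]
      + β ![x, t] * γ ![y, z, s] - β ![x, s] * γ ![y, z, t] + β ![y, z] * γ ![x, t, s]
      - β ![y, t] * γ ![x, z, s] + β ![y, s] * γ ![x, z, t] + β ![z, t] * γ ![x, y, s]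
      - β ![z, s] * γ ![x, y, t] + β ![t, s] * γ ![x, y, z] := by
  have hswap := AlternatingMap.apply_swap_two β
  rw [wedgeTwo_apply, Fin.sum_univ_five]
  have r0 : Fin.removeNth 0 ![x, y, z, t, s] = ![y, z, t, s] := by ext i; fin_cases i <;> rfl
  have r1 : Fin.removeNth 1 ![x, y, z, t, s] = ![x, z, t, s] := by ext i; fin_cases i <;> rfl
  have r2 : Fin.removeNth 2 ![x, y, z, t, s] = ![x, y, t, s] := by ext i; fin_cases i <;> rfl
  have r3 : Fin.removeNth 3 ![x, y, z, t, s] = ![x, y, z, s] := by ext i; fin_cases i <;> rfl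
  have r4 : Fin.removeNth 4 ![x, y, z, t, s] = ![x, y, z, t] := by ext i; fin_cases i <;> rfl
  rw [r0, r1, r2, r3, r4]
  have e2 : ![x, y, z, t, s] 2 = z := rfl
  have e3 : ![x, y, z, t, s] 3 = t := rfl
  have e4 : ![x, y, z, t, s] 4 = s := rfl
  rw [e2, e3, e4]
  simp only [wedgeOne_apply_four, contractTwo_apply]
  norm_num
  rw [hswap y x, hswap z x, hswap z y, hswap t x, hswap t y, hswap t z, hswap s x, hswap s y,
    hswap s z, hswap s t]
  ring

/-- The ratio of two top-degree forms can be computed on any basis. -/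
theorem topRatio_eq {v : T [⋀^Fin 6]→ₗ[ℝ] ℝ} (hv : v ≠ 0) (e : Module.Basis (Fin 6) ℝ T)
    (η : T [⋀^Fin 6]→ₗ[ℝ] ℝ) : v e ≠ 0 ∧ topRatio v η = η e / v e := by
  have h1 := fun f : T [⋀^Fin 6]→ₗ[ℝ] ℝ => f.eq_smul_basis_det e
  have hve : v e ≠ 0 := by
    intro h
    apply hv
    rw [h1 v, h, zero_smul]
  refine ⟨hve, ?_⟩
  have hx : v (Classical.epsilon fun b => v b ≠ 0) ≠ 0 :=
    Classical.epsilon_spec (p := fun b => v b ≠ 0) ⟨e, hve⟩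
  change η (Classical.epsilon fun b => v b ≠ 0) / v (Classical.epsilon fun b => v b ≠ 0) = _
  generalize (Classical.epsilon fun b => v b ≠ 0) = x at hx
  have hη := congrArg (fun f : T [⋀^Fin 6]→ₗ[ℝ] ℝ => f x) (h1 η)
  have hvx := congrArg (fun f : T [⋀^Fin 6]→ₗ[ℝ] ℝ => f x) (h1 v)
  simp only [AlternatingMap.smul_apply, smul_eq_mul] at hη hvx
  have hd : e.det x ≠ 0 := by
    intro h
    rw [h, mul_zero] at hvx
    exact hx hvx
  rw [hη, hvx, mul_div_mul_right _ _ hd]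

/-- The 6-form `a ∧ i_ξ Ω ∧ Ω` of `Ω = 2 Re (dz₁ ∧ dz₂ ∧ dz₃)`, on the standard real basis of `ℂ³`:
it is `-8 a(iξ)`. -/
theorem wedge_contraction_apply {Ω : T [⋀^Fin 3]→ₗ[ℝ] ℝ} (β : T ≃ₗ[ℝ] (Fin 3 → ℂ))
    (hΩ : ∀ u : Fin 3 → T, Ω u = 2 * (Matrix.det (Matrix.of fun i j => β (u j) i)).re)
    (a : T →ₗ[ℝ] ℝ) (ξ : T) {e : Fin 6 → T} (h0 : β (e 0) = ![1, 0, 0])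
    (h1 : β (e 1) = ![Complex.I, 0, 0]) (h2 : β (e 2) = ![0, 1, 0])
    (h3 : β (e 3) = ![0, Complex.I, 0]) (h4 : β (e 4) = ![0, 0, 1])
    (h5 : β (e 5) = ![0, 0, Complex.I]) :
    wedgeOne a (wedgeTwo (Ω.curryLeft ξ) Ω) e = -8 * a (β.symm (Complex.I • β ξ)) := by
  have hdet : ∀ x y z : T, Ω ![x, y, z] = 2 * (β x 0 * β y 1 * β z 2 - β x 0 * β z 1 * β y 2
      - β y 0 * β x 1 * β z 2 + β y 0 * β z 1 * β x 2 + β z 0 * β x 1 * β y 2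
      - β z 0 * β y 1 * β x 2).re := by
    intro x y z
    rw [hΩ, Matrix.det_fin_three]
    rfl
  have hI : β.symm (Complex.I • β ξ) = (β ξ 0).re • e 1 - (β ξ 0).im • e 0 + (β ξ 1).re • e 3
      - (β ξ 1).im • e 2 + (β ξ 2).re • e 5 - (β ξ 2).im • e 4 := by
    apply β.injective
    rw [LinearEquiv.apply_symm_apply]
    simp only [map_sub, map_add, map_smul, h0, h1, h2, h3, h4, h5]
    ext i
    fin_cases i <;> simp [Complex.ext_iff]
  have hc : ∀ x y : T, Ω.curryLeft ξ ![x, y] = Ω ![ξ, x, y] := fun x y => rfl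
  rw [hI, wedgeOne_apply_six]
  simp only [wedgeTwo_apply_five, hc, hdet, h0, h1, h2, h3, h4, h5, map_sub, map_add, map_smul]
  simp
  ring

/-- Hitchin's endomorphism of the model form `2 Re (dz₁ ∧ dz₂ ∧ dz₃)` is the standard complex
structure, up to the sign given by the orientation. -/
theorem hitchinJ_eq [Module.IsReflexive ℝ T] {v : T [⋀^Fin 6]→ₗ[ℝ] ℝ} (hv : v ≠ 0)
    {Ω : T [⋀^Fin 3]→ₗ[ℝ] ℝ} (β : T ≃ₗ[ℝ] (Fin 3 → ℂ))
    (hΩ : ∀ u : Fin 3 → T, Ω u = 2 * (Matrix.det (Matrix.of fun i j => β (u j) i)).re) :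
    ∃ ε : ℝ, ε * ε = 1 ∧ ∀ ξ, β (hitchinJ v Ω ξ) = ε • Complex.I • β ξ := by
  -- the real basis of `T` that corresponds to `1, i` in each coordinate of `ℂ³`
  have hfin : Module.finrank ℝ T = 6 := by
    rw [β.finrank_eq, Module.finrank_pi_fintype]
    simp
  have : FiniteDimensional ℝ T := FiniteDimensional.of_finrank_pos (by omega)
  let ev : Fin 6 → T := fun i => β.symm (![![1, 0, 0], ![Complex.I, 0, 0], ![0, 1, 0],
    ![0, Complex.I, 0], ![0, 0, 1], ![0, 0, Complex.I]] i)
  have hli : LinearIndependent ℝ ev := by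
    rw [Fintype.linearIndependent_iff]
    intro g hg
    have h := congrArg β hg
    simp only [ev, map_zero, Fin.sum_univ_six] at h
    have c0 := congrFun h 0
    have c1 := congrFun h 1
    have c2 := congrFun h 2
    simp [Complex.ext_iff] at c0 c1 c2
    intro i
    fin_cases i
    exacts [c0.1, c0.2, c1.1, c1.2, c2.1, c2.2]
  let e : Module.Basis (Fin 6) ℝ T := basisOfLinearIndependentOfCardEqFinrank hli (by simp [hfin])
  have he : ⇑e = ev := coe_basisOfLinearIndependentOfCardEqFinrank hli _
  let I : T →ₗ[ℝ] T := β.symm.toLinearMap ∘ₗ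
    (LinearMap.lsmul ℂ (Fin 3 → ℂ) Complex.I).restrictScalars ℝ ∘ₗ β.toLinearMap
  have hIa : ∀ ξ, I ξ = β.symm (Complex.I • β ξ) := fun ξ => rfl
  have hII : ∀ ξ, I (I ξ) = -ξ := by
    intro ξ
    rw [hIa, hIa, LinearEquiv.apply_symm_apply, smul_smul, Complex.I_mul_I, neg_one_smul,
      map_neg, LinearEquiv.symm_apply_apply]
  obtain ⟨c, hc0, hK⟩ : ∃ c : ℝ, c ≠ 0 ∧ ∀ a ξ, hitchinK v Ω a ξ = c * a (I ξ) := by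
    obtain ⟨hve, -⟩ := topRatio_eq hv e 0
    refine ⟨-8 / v e, div_ne_zero (by norm_num) hve, fun a ξ => ?_⟩
    change topRatio v (wedgeOne a (wedgeTwo (Ω.curryLeft ξ) Ω)) = _
    rw [(topRatio_eq hv e _).2]
    have := wedge_contraction_apply β hΩ a ξ (e := e) (by rw [he]; simp [ev])
      (by rw [he]; simp [ev]) (by rw [he]; simp [ev]) (by rw [he]; simp [ev])
      (by rw [he]; simp [ev]) (by rw [he]; simp [ev])
    rw [this, hIa]; ring
  have hKK : hitchinK v Ω ∘ₗ hitchinK v Ω = (-(c * c)) • LinearMap.id := by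
    ext a ξ
    simp only [LinearMap.comp_apply, hK, hII, LinearMap.smul_apply, LinearMap.id_apply, map_neg,
      smul_eq_mul]
    ring
  have hlam : hitchinLambda v Ω = -(c * c) := by
    rw [hitchinLambda, hKK, map_smul, LinearMap.trace_id, Subspace.dual_finrank_eq, hfin,
      smul_eq_mul]
    norm_num
    ring
  refine ⟨(√(c * c))⁻¹ * c, ?_, fun ξ => ?_⟩
  · have hpos : 0 < c * c := mul_self_pos.2 hc0
    have h1 : √(c * c) * √(c * c) = c * c := Real.mul_self_sqrt hpos.le
    have h2 : √(c * c) ≠ 0 := (Real.sqrt_pos.2 hpos).ne'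
    field_simp
    rw [sq, sq, h1]
  · have h1 : hitchinJ v Ω ξ = ((√(c * c))⁻¹ * c) • I ξ := by
      rw [← sub_eq_zero, ← Module.forall_dual_apply_eq_zero_iff ℝ]
      intro a
      rw [map_sub, dual_hitchinJ_apply, hitchinJDual, hlam, neg_neg, LinearMap.smul_apply,
        LinearMap.smul_apply, hK, map_smul, smul_eq_mul, smul_eq_mul]
      ring
    rw [h1, map_smul, hIa, LinearEquiv.apply_symm_apply]

end HitchinJ

/-! ### The square root of the curvature at a point -/

section Root

variable {T : Type*} [AddCommGroup T] [Module ℝ T]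
  {Θ : T ≃ₗ[ℝ] (Fin 3 → ℝ) × (Fin 3 → ℝ)} {F : T [⋀^Fin 2]→ₗ[ℝ] (Fin 3 → ℝ)}
  {Ω : T [⋀^Fin 3]→ₗ[ℝ] ℝ}

/-- In coordinates `Θ = (w, q)` in which `F` is horizontal (i.e. depends on `q` only): if the form
`-½ w ∧ F + ½ w₁ ∧ w₂ ∧ w₃` is of negative type, then the components of `F` form a positive triple.
Otherwise there would be a 3-dimensional space of vectors `η` with `Ω(ξ, η, ·) = 0` for some
`ξ ≠ 0`. -/
theorem IsNegativeType.triple_product_pos (hΩn : IsNegativeType Ω)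
    (hF : ∀ ξ v, (Θ ξ).2 = 0 → F ![v, ξ] = 0)
    (hΩ : ∀ x y z, Ω ![x, y, z] = -(1 / 2) * ((Θ x).1 ⬝ᵥ F ![y, z] + (Θ y).1 ⬝ᵥ F ![z, x] +
      (Θ z).1 ⬝ᵥ F ![x, y]) + (1 / 2) * ((Θ x).1 ⬝ᵥ (Θ y).1 ⨯₃ (Θ z).1))
    {k : Fin 3 → T} (hk : ∀ i, k i = Θ.symm (0, Pi.single i 1)) :
    0 < F ![k 1, k 2] ⬝ᵥ F ![k 2, k 0] ⨯₃ F ![k 0, k 1] := by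
  by_contra hneg
  rw [not_lt] at hneg
  have hexp := fun u v => horizontal_two_form_apply
    (q := LinearMap.snd ℝ _ _ ∘ₗ Θ.toLinearMap) (F := F) (k := k)
    (fun i => by simp [hk]) hF u v
  simp only [LinearMap.comp_apply, LinearEquiv.coe_coe, LinearMap.snd_apply] at hexp
  set b0 := F ![k 1, k 2] with hb0
  set b1 := F ![k 2, k 0] with hb1
  set b2 := F ![k 0, k 1] with hb2
  rcases hneg.lt_or_eq with hlt | heq
  · -- `F = - E ∧ E` for a frame `E`; then `Ω(ξ, η, ·) = 0` if `w ξ = E ξ` and `w η = - E η`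
    obtain ⟨a, -, ha0, ha1, ha2⟩ := exists_cross_products (b := ![-b0, -b1, -b2]) (by
      have : (-b0) ⬝ᵥ (-b1) ⨯₃ (-b2) = -(b0 ⬝ᵥ b1 ⨯₃ b2) := by simp
      change 0 < (-b0) ⬝ᵥ (-b1) ⨯₃ (-b2)
      rw [this]; linarith)
    simp only [Matrix.cons_val_zero, Matrix.cons_val_one, Matrix.cons_val] at ha0 ha1 ha2
    let A : (Fin 3 → ℝ) →ₗ[ℝ] (Fin 3 → ℝ) :=
      Fintype.linearCombination ℝ a
    have hA : ∀ x, A x = x 0 • a 0 + x 1 • a 1 + x 2 • a 2 := fun x => by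
      simp [A, Fintype.linearCombination_apply, Fin.sum_univ_three]
    have hFA : ∀ u v, F ![u, v] = -(A (Θ u).2 ⨯₃ A (Θ v).2) := by
      intro u v
      have e0 : b0 = -(a 1 ⨯₃ a 2) := by rw [ha0, neg_neg]
      have e1 : b1 = -(a 2 ⨯₃ a 0) := by rw [ha1, neg_neg]
      have e2 : b2 = -(a 0 ⨯₃ a 1) := by rw [ha2, neg_neg]
      rw [hexp, e0, e1, e2, hA, hA]
      ext i
      fin_cases i <;> simp [cross_apply] <;> ring
    let L : (Fin 3 → ℝ) →ₗ[ℝ] T := Θ.symm.toLinearMap ∘ₗ LinearMap.prod (-A) LinearMap.id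
    have hL : ∀ x, Θ (L x) = (-A x, x) := fun x => by simp [L]
    refine hΩn.false_of_kernel (ξ := Θ.symm (A (Pi.single 0 1), Pi.single 0 1)) (L := L) ?_ ?_ ?_
    · intro h
      have := congrArg (fun x => (Θ x).2 0) h
      simp at this
    · intro x y h
      have := congrArg (fun x => (Θ x).2) h
      simpa [hL] using this
    · intro x ζ
      rw [hΩ, hFA, hFA, hFA, hL, LinearEquiv.apply_symm_apply]
      simp only
      generalize A (Pi.single 0 1) = s
      generalize A x = t
      generalize A (Θ ζ).2 = r
      simp [cross_apply, dotProduct, Fin.sum_univ_three]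
      ring
  · -- a vertical `ξ` orthogonal to all values of `F` annihilates, with `Ω`, every horizontal vector
    rw [triple_product_eq_det] at heq
    obtain ⟨c, hc, hcb⟩ := Matrix.exists_mulVec_eq_zero_iff.2 heq
    have d0 : c ⬝ᵥ b0 = 0 := by rw [dotProduct_comm]; exact congrFun hcb 0
    have d1 : c ⬝ᵥ b1 = 0 := by rw [dotProduct_comm]; exact congrFun hcb 1
    have d2 : c ⬝ᵥ b2 = 0 := by rw [dotProduct_comm]; exact congrFun hcb 2
    let L : (Fin 3 → ℝ) →ₗ[ℝ] T := Θ.symm.toLinearMap ∘ₗ LinearMap.inr ℝ _ _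
    have hL : ∀ x, Θ (L x) = (0, x) := fun x => by simp [L]
    refine hΩn.false_of_kernel (ξ := Θ.symm (c, 0)) (L := L) ?_ ?_ ?_
    · intro h
      apply hc
      have := congrArg (fun x => (Θ x).1) h
      simpa using this
    · intro x y h
      have := congrArg (fun x => (Θ x).2) h
      simpa [hL] using this
    · intro x ζ
      rw [hΩ, hexp, hexp, hexp, hL, LinearEquiv.apply_symm_apply]
      simp [d0, d1, d2]

/-- The square root of the curvature at a point. -/
theorem exists_root (hF : ∀ ξ v, (Θ ξ).2 = 0 → F ![v, ξ] = 0)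
    {k : Fin 3 → T} (hk : ∀ i, k i = Θ.symm (0, Pi.single i 1))
    (hpos : 0 < F ![k 1, k 2] ⬝ᵥ F ![k 2, k 0] ⨯₃ F ![k 0, k 1]) :
    ∃ E : T →ₗ[ℝ] (Fin 3 → ℝ), (∀ ξ, E ξ = 0 ↔ (Θ ξ).2 = 0) ∧
      (∀ u v, F ![u, v] = E u ⨯₃ E v) ∧ 0 < E (k 0) ⬝ᵥ E (k 1) ⨯₃ E (k 2) := by
  have hexp := fun u v => horizontal_two_form_apply
    (q := LinearMap.snd ℝ _ _ ∘ₗ Θ.toLinearMap) (F := F) (k := k)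
    (fun i => by simp [hk]) hF u v
  simp only [LinearMap.comp_apply, LinearEquiv.coe_coe, LinearMap.snd_apply] at hexp
  obtain ⟨a, ha, ha0, ha1, ha2⟩ := exists_cross_products
    (b := ![F ![k 1, k 2], F ![k 2, k 0], F ![k 0, k 1]]) hpos
  simp only [Matrix.cons_val_zero, Matrix.cons_val_one, Matrix.cons_val] at ha0 ha1 ha2
  let A : (Fin 3 → ℝ) →ₗ[ℝ] (Fin 3 → ℝ) := Fintype.linearCombination ℝ a
  have hA : ∀ x, A x = x 0 • a 0 + x 1 • a 1 + x 2 • a 2 := fun x => by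
    simp [A, Fintype.linearCombination_apply, Fin.sum_univ_three]
  have hAk : ∀ i, A (Θ (k i)).2 = a i := fun i => by
    simp [hk, A, Fintype.linearCombination_apply_single]
  refine ⟨A ∘ₗ LinearMap.snd ℝ _ _ ∘ₗ Θ.toLinearMap, fun ξ => ⟨fun h => ?_, fun h => ?_⟩,
    fun u v => ?_, ?_⟩
  · change A (Θ ξ).2 = 0 at h
    generalize (Θ ξ).2 = x at h
    -- the coordinates of `x` are recovered from triple products
    have e0 : A x ⬝ᵥ a 1 ⨯₃ a 2 = x 0 * (a 0 ⬝ᵥ a 1 ⨯₃ a 2) := by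
      rw [hA]; simp [cross_apply, dotProduct, Fin.sum_univ_three]; ring
    have e1 : A x ⬝ᵥ a 2 ⨯₃ a 0 = x 1 * (a 0 ⬝ᵥ a 1 ⨯₃ a 2) := by
      rw [hA]; simp [cross_apply, dotProduct, Fin.sum_univ_three]; ring
    have e2 : A x ⬝ᵥ a 0 ⨯₃ a 1 = x 2 * (a 0 ⬝ᵥ a 1 ⨯₃ a 2) := by
      rw [hA]; simp [cross_apply, dotProduct, Fin.sum_univ_three]; ring
    rw [h, zero_dotProduct, eq_comm, mul_eq_zero, or_iff_left ha.ne'] at e0 e1 e2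
    ext i; fin_cases i <;> assumption
  · change A (Θ ξ).2 = 0
    rw [h, map_zero]
  · change F ![u, v] = A (Θ u).2 ⨯₃ A (Θ v).2
    rw [hexp, ← ha0, ← ha1, ← ha2, hA, hA]
    ext i
    fin_cases i <;> simp [cross_apply] <;> ring
  · change 0 < A (Θ (k 0)).2 ⬝ᵥ A (Θ (k 1)).2 ⨯₃ A (Θ (k 2)).2
    rw [hAk, hAk, hAk]; exact ha

/-- With a square root `E` of the curvature the Chern-Simons form is
`½ Re ((w₁ + iE₁) ∧ (w₂ + iE₂) ∧ (w₃ + iE₃))`. -/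
theorem exists_complex_coordinates {E : T →ₗ[ℝ] (Fin 3 → ℝ)} (hE : ∀ ξ, E ξ = 0 ↔ (Θ ξ).2 = 0)
    (hΩ : ∀ x y z, Ω ![x, y, z] = -(1 / 2) * ((Θ x).1 ⬝ᵥ E y ⨯₃ E z + (Θ y).1 ⬝ᵥ E z ⨯₃ E x +
      (Θ z).1 ⬝ᵥ E x ⨯₃ E y) + (1 / 2) * ((Θ x).1 ⬝ᵥ (Θ y).1 ⨯₃ (Θ z).1)) :
    ∃ (β : T ≃ₗ[ℝ] (Fin 3 → ℂ)) (c : ℝ), c ≠ 0 ∧ (∀ ξ i, β ξ i = c * ⟨(Θ ξ).1 i, E ξ i⟩) ∧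
      ∀ u : Fin 3 → T, Ω u = 2 * (Matrix.det (Matrix.of fun i j => β (u j) i)).re := by
  have hfin : Module.finrank ℝ T = 6 := by
    rw [Θ.finrank_eq, Module.finrank_prod, Module.finrank_fin_fun]
  have : FiniteDimensional ℝ T := FiniteDimensional.of_finrank_pos (by omega)
  -- the product of three coordinates scales by `c ^ 3`, and `2 c ^ 3 = 1 / 2`
  obtain ⟨c, hc0, hc⟩ : ∃ c : ℝ, c ≠ 0 ∧ c ^ 3 = 1 / 4 := by
    refine ⟨(1 / 4 : ℝ) ^ (1 / 3 : ℝ), by positivity, ?_⟩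
    rw [← Real.rpow_natCast, ← Real.rpow_mul (by norm_num)]
    norm_num
  let f : T →ₗ[ℝ] (Fin 3 → ℂ) :=
    { toFun := fun ξ i => c * ⟨(Θ ξ).1 i, E ξ i⟩
      map_add' := fun x y => by ext i; simp [Complex.ext_iff]; constructor <;> ring
      map_smul' := fun r x => by ext i; simp [Complex.ext_iff]; constructor <;> ring }
  have hf : ∀ ξ i, f ξ i = c * ⟨(Θ ξ).1 i, E ξ i⟩ := fun _ _ => rfl
  have hinj : Function.Injective f := by
    rw [injective_iff_map_eq_zero]
    intro ξ h
    have h1 : ∀ i, (Θ ξ).1 i = 0 ∧ E ξ i = 0 := by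
      intro i
      have := congrFun h i
      rw [hf, Pi.zero_apply, mul_eq_zero, or_iff_right (by exact_mod_cast hc0)] at this
      exact ⟨congrArg Complex.re this, congrArg Complex.im this⟩
    have h2 : (Θ ξ).2 = 0 := (hE ξ).1 (funext fun i => (h1 i).2)
    have h3 : (Θ ξ).1 = 0 := funext fun i => (h1 i).1
    exact Θ.map_eq_zero_iff.1 (Prod.ext h3 h2)
  refine ⟨LinearEquiv.ofInjectiveOfFinrankEq f hinj ?_, c, hc0, fun ξ i => rfl, fun u => ?_⟩
  · rw [hfin, Module.finrank_pi_fintype]; simp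
  · have hu : u = ![u 0, u 1, u 2] := by ext i; fin_cases i <;> rfl
    rw [hu, hΩ, Matrix.det_fin_three]
    have key : 2 * (f (u 0) 0 * f (u 1) 1 * f (u 2) 2 - f (u 0) 0 * f (u 2) 1 * f (u 1) 2
      - f (u 1) 0 * f (u 0) 1 * f (u 2) 2 + f (u 1) 0 * f (u 2) 1 * f (u 0) 2
      + f (u 2) 0 * f (u 0) 1 * f (u 1) 2 - f (u 2) 0 * f (u 1) 1 * f (u 0) 2).re =
        2 * c ^ 3 * ((Θ (u 0)).1 ⬝ᵥ (Θ (u 1)).1 ⨯₃ (Θ (u 2)).1 -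
          ((Θ (u 0)).1 ⬝ᵥ E (u 1) ⨯₃ E (u 2) + (Θ (u 1)).1 ⬝ᵥ E (u 2) ⨯₃ E (u 0) +
            (Θ (u 2)).1 ⬝ᵥ E (u 0) ⨯₃ E (u 1))) := by
      simp only [hf]
      simp [cross_apply, dotProduct, Fin.sum_univ_three]
      ring
    refine Eq.trans ?_ key.symm
    rw [hc]
    ring

end Root

/-! ### The Chern-Simons form of a negative definite connection -/

theorem wedgeOne_apply_three {T : Type*} [AddCommGroup T] [Module ℝ T] {A : Type*} [Ring A]
    [Algebra ℝ A] (a : T →ₗ[ℝ] A) (γ : T [⋀^Fin 2]→ₗ[ℝ] A) (x y z : T) :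
    wedgeOne a γ ![x, y, z] = a x * γ ![y, z] - a y * γ ![x, z] + a z * γ ![x, y] := by
  rw [wedgeOne_apply, Fin.sum_univ_three]
  have r0 : Fin.removeNth 0 ![x, y, z] = ![y, z] := by ext i; fin_cases i <;> rfl
  have r1 : Fin.removeNth 1 ![x, y, z] = ![x, z] := by ext i; fin_cases i <;> rfl
  have r2 : Fin.removeNth 2 ![x, y, z] = ![x, y] := by ext i; fin_cases i <;> rfl
  have e2 : ![x, y, z] 2 = z := rfl
  rw [r0, r1, r2, e2]
  norm_num
  abel

section Pointwise

variable {P : Type*} [TopologicalSpace P] [ChartedSpace (EuclideanSpace ℝ (Fin 6)) P]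

/-- `-Tr (α ∧ α ∧ α)` is, in coordinates, `3/2` times the determinant of `α`. -/
theorem reTrace_wedgeCube {α : OneForm 6 P Mat2} {p : P} (hα : ∀ v, α p v ∈ su2)
    (u : Fin 3 → TangentSpace (𝓡 6) p) :
    reTrace (wedgeCube α p u) = -(3 / 2) *
      (su2.vec (α p (u 0)) ⬝ᵥ su2.vec (α p (u 1)) ⨯₃ su2.vec (α p (u 2))) := by
  have hu : u = ![u 0, u 1, u 2] := by ext i; fin_cases i <;> rfl
  have h : ∀ x y z, reTrace (α p x * wedgeSelf α p ![y, z]) =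
      -(1 / 2) * (su2.vec (α p x) ⬝ᵥ su2.vec (α p y) ⨯₃ su2.vec (α p z)) := by
    intro x y z
    rw [wedgeSelf_apply]
    simp only [Matrix.cons_val_zero, Matrix.cons_val_one]
    rw [su2.reTrace_mul (hα x) (su2.commutator_mem (hα y) (hα z)),
      su2.vec_commutator (hα y) (hα z)]
  have h3 := wedgeOne_apply_three (α p).toLinearMap (wedgeSelf α p) (u 0) (u 1) (u 2)
  simp only [ContinuousLinearMap.coe_coe] at h3
  rw [hu, wedgeCube, h3, map_add, map_sub, h, h, h]
  simp [cross_apply, dotProduct, Fin.sum_univ_three]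
  ring

/-- The Chern-Simons form is `Tr (W ∧ F - ⅓ W ∧ W ∧ W)`, in coordinates. -/
theorem chernSimons_apply {W : OneForm 6 P Mat2} {p : P} (hW : ∀ v, W p v ∈ su2)
    (hF : ∀ v, curvature W p v ∈ su2) (x y z : TangentSpace (𝓡 6) p) :
    chernSimons W p ![x, y, z] = -(1 / 2) * (su2.vec (W p x) ⬝ᵥ su2.vec (curvature W p ![y, z]) +
      su2.vec (W p y) ⬝ᵥ su2.vec (curvature W p ![z, x]) +
      su2.vec (W p z) ⬝ᵥ su2.vec (curvature W p ![x, y])) +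
      (1 / 2) * (su2.vec (W p x) ⬝ᵥ su2.vec (W p y) ⨯₃ su2.vec (W p z)) := by
  have hd : (extDerivForm (toDiffForm W) p).toAlternatingMap = curvature W p - wedgeSelf W p :=
    (add_sub_cancel_right _ _).symm
  have hcube := reTrace_wedgeCube hW ![x, y, z]
  have h1 : wedgeOne (W p).toLinearMap (extDerivForm (toDiffForm W) p).toAlternatingMap =
      wedgeOne (W p).toLinearMap (curvature W p) - wedgeCube W p := by
    rw [hd, eq_sub_iff_add_eq, wedgeCube, ← wedgeOne_add_right, sub_add_cancel]
  have h2 : chernSimons W p ![x, y, z] = reTrace (wedgeOne (W p).toLinearMap (curvature W p)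
      ![x, y, z]) - (1 / 3) * reTrace (wedgeCube W p ![x, y, z]) := by
    rw [chernSimons, h1]
    simp only [LinearMap.compAlternatingMap_apply, AlternatingMap.add_apply,
      AlternatingMap.sub_apply, AlternatingMap.smul_apply, map_add, map_sub, map_smul, smul_eq_mul]
    ring
  rw [h2, hcube, wedgeOne_apply_three]
  simp only [ContinuousLinearMap.coe_coe, map_add, map_sub]
  rw [su2.reTrace_mul (hW x) (hF _), su2.reTrace_mul (hW y) (hF _), su2.reTrace_mul (hW z) (hF _),
    AlternatingMap.apply_swap_two (curvature W p) x z, map_neg, dotProduct_neg]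
  simp only [Matrix.cons_val_zero, Matrix.cons_val_one, Matrix.cons_val]
  ring

end Pointwise

namespace PrincipalSU2Bundle

variable {P M : Type*}
  [TopologicalSpace P] [ChartedSpace (EuclideanSpace ℝ (Fin 6)) P] [IsManifold (𝓡 6) ∞ P]
  [TopologicalSpace M] [ChartedSpace (EuclideanSpace ℝ (Fin 3)) M] [IsManifold (𝓡 3) ∞ M]
  {B : PrincipalSU2Bundle P M} {W : OneForm 6 P Mat2}

theorem IsConnection.curvature_vertical (hW : B.IsConnection W) {p : P}
    (v : TangentSpace (𝓡 6) p) {ξ : TangentSpace (𝓡 6) p} (hξ : ξ ∈ B.vertical p) :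
    curvature W p ![v, ξ] = 0 := by
  rw [← hW.fundamental_eq hξ]
  exact hW.curvature_fundamental p v _

variable (B) in
/-- The condition on the coordinates `e` of the square root of the curvature at the point `p`:
`e` is horizontal, its square is the curvature, and it is positive. -/
structure IsRootAt (vM : VolumeForm 3 M) (W : OneForm 6 P Mat2) (p : P)
    (e : TangentSpace (𝓡 6) p →ₗ[ℝ] (Fin 3 → ℝ)) : Prop where
  horizontal : ∀ ξ ∈ B.vertical p, e ξ = 0
  cross_eq : ∀ u v, su2.vec (curvature W p ![u, v]) = e u ⨯₃ e v
  positive : ∀ u : Fin 3 → TangentSpace (𝓡 6) p,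
    0 < vM.form (B.proj p) (fun i => B.dproj p (u i)) → 0 < e (u 0) ⬝ᵥ e (u 1) ⨯₃ e (u 2)

theorem exists_positive_frame (vM : VolumeForm 3 M) (p : P) :
    ∃ u : Fin 3 → TangentSpace (𝓡 6) p, 0 < vM.form (B.proj p) (fun i => B.dproj p (u i)) := by
  obtain ⟨x, hx⟩ : ∃ x, vM.form (B.proj p) x ≠ 0 := by
    by_contra! h
    exact vM.ne_zero (B.proj p) (ContinuousAlternatingMap.ext h)
  choose s hs using B.dproj_surjective p
  rcases hx.lt_or_gt with h | h
  · refine ⟨fun i => s (x (Equiv.swap 0 1 i)), ?_⟩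
    simp only [hs]
    have h2 := (vM.form (B.proj p)).toAlternatingMap.map_swap x (i := 0) (j := 1) (by decide)
    have h3 : vM.form (B.proj p) (fun i => x (Equiv.swap 0 1 i)) = -vM.form (B.proj p) x := h2
    rw [h3]; linarith
  · exact ⟨fun i => s (x i), by simpa only [hs] using h⟩

/-- Two horizontal top-degree forms are proportional. -/
theorem horizontal_triple_product (vM : VolumeForm 3 M) {p : P}
    {e : TangentSpace (𝓡 6) p →ₗ[ℝ] (Fin 3 → ℝ)} (he : ∀ ξ ∈ B.vertical p, e ξ = 0)
    (u k : Fin 3 → TangentSpace (𝓡 6) p)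
    (hk : vM.form (B.proj p) (fun i => B.dproj p (k i)) ≠ 0) :
    (e (u 0) ⬝ᵥ e (u 1) ⨯₃ e (u 2)) * vM.form (B.proj p) (fun i => B.dproj p (k i)) =
      vM.form (B.proj p) (fun i => B.dproj p (u i)) * (e (k 0) ⬝ᵥ e (k 1) ⨯₃ e (k 2)) := by
  obtain ⟨s, hs⟩ := LinearMap.exists_rightInverse_of_surjective (B.dproj p).toLinearMap
    (LinearMap.range_eq_top.2 (B.dproj_surjective p))
  have hs' : ∀ x, B.dproj p (s x) = x := fun x => LinearMap.congr_fun hs x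
  have hes : ∀ ξ, e ξ = (e ∘ₗ s) (B.dproj p ξ) := by
    intro ξ
    rw [← sub_eq_zero, LinearMap.comp_apply, ← map_sub]
    apply he
    change B.dproj p _ = 0
    rw [map_sub, hs', sub_self]
  let v := (vM.form (B.proj p)).toAlternatingMap
  let d := (Matrix.detRowAlternating (R := ℝ) (n := Fin 3)).compLinearMap (e ∘ₗ s)
  have hd : ∀ u : Fin 3 → TangentSpace (𝓡 6) p, e (u 0) ⬝ᵥ e (u 1) ⨯₃ e (u 2) =
      d (fun i => B.dproj p (u i)) := by
    intro u
    rw [triple_product_eq_det]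
    change _ = Matrix.det (fun i => (e ∘ₗ s) (B.dproj p (u i)))
    congr 1
    ext i : 1
    rw [← hes]
    fin_cases i <;> rfl
  have hli : LinearIndependent ℝ fun i => B.dproj p (k i) := by
    by_contra h
    exact hk (v.map_linearDependent _ h)
  let b : Module.Basis (Fin 3) ℝ (TangentSpace (𝓡 3) (B.proj p)) :=
    basisOfLinearIndependentOfCardEqFinrank hli (by rw [finrank_tangent_base]; simp)
  have hb : ⇑b = fun i => B.dproj p (k i) := coe_basisOfLinearIndependentOfCardEqFinrank hli _
  have h1 := congrArg (fun f => f (fun i => B.dproj p (u i))) (v.eq_smul_basis_det b)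
  have h2 := congrArg (fun f => f (fun i => B.dproj p (u i))) (d.eq_smul_basis_det b)
  rw [hb] at h1 h2
  simp only [AlternatingMap.smul_apply, smul_eq_mul] at h1 h2
  rw [hd u, hd k]
  change _ * v _ = v _ * _
  rw [h1, h2]
  ring

/-- The square root is given by an explicit formula in terms of the curvature and of one positive
frame. -/
theorem IsRootAt.apply_eq {vM : VolumeForm 3 M} {p : P}
    {e : TangentSpace (𝓡 6) p →ₗ[ℝ] (Fin 3 → ℝ)} (he : B.IsRootAt vM W p e)
    {u : Fin 3 → TangentSpace (𝓡 6) p}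
    (hu : 0 < vM.form (B.proj p) (fun i => B.dproj p (u i))) (ξ : TangentSpace (𝓡 6) p)
    {F : TangentSpace (𝓡 6) p → TangentSpace (𝓡 6) p → Fin 3 → ℝ}
    (hF : ∀ x y, F x y = su2.vec (curvature W p ![x, y])) {b : Fin 3 → Fin 3 → ℝ}
    (hb : b = ![F (u 1) (u 2), F (u 2) (u 0), F (u 0) (u 1)]) :
    0 < b 0 ⬝ᵥ b 1 ⨯₃ b 2 ∧
    e ξ = ((b 0 ⬝ᵥ b 1 ⨯₃ b 2) * √(b 0 ⬝ᵥ b 1 ⨯₃ b 2))⁻¹ •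
      ((F ξ (u 1) ⬝ᵥ (b 0 ⨯₃ b 1)) • (b 1 ⨯₃ b 2) + (F ξ (u 2) ⬝ᵥ (b 1 ⨯₃ b 2)) • (b 2 ⨯₃ b 0) +
        (F ξ (u 0) ⬝ᵥ (b 2 ⨯₃ b 0)) • (b 0 ⨯₃ b 1)) := by
  have := eq_of_cross_products (fun i => e (u i)) (e ξ) (he.positive u hu) (b := b)
    (by rw [hb]; simp [hF, he.cross_eq]) (by rw [hb]; simp [hF, he.cross_eq])
    (by rw [hb]; simp [hF, he.cross_eq])
  simp only [← he.cross_eq, ← hF] at this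
  exact this

theorem IsRootAt.unique {vM : VolumeForm 3 M} {p : P}
    {e e' : TangentSpace (𝓡 6) p →ₗ[ℝ] (Fin 3 → ℝ)} (he : B.IsRootAt vM W p e)
    (he' : B.IsRootAt vM W p e') : e = e' := by
  obtain ⟨u, hu⟩ := exists_positive_frame (B := B) vM p
  ext1 ξ
  rw [(he.apply_eq hu ξ (fun _ _ => rfl) rfl).2, (he'.apply_eq hu ξ (fun _ _ => rfl) rfl).2]

/-- The square root of the curvature at a point, together with the complex coordinates
`w + i e` in which Hitchin's `J` is the standard complex structure. -/
theorem IsNegativeDefinite.exists_root (hW : B.IsNegativeDefinite W) (vP : VolumeForm 6 P)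
    (vM : VolumeForm 3 M) (p : P) : ∃ e : TangentSpace (𝓡 6) p →ₗ[ℝ] (Fin 3 → ℝ),
      B.IsRootAt vM W p e ∧ (∀ ξ, e ξ = 0 → ξ ∈ B.vertical p) ∧
      (∀ ξ, almostComplex vP W p (almostComplex vP W p ξ) = -ξ) ∧
      ∃ ε : ℝ, ε * ε = 1 ∧
        (∀ ξ, su2.vec (W p (almostComplex vP W p ξ)) = -ε • e ξ) ∧
        ∀ ξ, e (almostComplex vP W p ξ) = ε • su2.vec (W p ξ) := by
  obtain ⟨hC, hneg⟩ := hW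
  obtain ⟨x, hx⟩ := exists_positive_frame (B := B) vM p
  have hli : LinearIndependent ℝ fun i => B.dproj p (x i) := by
    by_contra h
    exact hx.ne' ((vM.form (B.proj p)).toAlternatingMap.map_linearDependent _ h)
  let b : Module.Basis (Fin 3) ℝ (TangentSpace (𝓡 3) (B.proj p)) :=
    basisOfLinearIndependentOfCardEqFinrank hli (by rw [finrank_tangent_base]; simp)
  have hb : ⇑b = fun i => B.dproj p (x i) := coe_basisOfLinearIndependentOfCardEqFinrank hli _
  let f : TangentSpace (𝓡 6) p →ₗ[ℝ] (Fin 3 → ℝ) × (Fin 3 → ℝ) :=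
    (su2.vec ∘ₗ (W p).toLinearMap).prod (b.equivFun.toLinearMap ∘ₗ (B.dproj p).toLinearMap)
  have hvert : ∀ ξ, (f ξ).2 = 0 ↔ ξ ∈ B.vertical p := fun ξ => by
    change b.equivFun (B.dproj p ξ) = 0 ↔ B.dproj p ξ = 0
    simp
  have hfi : Function.Injective f := by
    rw [injective_iff_map_eq_zero]
    intro ξ h
    refine hC.eq_zero_of_vertical ((hvert ξ).1 (congrArg Prod.snd h)) ?_
    have h1 : su2.vec (W p ξ) = 0 := congrArg Prod.fst h
    exact su2.vec_injOn (hC.mem_su2 p ξ) su2.zero_mem (by rw [h1, map_zero])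
  -- coordinates: the value of the connection, and the projection to the base
  let Θ := LinearEquiv.ofInjectiveOfFinrankEq f hfi (by
    rw [finrank_tangent, Module.finrank_prod, Module.finrank_fin_fun])
  have hΘ : ∀ ξ, Θ ξ = f ξ := fun ξ => rfl
  let F := su2.vec.compAlternatingMap (curvature W p)
  have hF : ∀ ξ v, (Θ ξ).2 = 0 → F ![v, ξ] = 0 := by
    intro ξ v h
    change su2.vec (curvature W p ![v, ξ]) = 0
    rw [hC.curvature_vertical v ((hvert ξ).1 h), map_zero]
  have hcs := chernSimons_apply (hC.mem_su2 p) (hC.curvature_mem_su2 p)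
  let k : Fin 3 → TangentSpace (𝓡 6) p := fun i => Θ.symm (0, Pi.single i 1)
  have hk : ∀ i, k i = Θ.symm (0, Pi.single i 1) := fun i => rfl
  have hpos := (hneg p).triple_product_pos (Θ := Θ) (F := F) hF hcs hk
  obtain ⟨e, he0, he1, he2⟩ := _root_.exists_root hF hk hpos
  have hkx : (fun i => B.dproj p (k i)) = fun i => B.dproj p (x i) := by
    funext i
    rw [← congrFun hb i]
    apply b.equivFun.injective
    have h1 : (Θ (k i)).2 = Pi.single i 1 := by rw [hk, LinearEquiv.apply_symm_apply]
    change b.equivFun (B.dproj p (k i)) = _ at h1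
    rw [h1]
    ext j
    rw [Module.Basis.equivFun_apply, Module.Basis.repr_self, Finsupp.single_eq_pi_single]
  have hvol : 0 < vM.form (B.proj p) (fun i => B.dproj p (k i)) := by rw [hkx]; exact hx
  have hhor : ∀ ξ ∈ B.vertical p, e ξ = 0 := fun ξ hξ => (he0 ξ).2 ((hvert ξ).2 hξ)
  refine ⟨e, ⟨hhor, he1, fun u hu => ?_⟩, fun ξ h => (hvert ξ).1 ((he0 ξ).1 h), ?_⟩
  · have h1 := horizontal_triple_product vM hhor u k hvol.ne'
    have h2 := mul_pos hu he2
    rw [← h1] at h2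
    exact pos_of_mul_pos_left h2 hvol.le
  · obtain ⟨β, c, hc, hβ, hΩ⟩ := exists_complex_coordinates (Θ := Θ) (Ω := chernSimons W p) he0
      (fun x y z => by rw [← he1, ← he1, ← he1]; exact hcs x y z)
    have hv : (vP.form p).toAlternatingMap ≠ 0 := fun h =>
      vP.ne_zero p (ContinuousAlternatingMap.toAlternatingMap_injective h)
    obtain ⟨ε, hε, hJ⟩ := hitchinJ_eq hv β hΩ
    have hJ' : ∀ ξ, β (almostComplex vP W p ξ) = ε • Complex.I • β ξ := hJ
    have hcomp : ∀ ξ i, (⟨su2.vec (W p (almostComplex vP W p ξ)) i,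
        e (almostComplex vP W p ξ) i⟩ : ℂ) = ⟨-ε * e ξ i, ε * su2.vec (W p ξ) i⟩ := by
      intro ξ i
      have h1 := congrFun (hJ' ξ) i
      rw [hβ, Pi.smul_apply, Pi.smul_apply, hβ] at h1
      have h2 : (c : ℂ) ≠ 0 := by exact_mod_cast hc
      apply mul_left_cancel₀ h2
      refine h1.trans ?_
      change ε • Complex.I • ((c : ℂ) * ⟨su2.vec (W p ξ) i, e ξ i⟩) = _
      simp [Complex.ext_iff]
      constructor <;> ring
    refine ⟨fun ξ => ?_, ε, hε, fun ξ => ?_, fun ξ => ?_⟩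
    · apply β.injective
      rw [hJ', hJ', smul_comm Complex.I ε, smul_smul, hε, smul_smul, Complex.I_mul_I, map_neg]
      simp
    · funext i; exact congrArg Complex.re (hcomp ξ i)
    · funext i; exact congrArg Complex.im (hcomp ξ i)

end PrincipalSU2Bundle

/-! ### The square root of the curvature as a basic 1-form -/

section Smoothness

variable {G : Type*} [NormedAddCommGroup G] [NormedSpace ℝ G] {f g : G → Fin 3 → ℝ} {z : G}

theorem ContDiffAt.cross (hf : ContDiffAt ℝ ∞ f z) (hg : ContDiffAt ℝ ∞ g z) :
    ContDiffAt ℝ ∞ (fun y => f y ⨯₃ g y) z := by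
  have hf' := contDiffAt_pi.1 hf
  have hg' := contDiffAt_pi.1 hg
  refine contDiffAt_pi.2 fun i => ?_
  fin_cases i
  · exact (((hf' 1).mul (hg' 2)).sub ((hf' 2).mul (hg' 1))).congr_of_eventuallyEq
      (.of_forall fun y => by simp [cross_apply])
  · exact (((hf' 2).mul (hg' 0)).sub ((hf' 0).mul (hg' 2))).congr_of_eventuallyEq
      (.of_forall fun y => by simp [cross_apply])
  · exact (((hf' 0).mul (hg' 1)).sub ((hf' 1).mul (hg' 0))).congr_of_eventuallyEq
      (.of_forall fun y => by simp [cross_apply])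

theorem ContDiffAt.dotProduct (hf : ContDiffAt ℝ ∞ f z) (hg : ContDiffAt ℝ ∞ g z) :
    ContDiffAt ℝ ∞ (fun y => f y ⬝ᵥ g y) z := by
  have hf' := contDiffAt_pi.1 hf
  have hg' := contDiffAt_pi.1 hg
  exact ((((hf' 0).mul (hg' 0)).add ((hf' 1).mul (hg' 1))).add
    ((hf' 2).mul (hg' 2))).congr_of_eventuallyEq
      (.of_forall fun y => by simp [_root_.dotProduct, Fin.sum_univ_three])

theorem contDiffAt_cross_products_formula {b r : Fin 3 → G → Fin 3 → ℝ}
    (hb : ∀ i, ContDiffAt ℝ ∞ (b i) z) (hr : ∀ i, ContDiffAt ℝ ∞ (r i) z)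
    (hpos : 0 < b 0 z ⬝ᵥ b 1 z ⨯₃ b 2 z) :
    ContDiffAt ℝ ∞ (fun y => ((b 0 y ⬝ᵥ b 1 y ⨯₃ b 2 y) * √(b 0 y ⬝ᵥ b 1 y ⨯₃ b 2 y))⁻¹ •
      ((r 1 y ⬝ᵥ (b 0 y ⨯₃ b 1 y)) • (b 1 y ⨯₃ b 2 y) +
        (r 2 y ⬝ᵥ (b 1 y ⨯₃ b 2 y)) • (b 2 y ⨯₃ b 0 y) +
        (r 0 y ⬝ᵥ (b 2 y ⨯₃ b 0 y)) • (b 0 y ⨯₃ b 1 y))) z := by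
  have h01 := (hb 0).cross (hb 1)
  have h12 := (hb 1).cross (hb 2)
  have h20 := (hb 2).cross (hb 0)
  have hD := (hb 0).dotProduct h12
  refine ContDiffAt.smul ((hD.mul (hD.sqrt hpos.ne')).inv
    (mul_pos hpos (Real.sqrt_pos.2 hpos)).ne') ?_
  exact ((((hr 1).dotProduct h01).smul h12).add (((hr 2).dotProduct h12).smul h20)).add
    (((hr 0).dotProduct h20).smul h01)

end Smoothness

theorem su2.triple_product_eq {X Y Z : Mat2} (hX : X ∈ su2) (hY : Y ∈ su2) (hZ : Z ∈ su2) :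
    su2.vec X ⬝ᵥ su2.vec Y ⨯₃ su2.vec Z = -2 * reTrace (X * (Y * Z - Z * Y)) := by
  rw [su2.reTrace_mul hX (su2.commutator_mem hY hZ), su2.vec_commutator hY hZ]; ring

namespace PrincipalSU2Bundle

variable {P M : Type*}
  [TopologicalSpace P] [ChartedSpace (EuclideanSpace ℝ (Fin 6)) P] [IsManifold (𝓡 6) ∞ P]
  [TopologicalSpace M] [ChartedSpace (EuclideanSpace ℝ (Fin 3)) M] [IsManifold (𝓡 3) ∞ M]
  {B : PrincipalSU2Bundle P M} {W E : OneForm 6 P Mat2} {vM : VolumeForm 3 M}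

/-- The square root of the curvature is smooth: near every point it is given by the formula
`IsRootAt.apply_eq` for a frame with constant coefficients in the chart. -/
theorem IsConnection.isSmoothForm_root (hW : B.IsConnection W) (hE : ∀ p v, E p v ∈ su2)
    (hroot : ∀ p, B.IsRootAt vM W p (su2.vec ∘ₗ (E p).toLinearMap)) :
    IsSmoothForm (toDiffForm E) := by
  intro x₀ y₀ hy₀
  refine ContDiffAt.contDiffWithinAt (contDiffAt_alternating_of_apply fun ξ => ?_)
  set ψ := (extChartAt (𝓡 6) x₀).symm with hψ
  have htarget := (isOpen_extChartAt_target (I := 𝓡 6) x₀).mem_nhds hy₀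
  have hψs : ∀ᶠ y in nhds y₀, ContMDiffAt 𝓘(ℝ, EuclideanSpace ℝ (Fin 6)) (𝓡 6) ∞ ψ y := by
    filter_upwards [htarget] with y hy using contMDiffAt_extChartAt_symm x₀ hy
  let D : ∀ y : EuclideanSpace ℝ (Fin 6), EuclideanSpace ℝ (Fin 6) →L[ℝ] TangentSpace (𝓡 6) (ψ y) :=
    fun y => mfderiv 𝓘(ℝ, EuclideanSpace ℝ (Fin 6)) (𝓡 6) ψ y
  have hDsurj : Function.Surjective (D y₀) := by
    have : IsManifold (𝓡 6) 1 P := IsManifold.of_le (n := ∞) (by simp)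
    have h := isInvertible_mfderivWithin_extChartAt_symm (I := 𝓡 6) hy₀
    rw [ModelWithCorners.range_eq_univ, mfderivWithin_univ] at h
    obtain ⟨l, hl⟩ := h
    intro u
    exact ⟨l.symm u, by change mfderiv 𝓘(ℝ, EuclideanSpace ℝ (Fin 6)) (𝓡 6) ψ y₀ _ = u
                        rw [← hl]; exact l.apply_symm_apply u⟩
  obtain ⟨u, hu⟩ := exists_positive_frame (B := B) vM (ψ y₀)
  choose U hU using fun i => hDsurj (u i)
  -- the frame `U` stays positive near `y₀`
  have hpos : ∀ᶠ y in nhds y₀, 0 < vM.form (B.proj (ψ y)) (fun i => B.dproj (ψ y) (D y (U i))) := by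
    have hcomp : ∀ y, ContMDiffAt 𝓘(ℝ, EuclideanSpace ℝ (Fin 6)) (𝓡 6) ∞ ψ y →
        pullbackForm vM.form (B.proj ∘ ψ) y U =
          vM.form (B.proj (ψ y)) (fun i => B.dproj (ψ y) (D y (U i))) := by
      intro y hy
      rw [pullbackForm_apply]
      congr 1
      funext i
      exact mfderiv_comp_apply (I := 𝓘(ℝ, EuclideanSpace ℝ (Fin 6))) (I' := 𝓡 6) (I'' := 𝓡 3) y
        (B.mdifferentiableAt_proj (ψ y)) (hy.mdifferentiableAt (by simp)) (U i)
    have hc : ContDiffAt ℝ ∞ (pullbackForm vM.form (B.proj ∘ ψ)) y₀ := by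
      refine contDiffAt_pullbackForm vM.smooth ?_
      filter_upwards [hψs] with y hy
      exact (B.smooth_proj _).comp y hy
    have hc' : ContinuousAt (fun y => pullbackForm vM.form (B.proj ∘ ψ) y U) y₀ :=
      (ContDiffAt.alternating_apply hc (v := fun i _ => U i) fun i => contDiffAt_const).continuousAt
    have h0 : 0 < pullbackForm vM.form (B.proj ∘ ψ) y₀ U := by
      rw [hcomp y₀ hψs.self_of_nhds]; simpa only [hU] using hu
    filter_upwards [hc'.eventually (lt_mem_nhds h0), hψs] with y h1 h2
    rw [← hcomp y h2]; exact h1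
  -- the curvature has smooth coefficients
  have hWs : ∀ a : EuclideanSpace ℝ (Fin 6), ContDiffAt ℝ ∞ (fun y => W (ψ y) (D y a)) y₀ := by
    intro a
    exact ContDiffAt.alternating_apply (hW.smooth.contDiffAt hy₀) (v := fun _ _ => a)
      fun i => contDiffAt_const
  have hdW : ∀ a b : EuclideanSpace ℝ (Fin 6), ContDiffAt ℝ ∞
      (fun y => extDerivForm (toDiffForm W) (ψ y) ![D y a, D y b]) y₀ := by
    intro a b
    have h := ContDiffAt.alternating_apply (hW.smooth.extDerivForm.contDiffAt hy₀)
      (v := fun i _ => ![a, b] i) fun i => contDiffAt_const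
    refine h.congr_of_eventuallyEq (.of_forall fun y => ?_)
    exact congrArg (extDerivForm (toDiffForm W) (ψ y))
      (funext fun i => by fin_cases i <;> rfl :
        ![D y a, D y b] = fun i => D y (![a, b] i))
  have hvec : ContDiff ℝ ∞ su2.vec := (LinearMap.toContinuousLinearMap su2.vec).contDiff
  have hF : ∀ a b : EuclideanSpace ℝ (Fin 6), ContDiffAt ℝ ∞
      (fun y => su2.vec (curvature W (ψ y) ![D y a, D y b])) y₀ := by
    intro a b
    have h := (hdW a b).add (((hWs a).mul (hWs b)).sub ((hWs b).mul (hWs a)))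
    refine (hvec.contDiffAt.comp y₀ h).congr_of_eventuallyEq (.of_forall fun y => ?_)
    have h2 := wedgeSelf_apply W (ψ y) ![D y a, D y b]
    change su2.vec (_ + wedgeSelf W (ψ y) _) = _
    rw [h2]; rfl
  have hform := contDiffAt_cross_products_formula (z := y₀)
    (b := ![fun y => su2.vec (curvature W (ψ y) ![D y (U 1), D y (U 2)]),
      fun y => su2.vec (curvature W (ψ y) ![D y (U 2), D y (U 0)]),
      fun y => su2.vec (curvature W (ψ y) ![D y (U 0), D y (U 1)])])
    (r := fun i y => su2.vec (curvature W (ψ y) ![D y (ξ 0), D y (U i)]))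
    (fun i => by fin_cases i <;> exact hF _ _) (fun i => hF _ _)
    ((hroot (ψ y₀)).apply_eq hpos.self_of_nhds 0 (fun _ _ => rfl) rfl).1
  have hofVec : ContDiff ℝ ∞ su2.ofVec := (LinearMap.toContinuousLinearMap su2.ofVec).contDiff
  refine (hofVec.contDiffAt.comp y₀ hform).congr_of_eventuallyEq ?_
  filter_upwards [hpos] with y hy
  change E (ψ y) (D y (ξ 0)) = _
  rw [← su2.ofVec_vec (hE (ψ y) (D y (ξ 0)))]
  exact congrArg su2.ofVec
    ((hroot (ψ y)).apply_eq hy (D y (ξ 0)) (fun _ _ => rfl) rfl).2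

/-- Right translation preserves the curvature up to conjugation and the orientation of the base,
hence it preserves the square root, by uniqueness. -/
theorem IsConnection.root_equivariant (hW : B.IsConnection W) (hE : ∀ p v, E p v ∈ su2)
    (hroot : ∀ p, B.IsRootAt vM W p (su2.vec ∘ₗ (E p).toLinearMap)) (g : SU2) (p : P)
    (v : TangentSpace (𝓡 6) p) :
    E (B.act p g) (B.dact g p v) = ((g⁻¹ : SU2) : Mat2) * E p v * g := by
  let e : TangentSpace (𝓡 6) p →ₗ[ℝ] Mat2 := LinearMap.mulRight ℝ ((g⁻¹ : SU2) : Mat2) ∘ₗ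
    LinearMap.mulLeft ℝ (g : Mat2) ∘ₗ (E (B.act p g)).toLinearMap ∘ₗ (B.dact g p).toLinearMap
  have he : ∀ v, e v = (g : Mat2) * E (B.act p g) (B.dact g p v) * ((g⁻¹ : SU2) : Mat2) :=
    fun v => rfl
  have hemem : ∀ v, e v ∈ su2 := fun v => su2.conj_mem (hE _ _) g
  have hr := hroot (B.act p g)
  have key : B.IsRootAt vM W p (su2.vec ∘ₗ e) := by
    refine ⟨fun ξ hξ => ?_, fun x y => ?_, fun u hu => ?_⟩
    · have h1 : B.dact g p ξ ∈ B.vertical (B.act p g) := by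
        change B.dproj _ _ = 0
        exact (B.dproj_dact g p ξ).trans hξ
      have h2 : E (B.act p g) (B.dact g p ξ) = 0 :=
        su2.vec_injOn (hE _ _) su2.zero_mem ((hr.horizontal _ h1).trans (map_zero _).symm)
      change su2.vec (e ξ) = 0
      rw [he, h2]; simp
    · have h1 : curvature W (B.act p g) ![B.dact g p x, B.dact g p y] =
          E (B.act p g) (B.dact g p x) * E (B.act p g) (B.dact g p y) -
            E (B.act p g) (B.dact g p y) * E (B.act p g) (B.dact g p x) := by
        refine su2.vec_injOn (hW.curvature_mem_su2 _ _) (su2.commutator_mem (hE _ _) (hE _ _)) ?_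
        rw [hr.cross_eq, su2.vec_commutator (hE _ _) (hE _ _)]; rfl
      have h2 := hW.curvature_equivariant g p ![x, y]
      have h3 : (fun i => B.dact g p (![x, y] i)) = ![B.dact g p x, B.dact g p y] := by
        funext i; fin_cases i <;> rfl
      rw [h3, h1] at h2
      have h4 : curvature W p ![x, y] = e x * e y - e y * e x := by
        rw [he, he, SU2.conj_commutator, h2]
        calc _ = 1 * curvature W p ![x, y] * 1 := by simp
          _ = ((g : Mat2) * ((g⁻¹ : SU2) : Mat2)) * curvature W p ![x, y] *
              ((g : Mat2) * ((g⁻¹ : SU2) : Mat2)) := by rw [SU2.mul_inv_coe]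
          _ = _ := by noncomm_ring
      rw [h4, su2.vec_commutator (hemem x) (hemem y)]; rfl
    · have h1 : 0 < vM.form (B.proj (B.act p g))
          (fun i => B.dproj (B.act p g) (B.dact g p (u i))) := by
        refine lt_of_lt_of_eq hu ?_
        refine Eq.trans ?_ (form_apply_congr vM.form (B.proj_act p g)
          (fun i => B.dproj (B.act p g) (B.dact g p (u i)))).symm
        exact congrArg (vM.form (B.proj p)) (funext fun i => (B.dproj_dact g p (u i)).symm)
      have h2 := hr.positive _ h1
      change 0 < su2.vec (E _ _) ⬝ᵥ su2.vec (E _ _) ⨯₃ su2.vec (E _ _) at h2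
      change 0 < su2.vec (e _) ⬝ᵥ su2.vec (e _) ⨯₃ su2.vec (e _)
      rw [su2.triple_product_eq (hE _ _) (hE _ _) (hE _ _)] at h2
      rw [su2.triple_product_eq (hemem _) (hemem _) (hemem _), he, he, he, SU2.conj_commutator,
        SU2.conj_mul, SU2.reTrace_conj]
      exact h2
  have h := LinearMap.congr_fun ((hroot p).unique key) v
  have h' : E p v = (g : Mat2) * E (B.act p g) (B.dact g p v) * ((g⁻¹ : SU2) : Mat2) :=
    su2.vec_injOn (hE p v) (hemem v) h
  rw [h']
  calc _ = 1 * E (B.act p g) (B.dact g p v) * 1 := by simp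
    _ = (((g⁻¹ : SU2) : Mat2) * (g : Mat2)) * E (B.act p g) (B.dact g p v) *
        (((g⁻¹ : SU2) : Mat2) * (g : Mat2)) := by rw [SU2.inv_mul_coe]
    _ = _ := by noncomm_ring

/-- Being a square root of the curvature is a pointwise condition: smoothness and equivariance are
automatic. -/
theorem IsConnection.isCurvatureRoot_iff (hW : B.IsConnection W) :
    B.IsCurvatureRoot vM W E ↔ (∀ p v, E p v ∈ su2) ∧
      ∀ p, B.IsRootAt vM W p (su2.vec ∘ₗ (E p).toLinearMap) := by
  constructor
  · rintro ⟨hb, hc, hp⟩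
    refine ⟨hb.mem_su2, fun p => ⟨fun ξ hξ => ?_, fun u v => ?_, fun u hu => ?_⟩⟩
    · change su2.vec (E p ξ) = 0
      rw [hb.horizontal p ξ hξ, map_zero]
    · rw [hc, wedgeSelf_apply]
      exact su2.vec_commutator (hb.mem_su2 p u) (hb.mem_su2 p v)
    · have h := hp p u hu
      rw [reTrace_wedgeCube (hb.mem_su2 p)] at h
      change 0 < su2.vec (E p _) ⬝ᵥ su2.vec (E p _) ⨯₃ su2.vec (E p _)
      linarith
  · rintro ⟨hE, hr⟩
    refine ⟨⟨hW.isSmoothForm_root hE hr, hE, fun p v hv => ?_, hW.root_equivariant hE hr⟩,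
      fun p => ?_, fun p u hu => ?_⟩
    · exact su2.vec_injOn (hE p v) su2.zero_mem (((hr p).horizontal v hv).trans (map_zero _).symm)
    · ext1 u
      have hu : u = ![u 0, u 1] := by ext i; fin_cases i <;> rfl
      rw [wedgeSelf_apply]
      refine su2.vec_injOn (hW.curvature_mem_su2 p u) (su2.commutator_mem (hE _ _) (hE _ _)) ?_
      rw [su2.vec_commutator (hE _ _) (hE _ _)]
      conv_lhs => rw [hu]
      exact (hr p).cross_eq _ _
    · rw [reTrace_wedgeCube (hE p)]
      have h := (hr p).positive u hu
      change 0 < su2.vec (E p _) ⬝ᵥ su2.vec (E p _) ⨯₃ su2.vec (E p _) at h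
      linarith

end PrincipalSU2Bundle

/-! ### The metric of a basic frame -/

/-- A positive definite form on a finite-dimensional space bounds its unit ball. -/
theorem isVonNBounded_of_posDef {V : Type*} [NormedAddCommGroup V] [NormedSpace ℝ V]
    [FiniteDimensional ℝ V] (G : V →L[ℝ] V →L[ℝ] ℝ) (h : ∀ v, v ≠ 0 → 0 < G v v) :
    Bornology.IsVonNBounded ℝ {v : V | G v v < 1} := by
  have : ProperSpace V := FiniteDimensional.proper ℝ V
  obtain ⟨c, hc, hG⟩ := (isCompact_sphere (0 : V) 1).exists_forall_le'
    (f := fun v => G v v) (a := 0) (G.continuous.clm_apply continuous_id).continuousOn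
    fun v hv => h v (ne_zero_of_mem_unit_sphere ⟨v, hv⟩)
  refine NormedSpace.isVonNBounded_iff' .. |>.2 ⟨√c⁻¹, fun v hv => ?_⟩
  rcases eq_or_ne v 0 with rfl | h0
  · simp
  have hn : 0 < ‖v‖ := norm_pos_iff.2 h0
  have h1 : c ≤ G (‖v‖⁻¹ • v) (‖v‖⁻¹ • v) := hG _ (by simp [norm_smul, hn.ne'])
  have h2 : G (‖v‖⁻¹ • v) (‖v‖⁻¹ • v) = (‖v‖ ^ 2)⁻¹ * G v v := by
    simp only [map_smul, smul_apply, smul_eq_mul]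
    field_simp
  have hv' : G v v < 1 := hv
  refine Real.le_sqrt_of_sq_le ?_
  rw [h2] at h1
  have h3 : c * ‖v‖ ^ 2 ≤ G v v := by
    calc c * ‖v‖ ^ 2 ≤ ((‖v‖ ^ 2)⁻¹ * G v v) * ‖v‖ ^ 2 := by gcongr
      _ = G v v := by field_simp
  rw [← mul_one c⁻¹, ← div_eq_inv_mul, le_div_iff₀ hc]
  linarith

/-- The version at a point of `contDiffOn_clm_apply`. -/
theorem contDiffAt_clm_of_apply {G V A : Type*} [NormedAddCommGroup G] [NormedSpace ℝ G]
    [NormedAddCommGroup V] [NormedSpace ℝ V] [NormedAddCommGroup A] [NormedSpace ℝ A]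
    [FiniteDimensional ℝ V] {n : ℕ∞ω} {f : G → V →L[ℝ] A} {z : G}
    (h : ∀ v, ContDiffAt ℝ n (fun y => f y v) z) : ContDiffAt ℝ n f z := by
  let e₁ := ContinuousLinearEquiv.ofFinrankEq
    (Module.finrank_fin_fun ℝ (n := Module.finrank ℝ V)).symm
  let e₂ := (e₁.arrowCongr (1 : A ≃L[ℝ] A)).trans
    (ContinuousLinearEquiv.piRing (Fin (Module.finrank ℝ V)))
  rw [← Function.id_comp f, ← e₂.symm_comp_self]
  exact e₂.symm.contDiff.contDiffAt.comp z (contDiffAt_pi.2 fun i => h _)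

/-- A field of bilinear forms is smooth if it is smooth in the charts. -/
theorem contMDiffAt_bilinear_field {d : ℕ} {X : Type*} [TopologicalSpace X]
    [ChartedSpace (EuclideanSpace ℝ (Fin d)) X] [IsManifold (𝓡 d) ∞ X]
    {g : ∀ x : X, TangentSpace (𝓡 d) x →L[ℝ] TangentSpace (𝓡 d) x →L[ℝ] ℝ} {x₀ : X}
    (h : ∀ v w : EuclideanSpace ℝ (Fin d), ContDiffAt ℝ ∞ (fun y =>
      g ((extChartAt (𝓡 d) x₀).symm y)
        (mfderiv 𝓘(ℝ, EuclideanSpace ℝ (Fin d)) (𝓡 d) (extChartAt (𝓡 d) x₀).symm y v)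
        (mfderiv 𝓘(ℝ, EuclideanSpace ℝ (Fin d)) (𝓡 d) (extChartAt (𝓡 d) x₀).symm y w))
      (extChartAt (𝓡 d) x₀ x₀)) :
    ContMDiffAt (𝓡 d) ((𝓡 d).prod 𝓘(ℝ, EuclideanSpace ℝ (Fin d) →L[ℝ]
      EuclideanSpace ℝ (Fin d) →L[ℝ] ℝ)) ∞ (fun x : X => Bundle.TotalSpace.mk'
        (E := fun x : X => TangentSpace (𝓡 d) x →L[ℝ] TangentSpace (𝓡 d) x →L[ℝ] ℝ)
        (EuclideanSpace ℝ (Fin d) →L[ℝ] EuclideanSpace ℝ (Fin d) →L[ℝ] ℝ) x (g x)) x₀ := by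
  have : IsManifold (𝓡 d) 1 X := IsManifold.of_le (n := ∞) (by simp)
  rw [Bundle.contMDiffAt_section]
  let D : EuclideanSpace ℝ (Fin d) → EuclideanSpace ℝ (Fin d) →L[ℝ] EuclideanSpace ℝ (Fin d) :=
    fun y => mfderiv 𝓘(ℝ, EuclideanSpace ℝ (Fin d)) (𝓡 d) (extChartAt (𝓡 d) x₀).symm y
  let G : X → EuclideanSpace ℝ (Fin d) →L[ℝ] EuclideanSpace ℝ (Fin d) →L[ℝ] ℝ := g
  have hf : ContDiffAt ℝ ∞ (fun y => (G ((extChartAt (𝓡 d) x₀).symm y)).bilinearComp (D y) (D y))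
      (extChartAt (𝓡 d) x₀ x₀) :=
    contDiffAt_clm_of_apply fun v => contDiffAt_clm_of_apply fun w => h v w
  refine (hf.contMDiffAt.comp x₀
    (contMDiffAt_extChartAt (I := 𝓡 d) (x := x₀))).congr_of_eventuallyEq ?_
  filter_upwards [(chartAt (EuclideanSpace ℝ (Fin d)) x₀).open_source.mem_nhds
    (mem_chart_source _ x₀)] with x hx
  ext v w
  have hx' : x ∈ (trivializationAt (EuclideanSpace ℝ (Fin d)) (TangentSpace (𝓡 d)) x₀).baseSet := hx
  have hsymmL := TangentBundle.symmL_trivializationAt (I := 𝓡 d) hx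
  rw [ModelWithCorners.range_eq_univ, mfderivWithin_univ] at hsymmL
  rw [hom_trivializationAt_apply]
  refine (inCoordinates_apply_eq₂ hx' hx' (by trivial)).trans ?_
  have hD : ∀ a : EuclideanSpace ℝ (Fin d),
      (trivializationAt (EuclideanSpace ℝ (Fin d)) (TangentSpace (𝓡 d)) x₀).symm x a =
        D (extChartAt (𝓡 d) x₀ x) a := fun a =>
    ((trivializationAt (EuclideanSpace ℝ (Fin d)) (TangentSpace (𝓡 d)) x₀).symmL_apply
      (R := ℝ) hx' a).symm.trans
      (congrArg (fun L : EuclideanSpace ℝ (Fin d) →L[ℝ] EuclideanSpace ℝ (Fin d) => L a) hsymmL)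
  have hGx : G ((extChartAt (𝓡 d) x₀).symm (extChartAt (𝓡 d) x₀ x)) = G x :=
    congrArg G ((extChartAt (𝓡 d) x₀).left_inv (by rwa [extChartAt_source]))
  refine Eq.trans ?_ (congrArg (fun L : EuclideanSpace ℝ (Fin d) →L[ℝ] EuclideanSpace ℝ (Fin d)
    →L[ℝ] ℝ => L (D _ v) (D _ w)) hGx.symm)
  refine Eq.trans ?_ (congrArg₂ (fun a b : EuclideanSpace ℝ (Fin d) => G x a b) (hD v) (hD w))
  exact LinearMap.congr_fun (Bundle.Trivial.linearMapAt_trivialization ℝ X ℝ x) _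

namespace PrincipalSU2Bundle

variable {P M : Type*}
  [TopologicalSpace P] [ChartedSpace (EuclideanSpace ℝ (Fin 6)) P] [IsManifold (𝓡 6) ∞ P]
  [TopologicalSpace M] [ChartedSpace (EuclideanSpace ℝ (Fin 3)) M] [IsManifold (𝓡 3) ∞ M]
  {B : PrincipalSU2Bundle P M} {E : OneForm 6 P Mat2}

/-- The group acts transitively on the fibres. -/
theorem exists_act_eq {p q : P} (h : B.proj q = B.proj p) : ∃ g, B.act p g = q := by
  obtain ⟨e, hx, -, -, he⟩ := B.locally_trivial (B.proj p)
  have hp : p ∈ e.source := e.mem_source.2 hx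
  have hq : q ∈ e.source := e.mem_source.2 (h ▸ hx)
  have ha : B.act p ((e p).2⁻¹ * (e q).2) ∈ e.source :=
    e.mem_source.2 ((B.proj_act p _).symm ▸ hx)
  refine ⟨_, e.injOn ha hq (Prod.ext ?_ ?_)⟩
  · change (e _).1 = (e _).1
    rw [e.coe_fst ha, e.coe_fst hq, B.proj_act, h]
  · change (e _).2 = (e _).2
    rw [he p hp, mul_inv_cancel_left]

/-- The product `Tr (E ⊗ E)` descends to the base. -/
theorem IsBasic.reTrace_mul_eq (hE : B.IsBasic E) {p q : P} (h : B.proj q = B.proj p)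
    {u v : TangentSpace (𝓡 6) p} {u' v' : TangentSpace (𝓡 6) q}
    (hu : (B.dproj q u' : EuclideanSpace ℝ (Fin 3)) = B.dproj p u)
    (hv : (B.dproj q v' : EuclideanSpace ℝ (Fin 3)) = B.dproj p v) :
    reTrace (E q u' * E q v') = reTrace (E p u * E p v) := by
  obtain ⟨g, rfl⟩ := exists_act_eq h
  have key : ∀ {a : TangentSpace (𝓡 6) p} {a' : TangentSpace (𝓡 6) (B.act p g)},
      (B.dproj _ a' : EuclideanSpace ℝ (Fin 3)) = B.dproj p a →
        E (B.act p g) a' = ((g⁻¹ : SU2) : Mat2) * E p a * g := by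
    intro a a' ha
    rw [← hE.equivariant]
    refine sub_eq_zero.1 ((map_sub _ _ _).symm.trans (hE.horizontal _ _ ?_))
    refine (map_sub (B.dproj _) _ _).trans (sub_eq_zero.2 ?_)
    exact ha.trans (B.dproj_dact g p a).symm
  rw [key hu, key hv, SU2.reTrace_conj_mul_conj]

/-- The form on the tangent space of the base is that of any linear right inverse of the
projection. -/
theorem IsBasic.exists_form (hE : B.IsBasic E) (x : M) :
    ∃ G : EuclideanSpace ℝ (Fin 3) →L[ℝ] EuclideanSpace ℝ (Fin 3) →L[ℝ] ℝ,
      ∀ p, B.proj p = x → ∀ u v : TangentSpace (𝓡 6) p,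
        G (B.dproj p u) (B.dproj p v) = -2 * reTrace (E p u * E p v) := by
  obtain ⟨p, rfl⟩ := B.proj_surjective x
  obtain ⟨l, hl⟩ := LinearMap.exists_rightInverse_of_surjective (B.dproj p).toLinearMap
    (LinearMap.range_eq_top.2 (B.dproj_surjective p))
  have hl' : ∀ a, B.dproj p (l a) = a := fun a => LinearMap.congr_fun hl a
  let L : EuclideanSpace ℝ (Fin 3) →L[ℝ] Mat2 :=
    LinearMap.toContinuousLinearMap ((E p).toLinearMap ∘ₗ l : EuclideanSpace ℝ (Fin 3) →ₗ[ℝ] Mat2)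
  let r : Mat2 →L[ℝ] ℝ := LinearMap.toContinuousLinearMap ((-2 : ℝ) • reTrace)
  refine ⟨(ContinuousLinearMap.compL ℝ (EuclideanSpace ℝ (Fin 3)) Mat2 ℝ r).comp
    ((ContinuousLinearMap.mul ℝ Mat2).bilinearComp L L), fun q hq u v => ?_⟩
  rw [hE.reTrace_mul_eq (u := l (B.dproj q u)) (v := l (B.dproj q v)) hq (hl' _).symm (hl' _).symm]
  rfl

/-- The form on the base is smooth: a local section `s` pulls `E` back to a smooth frame. -/
theorem IsBasic.contMDiff_form (hE : B.IsBasic E)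
    {G : ∀ x : M, TangentSpace (𝓡 3) x →L[ℝ] TangentSpace (𝓡 3) x →L[ℝ] ℝ}
    (hG : ∀ (x : M) (p : P), B.proj p = x → ∀ u v : TangentSpace (𝓡 6) p,
      (G x : EuclideanSpace ℝ (Fin 3) →L[ℝ] EuclideanSpace ℝ (Fin 3) →L[ℝ] ℝ)
        (B.dproj p u) (B.dproj p v) = -2 * reTrace (E p u * E p v)) :
    ContMDiff (𝓡 3) ((𝓡 3).prod 𝓘(ℝ, EuclideanSpace ℝ (Fin 3) →L[ℝ]
      EuclideanSpace ℝ (Fin 3) →L[ℝ] ℝ)) ∞ (fun x : M => Bundle.TotalSpace.mk'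
        (E := fun x : M => TangentSpace (𝓡 3) x →L[ℝ] TangentSpace (𝓡 3) x →L[ℝ] ℝ)
        (EuclideanSpace ℝ (Fin 3) →L[ℝ] EuclideanSpace ℝ (Fin 3) →L[ℝ] ℝ) x (G x)) := by
  intro x₀
  refine contMDiffAt_bilinear_field fun v w => ?_
  have hx₀ := mem_extChartAt_source (I := 𝓡 3) x₀
  set φ := extChartAt (𝓡 3) x₀ with hφ
  obtain ⟨p, hp⟩ := B.proj_surjective x₀
  obtain ⟨s, -, hs, hps⟩ := B.exists_local_section x₀ p hp
  have htarget := (isOpen_extChartAt_target (I := 𝓡 3) x₀).mem_nhds (φ.map_source hx₀)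
  have hsymm₀ : ContMDiffAt 𝓘(ℝ, EuclideanSpace ℝ (Fin 3)) (𝓡 3) ∞ φ.symm (φ x₀) :=
    contMDiffAt_extChartAt_symm x₀ (φ.map_source hx₀)
  have hback : Filter.Tendsto φ.symm (nhds (φ x₀)) (nhds x₀) := by
    have := hsymm₀.continuousAt
    rwa [ContinuousAt, φ.left_inv hx₀] at this
  -- the metric in the chart is computed from the pullback of `E` by the local section
  have hη : ContDiffAt ℝ ∞ (pullbackForm (toDiffForm E) (s ∘ φ.symm)) (φ x₀) := by
    refine contDiffAt_pullbackForm hE.smooth ?_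
    filter_upwards [htarget, hback.eventually hs] with y h1 h2
    exact h2.comp y (contMDiffAt_extChartAt_symm x₀ h1)
  have hv : ∀ v : EuclideanSpace ℝ (Fin 3), ContDiffAt ℝ ∞
      (fun y => pullbackForm (toDiffForm E) (s ∘ φ.symm) y (fun _ => v)) (φ x₀) := fun v =>
    ContDiffAt.alternating_apply hη (v := fun _ _ => v) fun _ => contDiffAt_const
  have hr : ContDiff ℝ ∞ reTrace := (LinearMap.toContinuousLinearMap reTrace).contDiff
  refine (contDiffAt_const (c := (-2 : ℝ)).mul
    (hr.contDiffAt.comp _ ((hv v).mul (hv w)))).congr_of_eventuallyEq ?_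
  filter_upwards [htarget, hback.eventually hs, hback.eventually hps.eventually_nhds]
    with y h1 h2 h3
  have hy := contMDiffAt_extChartAt_symm x₀ h1
  have hd : ∀ a : EuclideanSpace ℝ (Fin 3),
      mfderiv 𝓘(ℝ, EuclideanSpace ℝ (Fin 3)) (𝓡 6) (s ∘ φ.symm) y a =
        mfderiv (𝓡 3) (𝓡 6) s (φ.symm y)
          (mfderiv 𝓘(ℝ, EuclideanSpace ℝ (Fin 3)) (𝓡 3) φ.symm y a) := fun a =>
    mfderiv_comp_apply (I := 𝓘(ℝ, EuclideanSpace ℝ (Fin 3))) (I' := 𝓡 3) (I'' := 𝓡 6) y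
      (h2.mdifferentiableAt (by simp)) (hy.mdifferentiableAt (by simp)) a
  have hl : ∀ a : EuclideanSpace ℝ (Fin 3),
      (B.dproj (s (φ.symm y)) (mfderiv 𝓘(ℝ, EuclideanSpace ℝ (Fin 3)) (𝓡 6) (s ∘ φ.symm) y a) :
        EuclideanSpace ℝ (Fin 3)) =
        mfderiv 𝓘(ℝ, EuclideanSpace ℝ (Fin 3)) (𝓡 3) φ.symm y a := fun a => by
    rw [hd]
    exact B.dproj_mfderiv_section h2 h3 _
  refine Eq.trans ?_ (hG (φ.symm y) (s (φ.symm y)) h3.self_of_nhds _ _)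
  exact congrArg₂ (fun a b : EuclideanSpace ℝ (Fin 3) => (G (φ.symm y) :
    EuclideanSpace ℝ (Fin 3) →L[ℝ] EuclideanSpace ℝ (Fin 3) →L[ℝ] ℝ) a b) (hl v).symm (hl w).symm

/-- A basic 1-form `E` that vanishes only on vertical vectors is a frame for a smooth metric on the
base. -/
theorem IsBasic.exists_metric (hE : B.IsBasic E) (h0 : ∀ p v, E p v = 0 → v ∈ B.vertical p) :
    ∃ g : Bundle.ContMDiffRiemannianMetric (𝓡 3) ∞ (EuclideanSpace ℝ (Fin 3))
        (fun x : M => TangentSpace (𝓡 3) x), B.IsFrame g.inner E := by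
  have hform : ∀ x : M, ∃ G : TangentSpace (𝓡 3) x →L[ℝ] TangentSpace (𝓡 3) x →L[ℝ] ℝ,
      ∀ p, B.proj p = x → ∀ u v : TangentSpace (𝓡 6) p,
        (G : EuclideanSpace ℝ (Fin 3) →L[ℝ] EuclideanSpace ℝ (Fin 3) →L[ℝ] ℝ)
          (B.dproj p u) (B.dproj p v) = -2 * reTrace (E p u * E p v) := hE.exists_form
  choose G hG using hform
  have hsymm : ∀ x v w, G x v w = G x w v := by
    intro x v w
    obtain ⟨p, rfl⟩ := B.proj_surjective x
    obtain ⟨v, rfl⟩ := B.dproj_surjective p v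
    obtain ⟨w, rfl⟩ := B.dproj_surjective p w
    rw [hG _ p rfl, hG _ p rfl, su2.reTrace_mul (hE.mem_su2 _ _) (hE.mem_su2 _ _),
      su2.reTrace_mul (hE.mem_su2 _ _) (hE.mem_su2 _ _), dotProduct_comm]
  have hpos : ∀ x v, v ≠ 0 → 0 < G x v v := by
    intro x v hv
    obtain ⟨p, rfl⟩ := B.proj_surjective x
    obtain ⟨v, rfl⟩ := B.dproj_surjective p v
    rw [hG _ p rfl, su2.reTrace_mul (hE.mem_su2 _ _) (hE.mem_su2 _ _)]
    have h1 : su2.vec (E p v) ≠ 0 := fun h =>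
      hv (h0 p v (su2.vec_injOn (hE.mem_su2 _ _) su2.zero_mem (h.trans (map_zero _).symm)))
    have h2 : 0 < su2.vec (E p v) ⬝ᵥ su2.vec (E p v) := by
      simpa using Matrix.dotProduct_star_self_pos_iff.2 h1
    linarith
  have hbdd : ∀ x, Bornology.IsVonNBounded ℝ {v : TangentSpace (𝓡 3) x | G x v v < 1} := fun x =>
    isVonNBounded_of_posDef (V := EuclideanSpace ℝ (Fin 3)) (G x) (hpos x)
  exact ⟨⟨G, hsymm, hpos, hbdd, hE.contMDiff_form hG⟩, hE,
    fun p u v => hG _ p rfl u v⟩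

end PrincipalSU2Bundle

/-! ### The connection and the metric determined by the almost-complex structure -/

namespace PrincipalSU2Bundle

variable {P M : Type*}
  [TopologicalSpace P] [ChartedSpace (EuclideanSpace ℝ (Fin 6)) P] [IsManifold (𝓡 6) ∞ P]
  [TopologicalSpace M] [ChartedSpace (EuclideanSpace ℝ (Fin 3)) M] [IsManifold (𝓡 3) ∞ M]
  {B : PrincipalSU2Bundle P M} {W W' : OneForm 6 P Mat2} {J : EndField P}

/-- A connection is determined by its horizontal spaces. -/
theorem IsConnection.eq_of_ker_eq (hW : B.IsConnection W) (hW' : B.IsConnection W')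
    (h : ∀ p, LinearMap.ker (W' p).toLinearMap = LinearMap.ker (W p).toLinearMap) : W' = W := by
  funext p
  ext1 ξ
  set X : su2 := ⟨W p ξ, hW.mem_su2 p ξ⟩
  have h1 : ξ - B.fundamental X p ∈ LinearMap.ker (W' p).toLinearMap := by
    rw [h p]
    change W p (ξ - B.fundamental X p) = 0
    rw [map_sub, hW.fundamental, sub_self]
  have h2 : W' p (ξ - B.fundamental X p) = 0 := h1
  rw [map_sub, hW'.fundamental, sub_eq_zero] at h2
  exact h2

/-- A form determined by `J` is unique, if `J(V)` is a complement of the vertical spaces. -/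
theorem IsConnectionOf.isMetricOf_unique (hW : B.IsConnectionOf J W)
    (hJ : ∀ p v, J p (J p v) = -v)
    {g g' : ∀ x : M, TangentSpace (𝓡 3) x →L[ℝ] TangentSpace (𝓡 3) x →L[ℝ] ℝ}
    (hg : B.IsMetricOf J g) (hg' : B.IsMetricOf J g') : g' = g := by
  have key : ∀ p (u : TangentSpace (𝓡 3) (B.proj p)), ∃ ξ ∈ (B.vertical p).map (J p),
      B.dproj p ξ = u ∧ ∃ X : su2, J p ξ = B.fundamental X p := by
    intro p u
    obtain ⟨ξ, rfl⟩ := B.dproj_surjective p u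
    set X : su2 := ⟨W p ξ, hW.1.mem_su2 p ξ⟩
    have h1 : ξ - B.fundamental X p ∈ (B.vertical p).map (J p) := by
      rw [← hW.2 p]
      change W p (ξ - B.fundamental X p) = 0
      rw [map_sub, hW.1.fundamental, sub_self]
    have h2 : B.dproj p (B.fundamental X p) = 0 := B.fundamental_mem_vertical X p
    refine ⟨_, h1, by rw [map_sub, h2, sub_zero], ?_⟩
    obtain ⟨v, hv, h3⟩ := h1
    rw [← h3, hJ]
    exact ⟨_, (hW.1.fundamental_eq ((B.vertical p).neg_mem hv)).symm⟩
  funext x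
  obtain ⟨p, rfl⟩ := B.proj_surjective x
  ext u v
  obtain ⟨ξ, hξ, rfl, X, hX⟩ := key p u
  obtain ⟨η, hη, rfl, Y, hY⟩ := key p v
  rw [hg p ξ hξ η hη X Y hX hY, hg' p ξ hξ η hη X Y hX hY]

end PrincipalSU2Bundle

end

theorem proposition1 {P M : Type*}
    [TopologicalSpace P] [ChartedSpace (EuclideanSpace ℝ (Fin 6)) P] [IsManifold (𝓡 6) ∞ P]
    [TopologicalSpace M] [ChartedSpace (EuclideanSpace ℝ (Fin 3)) M] [IsManifold (𝓡 3) ∞ M]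
    (B : PrincipalSU2Bundle P M) (vP : VolumeForm 6 P) (vM : VolumeForm 3 M)
    (W : OneForm 6 P Mat2) (hW : B.IsNegativeDefinite W) :
    (∀ p v, PrincipalSU2Bundle.almostComplex vP W p
      (PrincipalSU2Bundle.almostComplex vP W p v) = -v) ∧
    (∀ W' : OneForm 6 P Mat2,
      B.IsConnectionOf (PrincipalSU2Bundle.almostComplex vP W) W' ↔ W' = W) ∧
    ∃ E : OneForm 6 P Mat2,
      (∀ E' : OneForm 6 P Mat2, B.IsCurvatureRoot vM W E' ↔ E' = E) ∧
      ∃ g : Bundle.ContMDiffRiemannianMetric (𝓡 3) ∞ (EuclideanSpace ℝ (Fin 3))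
          (fun x : M => TangentSpace (𝓡 3) x),
        (∀ g' : ∀ x : M, TangentSpace (𝓡 3) x →L[ℝ] TangentSpace (𝓡 3) x →L[ℝ] ℝ,
          B.IsMetricOf (PrincipalSU2Bundle.almostComplex vP W) g' ↔ g' = g.inner) ∧
        B.IsFrame g.inner E := by
  choose e he h0 hJ ε hε hWJ heJ using hW.exists_root vP vM
  set J := PrincipalSU2Bundle.almostComplex vP W with hJdef
  have hC := hW.1
  -- `W` vanishes exactly on `J(V)`, since `W ∘ J = ∓ e` and `e` vanishes exactly on `V`
  have hker : B.IsConnectionOf J W := by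
    refine ⟨hC, fun p => Submodule.ext fun ξ => ⟨fun hξ => ?_, ?_⟩⟩
    · have h1 : e p (J p ξ) = 0 := by
        rw [heJ, show W p ξ = 0 from hξ, map_zero, smul_zero]
      exact ⟨-J p ξ, (B.vertical p).neg_mem (h0 p _ h1), by rw [map_neg, hJ, neg_neg]⟩
    · rintro ⟨v, hv, rfl⟩
      refine su2.vec_injOn (hC.mem_su2 p _) su2.zero_mem ?_
      change su2.vec (W p (J p v)) = _
      rw [hWJ, (he p).horizontal v hv, smul_zero, map_zero]
  obtain ⟨E, hE⟩ : ∃ E : OneForm 6 P Mat2, ∀ p v, E p v = su2.ofVec (e p v) := by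
    let e' : P → EuclideanSpace ℝ (Fin 6) →ₗ[ℝ] Fin 3 → ℝ := e
    let E' : P → EuclideanSpace ℝ (Fin 6) →L[ℝ] Mat2 := fun p =>
      LinearMap.toContinuousLinearMap (su2.ofVec ∘ₗ e' p)
    exact ⟨E', fun p v => rfl⟩
  have hEe' : ∀ p v, su2.vec (E p v) = e p v := fun p v => by rw [hE, su2.vec_ofVec]
  have hEe : ∀ p, su2.vec ∘ₗ (E p).toLinearMap = e p := fun p => LinearMap.ext (hEe' p)
  have hEmem : ∀ p v, E p v ∈ su2 := fun p v => by rw [hE]; exact su2.ofVec_mem (e p v)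
  have hroot : B.IsCurvatureRoot vM W E :=
    hC.isCurvatureRoot_iff.2 ⟨hEmem, fun p => by rw [hEe]; exact he p⟩
  obtain ⟨g, hg⟩ := hroot.basic.exists_metric fun p v hv =>
    h0 p v (by rw [← hEe', hv, map_zero])
  have hgJ : B.IsMetricOf J g.inner := by
    intro p ξ _ η _ X Y hX hY
    have h1 : ∀ (ζ) (Z : su2), J p ζ = B.fundamental Z p → su2.vec (Z : Mat2) = -ε p • e p ζ := by
      intro ζ Z hZ
      rw [← hWJ, hZ, hC.fundamental]
    rw [hg.2 p ξ η, su2.reTrace_mul (hEmem p ξ) (hEmem p η), su2.reTrace_mul X.2 Y.2, h1 ξ X hX,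
      h1 η Y hY, hEe', hEe', smul_dotProduct, dotProduct_smul, smul_smul, neg_mul_neg, hε, one_smul]
  refine ⟨hJ, fun W' => ⟨fun h => hC.eq_of_ker_eq h.1 fun p => (h.2 p).trans (hker.2 p).symm,
    fun h => h ▸ hker⟩, E, fun E' => ⟨fun h => ?_, fun h => h ▸ hroot⟩, g,
    fun g' => ⟨hker.isMetricOf_unique hJ hgJ, fun h => h ▸ hgJ⟩, hg⟩
  obtain ⟨hmem, hr⟩ := hC.isCurvatureRoot_iff.1 h
  funext p
  ext1 v
  refine su2.vec_injOn (hmem p v) (hEmem p v) ?_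
  rw [hEe']
  exact LinearMap.congr_fun ((hr p).unique (he p)) v
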